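/- Let $R$ be a commutative ring in which $2$ is invertible and let $z\in R$ (for instance $R=\mathbb Z[\tfrac12][z]$ with $z$ an indeterminate). For $k\ge 0$ let $\mathcal A_k(z)$ be the partition algebra: the free $R$-module on the set partitions of $\{1,\dots,k,1',\dots,k'\}$ with product $\rho_1\rho_2=z^{\ell}\,\rho_1\circ\rho_2$, where $\rho_1\circ\rho_2$ is obtained by placing $\rho_1$ above $\rho_2$, identifying the bottom row of $\rho_1$ with the top row of $\rho_2$, and removing the $\ell$ blocks that lie entirely in the middle row. For $i\le k$ regard $\mathcal A_i(z)\subseteq\mathcal A_k(z)$ by adding the blocks $\{m,m'\}$, $i<m\le k$; for $i+1\le k$ let $\mathcal A_{i+\frac12}(z)\subseteq\mathcal A_{i+1}(z)$ be the span of the set partitions in which $i+1$ and $(i+1)'$ lie in the same block. Let $p_i$ be the diagram with blocks $\{i\},\{i'\}$ and $\{m,m'\}$ for $m\ne i$; let $p_{i+\frac12}$ be the diagram with blocks $\{i,i+1,i',(i+1)'\}$ and $\{m,m'\}$ for $m\neq i,i+1$; let $s_i$ be the diagram with blocks $\{i,(i+1)'\},\{i+1,i'\}$ and $\{m,m'\}$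 for $m\neq i,i+1$. Define $L_0=0$, $L_1=p_1$, $\sigma_1=1$, $\sigma_2=s_1$, $L_{\frac12}=0$, $\sigma_{\frac12}=\sigma_{1+\frac12}=1$, and, for $i\ge1$, $$L_{i+1}=-s_iL_ip_{i+\frac12}-p_{i+\frac12}L_is_i+p_{i+\frac12}L_ip_{i+1}p_{i+\frac12}+s_iL_is_i+\sigma_{i+1},$$ $$L_{i+\frac12}=-L_ip_{i+\frac12}-p_{i+\frac12}L_i+p_{i+\frac12}L_ip_ip_{i+\frac12}+s_iL_{i-\frac12}s_i+\sigma_{i+\frac12},$$ where, for $i\ge2$, $$\sigma_{i+1}=s_{i-1}s_i\sigma_is_is_{i-1}+s_ip_{i-\frac12}L_{i-1}s_ip_{i-\frac12}s_i+p_{i-\frac12}L_{i-1}s_ip_{i-\frac12}-s_ip_{i-\frac12}L_{i-1}s_{i-1}p_{i+\frac12}p_ip_{i-\frac12}-p_{i-\frac12}p_ip_{i+\frac12}s_{i-1}L_{i-1}p_{i-\frac12}s_i,$$ $$\sigma_{i+\frac12}=s_{i-1}s_i\sigma_{i-\frac12}s_is_{i-1}+p_{i-\frac12}L_{i-1}s_ip_{i-\frac12}s_i+s_ip_{i-\frac12}L_{i-1}s_ip_{i-\frac12}-p_{i-\frac12}L_{i-1}s_{i-1}p_{i+\frac12}p_ip_{i-\frac12}-s_ip_{i-\frac12}p_ip_{i+\frac12}s_{i-1}L_{i-1}p_{i-\frac12}s_i.$$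 Put $x_i=L_i-\frac z2$ and $x_{i+\frac12}=L_{i+\frac12}-\frac z2$. In the following, the identities involving index $i$ are understood in $\mathcal A_k(z)$ for any $k$ such that all the diagrams involved are defined, that is, $k\ge i+1$ for statements on $x^{(j)}_{i+\frac12}$ and $W_{i+\frac12}$, and $k\ge i+2$ for statements on $x^{(j)}_{i+1}$ and $W_{i+1}$. For all $i\ge0$ there are unique elements $x^{(j)}_{i+\frac12}\in\mathcal A_i(z)$ and $x^{(j)}_{i+1}\in\mathcal A_{i+\frac12}(z)$, $j=0,1,2,\dots$, such that $$x^{(j)}_{i+\frac12}p_{i+1}=p_{i+1}(x_{i+\frac12})^jp_{i+1},\qquad x^{(j)}_{i+1}p_{i+\frac32}=p_{i+\frac32}(x_{i+1})^jp_{i+\frac32},$$ and they are central in $\mathcal A_i(z)$ and in $\mathcal A_{i+\frac12}(z)$ respectively. Let $u$ be a formal variable and put $$W_{i+\frac12}(u)=u^{-1}\sum_{j\ge0}x^{(j)}_{i+\frac12}u^{-j},\qquad W_{i+1}(u)=\sum_{j\ge0}x^{(j)}_{i+1}u^{-j}.$$ Then, for all $i\ge1$, in the ring $\mathcal A_k(z)((u^{-1}))$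 of formal Laurent series in $u^{-1}$, $$\frac{W_{i+\frac12}(u)+(\frac z2-u-1)}{W_{i-\frac12}(u)+(\frac z2-u-1)}=\frac{(u+x_i)^2-1}{(u-x_{i-\frac12})^2-1}\cdot\frac{(u-x_{i-\frac12})^2}{(u+x_i)^2}$$ and $$\frac{W_{i+1}(u)}{W_i(u)}=\frac{(u+x_{i+\frac12})^2-1}{(u-x_i)^2-1}\cdot\frac{(u-x_i)^2}{(u+x_{i+\frac12})^2},$$ where in each of the six fractions the denominator is invertible and commutes with the numerator. -/

import Mathlib

noncomputable section

namespace PartAlg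

/-! ### Partition diagrams and their composition -/

/-- A partition diagram on `2k` vertices: a set partition (equivalence relation) of
`{1, …, k} ∪ {1', …, k'}`.  The vertex `m` of the top row is `(0, m - 1)` and the vertex `m'` of the
bottom row is `(1, m - 1)`. -/
abbrev Diagram (k : ℕ) := Setoid (Fin 2 × Fin k)

/-- The map of vertices induced by a map of rows. -/
def rowMap {m n : ℕ} (k : ℕ) (α : Fin m → Fin n) : Fin m × Fin k → Fin n × Fin k :=
  Prod.map α id

/-- `a` placed above `b`, with the bottom row of `a` identified with the top row of `b`: the
equivalence relation on three rows of vertices generated by `a` on rows `0, 1` and `b` on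
rows `1, 2`. -/
def stack {k : ℕ} (a b : Diagram k) : Setoid (Fin 3 × Fin k) :=
  a.map (rowMap k ![0, 1]) ⊔ b.map (rowMap k ![1, 2])

/-- The composition `a ∘ b`: restrict the stacked diagram to the top and bottom rows. -/
def comp {k : ℕ} (a b : Diagram k) : Diagram k :=
  (stack a b).comap (rowMap k ![0, 2])

/-- The set of classes of `r` which contain no vertex of `S`. -/
def hidden {V : Type*} (r : Setoid V) (S : Set V) : Set (Quotient r) :=
  {q | ∀ v, Quotient.mk r v = q → v ∉ S}

/-- The number of blocks of the stacked diagram lying entirely in the middle row, which are removed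
in the composition `a ∘ b`. -/
def loops {k : ℕ} (a b : Diagram k) : ℕ :=
  (hidden (stack a b) {v | v.1 ≠ 1}).ncard

/-- The identity diagram, with blocks `{m, m'}`. -/
def idDiagram (k : ℕ) : Diagram k := Setoid.ker Prod.snd

/-! ### Associativity of the composition product -/

section Aux

variable {U V W Z : Type*}

theorem map_rel {r : Setoid V} {g : V → W} (hg : g.Injective) (x y : W) :
    r.map g x y ↔ x = y ∨ ∃ a b, r a b ∧ g a = x ∧ g b = y := by
  constructor
  · intro h
    induction h with
    | rel x y h => obtain ⟨a, b, h1, h2, h3⟩ := h; exact Or.inr ⟨a, b, h1, h2, h3⟩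
    | refl x => exact Or.inl rfl
    | symm x y _ ih =>
      rcases ih with rfl | ⟨a, b, h1, h2, h3⟩
      · exact Or.inl rfl
      · exact Or.inr ⟨b, a, r.symm h1, h3, h2⟩
    | trans x y z _ _ ih1 ih2 =>
      rcases ih1 with rfl | ⟨a, b, h1, rfl, rfl⟩
      · exact ih2
      · rcases ih2 with rfl | ⟨c, d, h2, h3, rfl⟩
        · exact Or.inr ⟨a, b, h1, rfl, rfl⟩
        · obtain rfl := hg h3
          exact Or.inr ⟨a, d, r.trans h1 h2, rfl, rfl⟩
  · rintro (rfl | ⟨a, b, h, rfl, rfl⟩)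
    · exact (r.map g).refl _
    · exact Relation.EqvGen.rel _ _ ⟨a, b, h, rfl, rfl⟩

theorem map_le {r : Setoid V} {g : V → W} {s : Setoid W} : r.map g ≤ s ↔ r ≤ s.comap g := by
  constructor
  · intro h x y hxy
    exact h (Relation.EqvGen.rel _ _ ⟨x, y, hxy, rfl, rfl⟩)
  · intro h x y hxy
    induction hxy with
    | rel x y h' => obtain ⟨a, b, h1, rfl, rfl⟩ := h'; exact h h1
    | refl x => exact s.refl _
    | symm x y _ ih => exact s.symm ih
    | trans x y z _ _ ih1 ih2 => exact s.trans ih1 ih2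

theorem map_map (r : Setoid U) (f : U → V) (g : V → W) :
    (r.map f).map g = r.map (g ∘ f) := by
  apply le_antisymm
  · rw [map_le, map_le]
    exact fun x y h => Setoid.le_comap_map (f := g ∘ f) h
  · rw [map_le]
    exact fun x y h => (Setoid.le_comap_map (f := g)) ((Setoid.le_comap_map (f := f)) h)

theorem map_sup (r s : Setoid V) (g : V → W) : (r ⊔ s).map g = r.map g ⊔ s.map g := by
  apply le_antisymm
  · rw [map_le]
    exact sup_le (map_le.1 le_sup_left) (map_le.1 le_sup_right)
  · exact sup_le (map_le.2 (le_sup_left.trans Setoid.le_comap_map))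
      (map_le.2 (le_sup_right.trans Setoid.le_comap_map))

/-- A path in `P ⊔ f(C)` starting at `v` can be replaced by a path in `Z` followed by a
`P`-step. -/
theorem sup_map_rel {P : Setoid V} {C : Setoid Z} {f : Z → V} {v w : V}
    (h : (P ⊔ C.map f) v w) :
    P v w ∨ ∃ x y, P v (f x) ∧ (P.comap f ⊔ C) x y ∧ P (f y) w := by
  rw [Setoid.sup_def] at h
  induction h with
  | rel v w h =>
    rcases h with h | h
    · exact Or.inl h
    · have : C.map f ≤ P ⊔ C.map f := le_sup_right
      clear this
      induction h with
      | rel v w h =>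
        obtain ⟨a, b, h1, rfl, rfl⟩ := h
        exact Or.inr ⟨a, b, P.refl _, (le_sup_right : C ≤ P.comap f ⊔ C) h1, P.refl _⟩
      | refl v => exact Or.inl (P.refl _)
      | symm v w _ ih =>
        rcases ih with ih | ⟨x, y, h1, h2, h3⟩
        · exact Or.inl (P.symm ih)
        · exact Or.inr ⟨y, x, P.symm h3, Setoid.symm' _ h2, P.symm h1⟩
      | trans u v w _ _ ih1 ih2 =>
        rcases ih1 with ih1 | ⟨x, y, h1, h2, h3⟩
        · rcases ih2 with ih2 | ⟨x', y', h1', h2', h3'⟩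
          · exact Or.inl (P.trans ih1 ih2)
          · exact Or.inr ⟨x', y', P.trans ih1 h1', h2', h3'⟩
        · rcases ih2 with ih2 | ⟨x', y', h1', h2', h3'⟩
          · exact Or.inr ⟨x, y, h1, h2, P.trans h3 ih2⟩
          · exact Or.inr ⟨x, y', h1, Setoid.trans' _ h2 (Setoid.trans' _
              ((le_sup_left : P.comap f ≤ P.comap f ⊔ C) (P.trans h3 h1')) h2'), h3'⟩
  | refl v => exact Or.inl (P.refl _)
  | symm v w _ ih =>
    rcases ih with ih | ⟨x, y, h1, h2, h3⟩
    · exact Or.inl (P.symm ih)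
    · exact Or.inr ⟨y, x, P.symm h3, Setoid.symm' _ h2, P.symm h1⟩
  | trans u v w _ _ ih1 ih2 =>
    rcases ih1 with ih1 | ⟨x, y, h1, h2, h3⟩
    · rcases ih2 with ih2 | ⟨x', y', h1', h2', h3'⟩
      · exact Or.inl (P.trans ih1 ih2)
      · exact Or.inr ⟨x', y', P.trans ih1 h1', h2', h3'⟩
    · rcases ih2 with ih2 | ⟨x', y', h1', h2', h3'⟩
      · exact Or.inr ⟨x, y, h1, h2, P.trans h3 ih2⟩
      · exact Or.inr ⟨x, y', h1, Setoid.trans' _ h2 (Setoid.trans' _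
          ((le_sup_left : P.comap f ≤ P.comap f ⊔ C) (P.trans h3 h1')) h2'), h3'⟩

theorem comap_sup_map (P : Setoid V) (C : Setoid Z) (f : Z → V) :
    (P ⊔ C.map f).comap f = P.comap f ⊔ C := by
  apply le_antisymm
  · intro x y h
    have hl : P.comap f ≤ P.comap f ⊔ C := le_sup_left
    rcases sup_map_rel h with h | ⟨x', y', h1, h2, h3⟩
    · exact hl h
    · exact Setoid.trans' _ (hl h1) (Setoid.trans' _ h2 (hl h3))
  · exact sup_le (fun x y h => (le_sup_left : P ≤ P ⊔ C.map f) h) (map_le.1 le_sup_right)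

theorem comap_map_square {r : Setoid V} {f : U → W} {g : V → W} {f' : Z → U} {g' : Z → V}
    (hg : g.Injective) (hf : f.Injective) (hf' : f'.Injective)
    (h : ∀ x y, f x = g y ↔ ∃ w, f' w = x ∧ g' w = y) :
    (r.map g).comap f = (r.comap g').map f' := by
  ext x y
  rw [Setoid.comap_rel, map_rel hg, map_rel hf', hf.eq_iff]
  apply or_congr_right
  constructor
  · rintro ⟨a, b, h1, h2, h3⟩
    obtain ⟨w, rfl, rfl⟩ := (h _ _).1 h2.symm
    obtain ⟨w', rfl, rfl⟩ := (h _ _).1 h3.symm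
    exact ⟨w, w', h1, rfl, rfl⟩
  · rintro ⟨w, w', h1, rfl, rfl⟩
    exact ⟨g' w, g' w', h1, ((h _ _).2 ⟨w, rfl, rfl⟩).symm, ((h _ _).2 ⟨w', rfl, rfl⟩).symm⟩

theorem ncard_hidden_sup_map [Finite V] (P : Setoid V) (C : Setoid Z) (f : Z → V) (S : Set V)
    (hS : S ⊆ Set.range f) :
    (hidden (P ⊔ C.map f) S).ncard =
      (hidden P (Set.range f)).ncard + (hidden (P.comap f ⊔ C) (f ⁻¹' S)).ncard := by
  set J := P ⊔ C.map f with hJ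
  have hPJ : P ≤ J := le_sup_left
  let i1 : Quotient P → Quotient J := Quotient.map id (fun _ _ h => hPJ h)
  have hcomap : P.comap f ⊔ C = J.comap f := (comap_sup_map P C f).symm
  rw [hcomap]
  let i2 : Quotient (J.comap f) → Quotient J := Quotient.map f (fun _ _ h => h)
  have e1 : Set.InjOn i1 (hidden P (Set.range f)) := by
    intro q hq q' hq' h
    induction q using Quotient.inductionOn with | _ v => ?_
    induction q' using Quotient.inductionOn with | _ w => ?_
    have h' : J v w := Quotient.exact h
    rcases sup_map_rel h' with h' | ⟨x, y, h1, h2, h3⟩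
    · exact Quotient.sound h'
    · exact absurd ⟨x, rfl⟩ (hq (f x) (Quotient.sound (P.symm h1)))
  have e2 : Set.InjOn i2 (hidden (J.comap f) (f ⁻¹' S)) := by
    intro q hq q' hq' h
    induction q using Quotient.inductionOn with | _ v => ?_
    induction q' using Quotient.inductionOn with | _ w => ?_
    have h' : J (f v) (f w) := Quotient.exact h
    exact Quotient.sound h'
  rw [← Set.InjOn.ncard_image e1, ← Set.InjOn.ncard_image e2,
    ← Set.ncard_union_eq _ (Set.toFinite _) (Set.toFinite _)]
  · congr 1
    ext q
    induction q using Quotient.inductionOn with | _ v => ?_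
    constructor
    · intro hq
      by_cases hv : ∃ x, J (f x) v
      · right
        obtain ⟨x, hx⟩ := hv
        refine ⟨Quotient.mk _ x, ?_, Quotient.sound hx⟩
        intro y hy hyS
        have hy' : (J.comap f) y x := Quotient.exact hy
        exact hq (f y) (Quotient.sound (J.trans hy' hx)) hyS
      · left
        refine ⟨Quotient.mk _ v, ?_, rfl⟩
        rintro w hw ⟨x, rfl⟩
        exact hv ⟨x, hPJ (Quotient.exact hw)⟩
    · rintro (⟨q, hq, h⟩ | ⟨q, hq, h⟩)
      · induction q using Quotient.inductionOn with | _ w => ?_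
        intro v' hv' hvS
        obtain ⟨z, rfl⟩ := hS hvS
        have h' : J w (f z) := Quotient.exact (h.trans hv'.symm)
        rcases sup_map_rel h' with h' | ⟨x, y, h1, h2, h3⟩
        · exact hq (f z) (Quotient.sound (P.symm h')) ⟨z, rfl⟩
        · exact hq (f x) (Quotient.sound (P.symm h1)) ⟨x, rfl⟩
      · induction q using Quotient.inductionOn with | _ w => ?_
        intro v' hv' hvS
        obtain ⟨z, rfl⟩ := hS hvS
        have h' : J (f w) (f z) := Quotient.exact (h.trans hv'.symm)
        exact hq z (Quotient.sound (J.symm h')) hvS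
  · rw [Set.disjoint_left]
    rintro _ ⟨q, hq, rfl⟩ ⟨q', hq', h⟩
    induction q using Quotient.inductionOn with | _ v => ?_
    induction q' using Quotient.inductionOn with | _ w => ?_
    have h' : J v (f w) := Quotient.exact h.symm
    rcases sup_map_rel h' with h' | ⟨x, y, h1, h2, h3⟩
    · exact hq (f w) (Quotient.sound (P.symm h')) ⟨w, rfl⟩
    · exact hq (f x) (Quotient.sound (P.symm h1)) ⟨x, rfl⟩

theorem ncard_hidden_map (r : Setoid V) {g : V → W} (hg : g.Injective) (S : Set W)
    (hS : ∀ w, w ∉ S → w ∈ Set.range g) :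
    (hidden (r.map g) S).ncard = (hidden r (g ⁻¹' S)).ncard := by
  let i : Quotient r → Quotient (r.map g) :=
    Quotient.map g (fun _ _ h => Setoid.le_comap_map (f := g) h)
  have hi : i.Injective := by
    intro q q' h
    induction q using Quotient.inductionOn with | _ v => ?_
    induction q' using Quotient.inductionOn with | _ w => ?_
    have h' : r.map g (g v) (g w) := Quotient.exact h
    have h2 : (r.map g).comap g v w := h'
    rw [Setoid.comap_map_eq g r hg] at h2
    exact Quotient.sound h2
  rw [← Set.ncard_image_of_injective _ hi]
  congr 1
  ext q
  induction q using Quotient.inductionOn with | _ w => ?_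
  constructor
  · intro hq
    obtain ⟨v, rfl⟩ := hS w (hq w rfl)
    refine ⟨Quotient.mk _ v, ?_, rfl⟩
    intro v' hv' hvS
    exact hq (g v') (Quotient.sound (Setoid.le_comap_map (f := g) (Quotient.exact hv'))) hvS
  · rintro ⟨q, hq, h⟩ w' hw' hwS
    induction q using Quotient.inductionOn with | _ v => ?_
    have h' : r.map g (g v) w' := Quotient.exact (h.trans hw'.symm)
    rcases (map_rel hg _ _).1 h' with rfl | ⟨a, b, h1, h2, rfl⟩
    · exact hq v rfl hwS
    · obtain rfl := hg h2
      exact hq b (Quotient.sound (r.symm h1)) hwS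

end Aux

section Assoc

variable {k : ℕ}

theorem rowMap_injective {m n : ℕ} {α : Fin m → Fin n} (h : α.Injective) :
    (rowMap k α).Injective :=
  Function.Injective.prodMap h Function.injective_id

theorem rowMap_comp {l m n : ℕ} (α : Fin m → Fin n) (β : Fin l → Fin m) :
    rowMap k α ∘ rowMap k β = rowMap k (α ∘ β) := rfl

theorem mem_range_rowMap {m n : ℕ} {α : Fin m → Fin n} (v : Fin n × Fin k) :
    v ∈ Set.range (rowMap k α) ↔ ∃ i, α i = v.1 := by
  constructor
  · rintro ⟨w, rfl⟩; exact ⟨w.1, rfl⟩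
  · rintro ⟨i, hi⟩; exact ⟨(i, v.2), Prod.ext hi rfl⟩

theorem rowMap_square {m n l p : ℕ} {α : Fin m → Fin n} {β : Fin l → Fin n}
    {α' : Fin p → Fin m} {β' : Fin p → Fin l}
    (h : ∀ i j, α i = β j ↔ ∃ t, α' t = i ∧ β' t = j)
    (x : Fin m × Fin k) (y : Fin l × Fin k) :
    rowMap k α x = rowMap k β y ↔ ∃ w, rowMap k α' w = x ∧ rowMap k β' w = y := by
  constructor
  · intro hxy
    obtain ⟨t, h1, h2⟩ := (h x.1 y.1).1 (congrArg Prod.fst hxy)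
    have h3 : x.2 = y.2 := congrArg Prod.snd hxy
    exact ⟨(t, x.2), Prod.ext h1 rfl, Prod.ext h2 h3⟩
  · rintro ⟨w, rfl, rfl⟩
    exact Prod.ext ((h _ _).2 ⟨w.1, rfl, rfl⟩) rfl

/-- Four stacked rows. -/
def stack₃ (a b c : Diagram k) : Setoid (Fin 4 × Fin k) :=
  a.map (rowMap k ![0, 1]) ⊔ b.map (rowMap k ![1, 2]) ⊔ c.map (rowMap k ![2, 3])

theorem stack₃_left (a b c : Diagram k) :
    stack₃ a b c = (stack a b).map (rowMap k ![0, 1, 2]) ⊔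
      (c.map (rowMap k ![1, 2])).map (rowMap k ![0, 2, 3]) := by
  rw [stack, map_sup, map_map, map_map, map_map, rowMap_comp, rowMap_comp, rowMap_comp, stack₃]
  congr 3 <;> (try congr 1) <;> (funext i; fin_cases i <;> rfl)

theorem stack₃_right (a b c : Diagram k) :
    stack₃ a b c = (stack b c).map (rowMap k ![1, 2, 3]) ⊔
      (a.map (rowMap k ![0, 1])).map (rowMap k ![0, 1, 3]) := by
  rw [stack, map_sup, map_map, map_map, map_map, rowMap_comp, rowMap_comp, rowMap_comp, stack₃,
    sup_assoc, sup_comm]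
  congr 3 <;> (try congr 1) <;> (funext i; fin_cases i <;> rfl)

theorem comap_left (a b : Diagram k) :
    ((stack a b).map (rowMap k (![0, 1, 2] : Fin 3 → Fin 4))).comap (rowMap k ![0, 2, 3]) =
      (comp a b).map (rowMap k (![0, 1] : Fin 2 → Fin 3)) :=
  comap_map_square (rowMap_injective (by decide)) (rowMap_injective (by decide))
    (rowMap_injective (by decide)) (rowMap_square (by decide))

theorem comap_right (b c : Diagram k) :
    ((stack b c).map (rowMap k (![1, 2, 3] : Fin 3 → Fin 4))).comap (rowMap k ![0, 1, 3]) =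
      (comp b c).map (rowMap k (![1, 2] : Fin 2 → Fin 3)) :=
  comap_map_square (rowMap_injective (by decide)) (rowMap_injective (by decide))
    (rowMap_injective (by decide)) (rowMap_square (by decide))

theorem comap_stack₃_left (a b c : Diagram k) :
    (stack₃ a b c).comap (rowMap k ![0, 2, 3]) = stack (comp a b) c := by
  rw [stack₃_left, comap_sup_map, comap_left, stack]

theorem comap_stack₃_right (a b c : Diagram k) :
    (stack₃ a b c).comap (rowMap k ![0, 1, 3]) = stack a (comp b c) := by
  rw [stack₃_right, comap_sup_map, comap_right, stack, sup_comm]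

theorem comp_assoc (a b c : Diagram k) : comp (comp a b) c = comp a (comp b c) := by
  have h1 : comp (comp a b) c = (stack₃ a b c).comap (rowMap k ![0, 3]) := by
    rw [comp, ← comap_stack₃_left]
    ext ⟨i, j⟩ ⟨i', j'⟩
    fin_cases i <;> fin_cases i' <;> rfl
  have h2 : comp a (comp b c) = (stack₃ a b c).comap (rowMap k ![0, 3]) := by
    rw [comp, ← comap_stack₃_right]
    ext ⟨i, j⟩ ⟨i', j'⟩
    fin_cases i <;> fin_cases i' <;> rfl
  rw [h1, h2]

theorem loops_left (a b c : Diagram k) :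
    (hidden (stack₃ a b c) {v | v.1 = 0 ∨ v.1 = 3}).ncard = loops a b + loops (comp a b) c := by
  rw [stack₃_left, ncard_hidden_sup_map, ncard_hidden_map _ (rowMap_injective (by decide)),
    comap_left, loops, loops, stack, stack]
  · congr 3
    · ext ⟨i, j⟩
      rw [Set.mem_preimage, mem_range_rowMap]
      simp only [Set.mem_ofPred_eq, rowMap, Prod.map]
      revert i; decide
    · ext ⟨i, j⟩
      simp only [Set.mem_preimage, Set.mem_ofPred_eq, rowMap, Prod.map]
      revert i; decide
  · rintro ⟨i, j⟩
    simp only [mem_range_rowMap]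
    revert i; decide
  · rintro ⟨i, j⟩
    simp only [mem_range_rowMap, Set.mem_ofPred_eq]
    revert i; decide

theorem loops_right (a b c : Diagram k) :
    (hidden (stack₃ a b c) {v | v.1 = 0 ∨ v.1 = 3}).ncard = loops b c + loops a (comp b c) := by
  rw [stack₃_right, ncard_hidden_sup_map, ncard_hidden_map _ (rowMap_injective (by decide)),
    comap_right, loops, loops, sup_comm, stack, stack]
  · congr 3
    · ext ⟨i, j⟩
      rw [Set.mem_preimage, mem_range_rowMap]
      simp only [Set.mem_ofPred_eq, rowMap, Prod.map]
      revert i; decide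
    · ext ⟨i, j⟩
      simp only [Set.mem_preimage, Set.mem_ofPred_eq, rowMap, Prod.map]
      revert i; decide
  · rintro ⟨i, j⟩
    simp only [mem_range_rowMap]
    revert i; decide
  · rintro ⟨i, j⟩
    simp only [mem_range_rowMap, Set.mem_ofPred_eq]
    revert i; decide

theorem loops_assoc (a b c : Diagram k) :
    loops a b + loops (comp a b) c = loops b c + loops a (comp b c) := by
  rw [← loops_left, loops_right]

theorem stack_id_left (a : Diagram k) :
    stack (idDiagram k) a = a.comap (rowMap k ![0, 0, 1]) := by
  apply le_antisymm
  · refine sup_le (map_le.2 ?_) (map_le.2 ?_)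
    · rintro ⟨i, j⟩ ⟨i', j'⟩ h
      obtain rfl : j = j' := h
      have : rowMap k (![0, 0, 1] : Fin 3 → Fin 2) (rowMap k ![0, 1] (i, j)) =
          rowMap k ![0, 0, 1] (rowMap k ![0, 1] (i', j)) :=
        Prod.ext (by fin_cases i <;> fin_cases i' <;> rfl) rfl
      rw [Setoid.comap_rel, Setoid.comap_rel, this]
    · intro x y h
      rw [Setoid.comap_rel, Setoid.comap_rel]
      convert h using 1
      · exact Prod.ext (by rcases x with ⟨i, j⟩; fin_cases i <;> rfl) rfl
      · exact Prod.ext (by rcases y with ⟨i, j⟩; fin_cases i <;> rfl) rfl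
  · have key : ∀ x : Fin 3 × Fin k, stack (idDiagram k) a x
        (rowMap k ![1, 2] (rowMap k ![0, 0, 1] x)) := by
      rintro ⟨i, j⟩
      fin_cases i
      · exact (le_sup_left : _ ≤ stack (idDiagram k) a)
          (Setoid.le_comap_map (f := rowMap k ![0, 1]) (r := idDiagram k)
            (x := (0, j)) (y := (1, j)) rfl)
      · exact Setoid.refl' _ _
      · exact Setoid.refl' _ _
    intro x y h
    refine Setoid.trans' _ (key x) (Setoid.trans' _ ?_ (Setoid.symm' _ (key y)))
    exact (le_sup_right : _ ≤ stack (idDiagram k) a)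
      (Setoid.le_comap_map (f := rowMap k ![1, 2]) h)

theorem stack_id_right (a : Diagram k) :
    stack a (idDiagram k) = a.comap (rowMap k ![0, 1, 1]) := by
  apply le_antisymm
  · refine sup_le (map_le.2 ?_) (map_le.2 ?_)
    · intro x y h
      rw [Setoid.comap_rel, Setoid.comap_rel]
      convert h using 1
      · exact Prod.ext (by rcases x with ⟨i, j⟩; fin_cases i <;> rfl) rfl
      · exact Prod.ext (by rcases y with ⟨i, j⟩; fin_cases i <;> rfl) rfl
    · rintro ⟨i, j⟩ ⟨i', j'⟩ h
      obtain rfl : j = j' := h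
      have : rowMap k (![0, 1, 1] : Fin 3 → Fin 2) (rowMap k ![1, 2] (i, j)) =
          rowMap k ![0, 1, 1] (rowMap k ![1, 2] (i', j)) :=
        Prod.ext (by fin_cases i <;> fin_cases i' <;> rfl) rfl
      rw [Setoid.comap_rel, Setoid.comap_rel, this]
  · have key : ∀ x : Fin 3 × Fin k, stack a (idDiagram k) x
        (rowMap k ![0, 1] (rowMap k ![0, 1, 1] x)) := by
      rintro ⟨i, j⟩
      fin_cases i
      · exact Setoid.refl' _ _
      · exact Setoid.refl' _ _
      · exact (le_sup_right : _ ≤ stack a (idDiagram k))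
          (Setoid.le_comap_map (f := rowMap k ![1, 2]) (r := idDiagram k)
            (x := (1, j)) (y := (0, j)) rfl)
    intro x y h
    refine Setoid.trans' _ (key x) (Setoid.trans' _ ?_ (Setoid.symm' _ (key y)))
    exact (le_sup_left : _ ≤ stack a (idDiagram k))
      (Setoid.le_comap_map (f := rowMap k ![0, 1]) h)

theorem id_comp (a : Diagram k) : comp (idDiagram k) a = a := by
  rw [comp, stack_id_left, ← Setoid.comap_comp, rowMap_comp]
  ext x y
  rw [Setoid.comap_rel]
  rcases x with ⟨i, j⟩
  rcases y with ⟨i', j'⟩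
  fin_cases i <;> fin_cases i' <;> rfl

theorem comp_id (a : Diagram k) : comp a (idDiagram k) = a := by
  rw [comp, stack_id_right, ← Setoid.comap_comp, rowMap_comp]
  ext x y
  rw [Setoid.comap_rel]
  rcases x with ⟨i, j⟩
  rcases y with ⟨i', j'⟩
  fin_cases i <;> fin_cases i' <;> rfl

theorem loops_id_left (a : Diagram k) : loops (idDiagram k) a = 0 := by
  rw [loops, Set.ncard_eq_zero]
  ext q
  simp only [Set.mem_empty_iff_false, iff_false]
  intro hq
  induction q using Quotient.inductionOn with | _ v => ?_
  refine hq (0, v.2) (Quotient.sound ?_) (by simp)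
  by_cases hv : v.1 = 1
  · obtain ⟨i, j⟩ := v
    obtain rfl : i = 1 := hv
    exact (le_sup_left : _ ≤ stack (idDiagram k) a)
      (Setoid.le_comap_map (f := rowMap k ![0, 1]) (r := idDiagram k)
        (x := (0, j)) (y := (1, j)) rfl)
  · exact absurd hv (by simpa using hq v rfl)

theorem loops_id_right (a : Diagram k) : loops a (idDiagram k) = 0 := by
  rw [loops, Set.ncard_eq_zero]
  ext q
  simp only [Set.mem_empty_iff_false, iff_false]
  intro hq
  induction q using Quotient.inductionOn with | _ v => ?_
  refine hq (2, v.2) (Quotient.sound ?_) (by simp)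
  by_cases hv : v.1 = 1
  · obtain ⟨i, j⟩ := v
    obtain rfl : i = 1 := hv
    exact (le_sup_right : _ ≤ stack a (idDiagram k))
      (Setoid.le_comap_map (f := rowMap k ![1, 2]) (r := idDiagram k)
        (x := (1, j)) (y := (0, j)) rfl)
  · exact absurd hv (by simpa using hq v rfl)

end Assoc

/-! ### The partition algebra -/

/-- The partition algebra with parameter `z` over `R`, as an `R`-module: it is freely generated by
the partition diagrams on `2k` vertices. -/
def PAlg (R : Type*) [CommRing R] (_z : R) (k : ℕ) : Type _ := Diagram k →₀ R

namespace PAlg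

variable {R : Type*} [CommRing R] {z : R} {k : ℕ}

instance : AddCommGroup (PAlg R z k) := inferInstanceAs (AddCommGroup (Diagram k →₀ R))

instance : Module R (PAlg R z k) := inferInstanceAs (Module R (Diagram k →₀ R))

/-- The basis of the partition algebra given by the diagrams. -/
def basis (R : Type*) [CommRing R] (z : R) (k : ℕ) : Module.Basis (Diagram k) R (PAlg R z k) :=
  show Module.Basis (Diagram k) R (Diagram k →₀ R) from Finsupp.basisSingleOne

/-- A diagram, as an element of the partition algebra. -/
def of (z : R) (d : Diagram k) : PAlg R z k := basis R z k d

/-- The bilinear product determined by `d₁ * d₂ = z ^ ℓ • (d₁ ∘ d₂)` on diagrams, where `ℓ` is the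
number of blocks removed from the middle row. -/
def mulHom : PAlg R z k →ₗ[R] PAlg R z k →ₗ[R] PAlg R z k :=
  (basis R z k).constr R fun a => (basis R z k).constr R fun b => z ^ loops a b • of z (comp a b)

instance : Mul (PAlg R z k) := ⟨fun x y => mulHom x y⟩

instance : One (PAlg R z k) := ⟨of z (idDiagram k)⟩

theorem mul_def (x y : PAlg R z k) : x * y = mulHom x y := rfl

theorem one_def : (1 : PAlg R z k) = of z (idDiagram k) := rfl

theorem of_mul_of (a b : Diagram k) :
    of z a * of z b = z ^ loops a b • of z (comp a b) := by
  rw [mul_def, mulHom, of, of, Module.Basis.constr_basis, Module.Basis.constr_basis]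

theorem induction_of {p : PAlg R z k → Prop} (x : PAlg R z k) (h0 : p 0)
    (hadd : ∀ x y, p x → p y → p (x + y)) (hof : ∀ (c : R) d, p (c • of z d)) : p x := by
  have hx : x ∈ Submodule.span R (Set.range (basis R z k)) := (basis R z k).mem_span x
  rw [← Finsupp.range_linearCombination] at hx
  obtain ⟨f, rfl⟩ := hx
  rw [Finsupp.linearCombination_apply]
  exact Finset.sum_induction _ p hadd h0 fun d _ => hof _ d

theorem add_mul' (x y w : PAlg R z k) : (x + y) * w = x * w + y * w := by
  simp only [mul_def, _root_.map_add, LinearMap.add_apply]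

theorem mul_add' (x y w : PAlg R z k) : x * (y + w) = x * y + x * w := by
  simp only [mul_def, _root_.map_add]

theorem smul_mul' (c : R) (x y : PAlg R z k) : (c • x) * y = c • (x * y) := by
  simp only [mul_def, _root_.map_smul, LinearMap.smul_apply]

theorem mul_smul' (c : R) (x y : PAlg R z k) : x * (c • y) = c • (x * y) := by
  simp only [mul_def, _root_.map_smul]

theorem zero_mul' (x : PAlg R z k) : 0 * x = 0 := by
  simp only [mul_def, _root_.map_zero, LinearMap.zero_apply]

theorem mul_zero' (x : PAlg R z k) : x * 0 = 0 := by
  simp only [mul_def, _root_.map_zero]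

theorem mul_assoc' (x y w : PAlg R z k) : x * y * w = x * (y * w) := by
  refine induction_of (p := fun x => x * y * w = x * (y * w)) x ?_ ?_ ?_
  · simp only [zero_mul']
  · intro x x' h h'
    simp only [add_mul', h, h']
  intro c a
  refine induction_of (p := fun y => c • of z a * y * w = c • of z a * (y * w)) y ?_ ?_ ?_
  · simp only [zero_mul', mul_zero']
  · intro x x' h h'
    simp only [add_mul', mul_add', h, h']
  intro c' b
  refine induction_of
    (p := fun w => c • of z a * (c' • of z b) * w = c • of z a * (c' • of z b * w)) w ?_ ?_ ?_
  · simp only [mul_zero']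
  · intro x x' h h'
    simp only [mul_add', h, h']
  intro c'' d
  simp only [smul_mul', mul_smul', of_mul_of, smul_smul, comp_assoc]
  congr 1
  have := congrArg (fun n => z ^ n) (loops_assoc a b d)
  simp only [pow_add] at this
  linear_combination (c * c' * c'') * this

theorem one_mul' (x : PAlg R z k) : 1 * x = x := by
  refine induction_of (p := fun x => 1 * x = x) x (mul_zero' _) ?_ ?_
  · intro x x' h h'
    rw [mul_add', h, h']
  · intro c a
    rw [mul_smul', one_def, of_mul_of, id_comp, loops_id_left, pow_zero, one_smul]

theorem mul_one' (x : PAlg R z k) : x * 1 = x := by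
  refine induction_of (p := fun x => x * 1 = x) x (zero_mul' _) ?_ ?_
  · intro x x' h h'
    rw [add_mul', h, h']
  · intro c a
    rw [smul_mul', one_def, of_mul_of, comp_id, loops_id_right, pow_zero, one_smul]

instance : Ring (PAlg R z k) :=
  { (inferInstance : AddCommGroup (PAlg R z k)) with
    mul := (· * ·)
    one := 1
    left_distrib := mul_add'
    right_distrib := add_mul'
    zero_mul := zero_mul'
    mul_zero := mul_zero'
    mul_assoc := mul_assoc'
    one_mul := one_mul'
    mul_one := mul_one' }

instance : Algebra R (PAlg R z k) := Algebra.ofModule smul_mul' mul_smul'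

end PAlg

/-! ### Generators -/

/-- The diagram `p_i`: its blocks are `{i}`, `{i'}` and `{m, m'}` for `m ≠ i`. -/
def pDiagram (k i : ℕ) : Diagram k :=
  Setoid.ker fun v : Fin 2 × Fin k => (v.2, if (v.2 : ℕ) + 1 = i then v.1 else 0)

/-- The diagram `p_{i+1/2}` (for `1 ≤ i < k`): its blocks are `{i, i+1, i', (i+1)'}` and `{m, m'}`
for `m ≠ i, i+1`. -/
def pHalfDiagram (k i : ℕ) : Diagram k :=
  Setoid.ker fun v : Fin 2 × Fin k => if (v.2 : ℕ) + 1 = i + 1 then i else (v.2 : ℕ) + 1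

/-- The diagram `s_i` (for `1 ≤ i < k`): its blocks are `{i, (i+1)'}`, `{i+1, i'}` and `{m, m'}`
for `m ≠ i, i+1`. -/
def sDiagram (k i : ℕ) : Diagram k :=
  Setoid.ker fun v : Fin 2 × Fin k =>
    if v.1 = 0 then (v.2 : ℕ) + 1 else Equiv.swap i (i + 1) ((v.2 : ℕ) + 1)

/-- The diagrams of the partition algebra `A_i`, embedded in the diagrams on `2k` vertices, `i ≤ k`,
by adding the blocks `{m, m'}` for `i < m ≤ k`. -/
def diagrams (k i : ℕ) : Set (Diagram k) :=
  {d | ∀ m : Fin k, i < (m : ℕ) + 1 → ∀ v, d (0, m) v ↔ v = (0, m) ∨ v = (1, m)}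

/-- The diagrams of `A_{i+1/2}`, embedded in the diagrams on `2k` vertices, `i + 1 ≤ k`: the diagrams
of `A_{i+1}` in which `i+1` and `(i+1)'` are in the same block. -/
def diagramsHalf (k i : ℕ) : Set (Diagram k) :=
  {d | d ∈ diagrams k (i + 1) ∧ ∀ m : Fin k, (m : ℕ) + 1 = i + 1 → d (0, m) (1, m)}

section Elements

variable {R : Type*} [CommRing R] (z : R) (k : ℕ)

/-- The element `p_i`. -/
def p (i : ℕ) : PAlg R z k := .of z (pDiagram k i)

/-- The element `p_{i+1/2}`. -/
def pHalf (i : ℕ) : PAlg R z k := .of z (pHalfDiagram k i)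

/-- The element `s_i`. -/
def s (i : ℕ) : PAlg R z k := .of z (sDiagram k i)

/-- The subalgebra `A_i(z)` of `A_k(z)`, spanned by its diagrams. -/
def A (i : ℕ) : Submodule R (PAlg R z k) := Submodule.span R (PAlg.of z '' diagrams k i)

/-- The subalgebra `A_{i+1/2}(z)` of `A_k(z)`, spanned by its diagrams. -/
def AHalf (i : ℕ) : Submodule R (PAlg R z k) := Submodule.span R (PAlg.of z '' diagramsHalf k i)

/-! ### Jucys–Murphy elements -/

mutual

/-- The Jucys–Murphy element `L_i`. -/
def L : ℕ → PAlg R z k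
  | 0 => 0
  | 1 => p z k 1
  | i + 2 =>
    -(s z k (i + 1) * L (i + 1) * pHalf z k (i + 1))
      - pHalf z k (i + 1) * L (i + 1) * s z k (i + 1)
      + pHalf z k (i + 1) * L (i + 1) * p z k (i + 2) * pHalf z k (i + 1)
      + s z k (i + 1) * L (i + 1) * s z k (i + 1)
      + sigmaSucc (i + 1)

/-- The element `σ_{i+1}`. -/
def sigmaSucc : ℕ → PAlg R z k
  | 0 => 1
  | 1 => s z k 1
  | i + 2 =>
    s z k (i + 1) * s z k (i + 2) * sigmaSucc (i + 1) * s z k (i + 2) * s z k (i + 1)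
      + s z k (i + 2) * pHalf z k (i + 1) * L (i + 1) * s z k (i + 2) * pHalf z k (i + 1)
          * s z k (i + 2)
      + pHalf z k (i + 1) * L (i + 1) * s z k (i + 2) * pHalf z k (i + 1)
      - s z k (i + 2) * pHalf z k (i + 1) * L (i + 1) * s z k (i + 1) * pHalf z k (i + 2)
          * p z k (i + 2) * pHalf z k (i + 1)
      - pHalf z k (i + 1) * p z k (i + 2) * pHalf z k (i + 2) * s z k (i + 1) * L (i + 1)
          * pHalf z k (i + 1) * s z k (i + 2)

end

/-- The element `σ_{i+1/2}`. -/
def sigmaHalf : ℕ → PAlg R z k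
  | 0 => 1
  | 1 => 1
  | i + 2 =>
    s z k (i + 1) * s z k (i + 2) * sigmaHalf (i + 1) * s z k (i + 2) * s z k (i + 1)
      + pHalf z k (i + 1) * L z k (i + 1) * s z k (i + 2) * pHalf z k (i + 1) * s z k (i + 2)
      + s z k (i + 2) * pHalf z k (i + 1) * L z k (i + 1) * s z k (i + 2) * pHalf z k (i + 1)
      - pHalf z k (i + 1) * L z k (i + 1) * s z k (i + 1) * pHalf z k (i + 2) * p z k (i + 2)
          * pHalf z k (i + 1)
      - s z k (i + 2) * pHalf z k (i + 1) * p z k (i + 2) * pHalf z k (i + 2) * s z k (i + 1)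
          * L z k (i + 1) * pHalf z k (i + 1) * s z k (i + 2)

/-- The Jucys–Murphy element `L_{i+1/2}`. -/
def LHalf : ℕ → PAlg R z k
  | 0 => 0
  | i + 1 =>
    -(L z k (i + 1) * pHalf z k (i + 1)) - pHalf z k (i + 1) * L z k (i + 1)
      + pHalf z k (i + 1) * L z k (i + 1) * p z k (i + 1) * pHalf z k (i + 1)
      + s z k (i + 1) * LHalf i * s z k (i + 1)
      + sigmaHalf z k (i + 1)

variable [Invertible (2 : R)]

/-- The scalar `z / 2` in the partition algebra. -/
def halfZ : PAlg R z k := algebraMap R _ (⅟2 * z)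

/-- The renormalised Jucys–Murphy element `x_i = L_i - z / 2`. -/
def x (i : ℕ) : PAlg R z k := L z k i - halfZ z k

/-- The renormalised Jucys–Murphy element `x_{i+1/2} = L_{i+1/2} - z / 2`. -/
def xHalf (i : ℕ) : PAlg R z k := LHalf z k i - halfZ z k

/-! ### The central elements and their generating series -/

/-- `w` is the sequence `x_{i+1/2}^{(j)}`, `j = 0, 1, …`, of elements of `A_i(z)` determined by
`x_{i+1/2}^{(j)} p_{i+1} = p_{i+1} (x_{i+1/2})^j p_{i+1}`. -/
def IsContractionHalf (i : ℕ) (w : ℕ → PAlg R z k) : Prop :=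
  ∀ j, w j ∈ A z k i ∧ w j * p z k (i + 1) = p z k (i + 1) * xHalf z k i ^ j * p z k (i + 1)

/-- `w` is the sequence `x_{i+1}^{(j)}`, `j = 0, 1, …`, of elements of `A_{i+1/2}(z)` determined by
`x_{i+1}^{(j)} p_{i+3/2} = p_{i+3/2} (x_{i+1})^j p_{i+3/2}`. -/
def IsContractionSucc (i : ℕ) (w : ℕ → PAlg R z k) : Prop :=
  ∀ j, w j ∈ AHalf z k i ∧
    w j * pHalf z k (i + 1) = pHalf z k (i + 1) * x z k (i + 1) ^ j * pHalf z k (i + 1)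

end Elements

section Series

variable {S : Type*} [Ring S]

/-- The variable `u`, in the ring `S((u⁻¹))` of Laurent series in `u⁻¹` (so that the coefficient of
index `n` of such a series is the coefficient of `u ^ (-n)`). -/
def u : LaurentSeries S := HahnSeries.single (-1 : ℤ) 1

/-- The series `∑_{j ≥ 0} w_j u^{-j}`. -/
def genSeries (w : ℕ → S) : LaurentSeries S := HahnSeries.ofPowerSeries ℤ S (PowerSeries.mk w)

/-- The series `W_{i+1/2}(u) = u⁻¹ ∑_{j ≥ 0} w_j u^{-j}`, where `w_j = x_{i+1/2}^{(j)}`. -/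
def WHalf (w : ℕ → S) : LaurentSeries S := HahnSeries.single (1 : ℤ) 1 * genSeries w

/-- The series `W_{i+1}(u) = ∑_{j ≥ 0} w_j u^{-j}`, where `w_j = x_{i+1}^{(j)}`. -/
def WSucc (w : ℕ → S) : LaurentSeries S := genSeries w

/-- The fraction `a / b` has a meaning: `b` is invertible and commutes with `a`. -/
def IsFraction (a b : S) : Prop := IsUnit b ∧ Commute a b

/-- The fraction `a / b`. -/
def frac (a b : S) : S := a * Ring.inverse b

end Series

/-- `W_{i+1/2}(u) + (z/2 - u - 1)`, where `w` is the sequence `x_{i+1/2}^{(j)}`. -/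
def shiftedWHalf {R : Type*} [CommRing R] [Invertible (2 : R)] (z : R) (k : ℕ)
    (w : ℕ → PAlg R z k) : LaurentSeries (PAlg R z k) :=
  WHalf w + (HahnSeries.C (halfZ z k) - u - 1)

end PartAlg

end

-- Colorings of diagrams and the meaning of composition.

noncomputable section

namespace PartAlg

-- The identities hold because they hold on tensor space, where they become statements about sums of
-- transpositions in a symmetric group.
--
-- Reduction. For `n` colors, `A_k(n)` acts on the `k`-th tensor power of a free module of rank `n`:
-- a diagram acts by the 0/1 matrix recording which pairs of colorings of its two rows are constant
-- on its blocks. The action is faithful once `n ≥ 2k` (`rep_injective`). All structures are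
-- therefore lifted to the algebra over `ℤ[h]` with parameter `2h`. An identity there is checked
-- after `h ↦ n`, acting on `2n` colors, for all large `n` (`genericRep_ext`), and then carried to
-- `R` by `h ↦ z/2` (`specialize`).
--
-- Jucys–Murphy elements. Write `π_m` for the action of color permutations on the first `m` tensor
-- factors and `J_a = ∑_c π((a c))`, the term `c = a` being the identity. The recursive definitions
-- amount to closed formulas: on tensors whose factor of index `m` (counting from 0) has color `a`,
-- `L_{m+1}` acts as `J_a` for `π_{m+1}` (`rep_L`), and `z - L_{m+1/2}` acts as `J_a` for `π_m`
-- (`rep_LHalf`). Contracting, `x_{m+1/2}^{(j)}` acts as `∑_b (n - J_b)^j` for `π_m`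
-- (`rep_contractionHalf`), and `x_{m+1}^{(j)}` acts as the part of the power of `x_{m+1}`
-- preserving the color of factor `m` (`rep_contractionSucc`).
--
-- The symmetric group identity. Fix a color `a`, let `J_b'` be the analogue of `J_b` for the
-- stabilizer of `a`, and let `s = π((a b))`. Then `s J_b' = J_a s - 1`, the degenerate affine Hecke
-- relation. Rewriting it for resolvents and summing over `b ≠ a` gives a factorization of the
-- generating series, `hat = hatErase_a · (1 - X² / (1 - X ε(h - J_a))²)` (`hat_eq`), where `ε² = 1`
-- and `hatErase_a` involves only the stabilizer of `a`. The same relation shows that `hatErase_a`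
-- inverts the resolvent of `J_a` compressed to the color `a` (`compressed_geo_mul_hatErase`).
--
-- The recursions. On tensors whose factor `m` is `a`, the stabilizer of `a` acts in the same way
-- through `π_m` and `π_{m+1}`, so both levels share the factor `hatErase_a`. Eliminating it relates
-- `hat` at levels `m` and `m+1` (`hat_recursion`), which is the first recursion with `X = u⁻¹`.
-- Multiplying by the compressed resolvents instead gives `W_{m+1} · hat_{m+1}` and `W_{m+2} ·
-- hat_{m+1}` in closed form (`diagSeries_mul_hat_succ`, `diagSeries_mul_hat`); since `W_{m+1}` and
-- `W_{m+2}` commute, `hat_{m+1}` drops out and the second recursion follows.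

open scoped Classical in
/-- A coloring of the vertices which is constant on the blocks of `r` and has prescribed values on
`S` amounts to a coloring of the blocks which are disjoint from `S`. -/
theorem card_extensions {V α : Type*} [Finite V] [Fintype α] (r : Setoid V) (S : Set V) (g : V → α)
    (hg : ∀ v ∈ S, ∀ w ∈ S, r v w → g v = g w) :
    Nat.card {f : V → α // r ≤ Setoid.ker f ∧ ∀ v ∈ S, f v = g v} =
      Fintype.card α ^ (hidden r S).ncard := by
  have hmeet : ∀ v : V, Quotient.mk r v ∉ hidden r S → ∃ w, r w v ∧ w ∈ S := by
    intro v hv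
    simp only [hidden, Set.mem_ofPred_eq, not_forall, not_not] at hv
    obtain ⟨w, hw, hS⟩ := hv
    exact ⟨w, Quotient.exact hw, hS⟩
  let e : {f : V → α // r ≤ Setoid.ker f ∧ ∀ v ∈ S, f v = g v} ≃ (hidden r S → α) :=
    { toFun := fun f q => Quotient.lift f.1 (fun _ _ h => f.2.1 h) q.1
      invFun := fun c => ⟨fun v => if h : Quotient.mk r v ∈ hidden r S then c ⟨_, h⟩
          else g (hmeet v h).choose, by
        constructor
        · intro v w hvw
          have hq : Quotient.mk r v = Quotient.mk r w := Quotient.sound hvw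
          rw [Setoid.ker_def]
          by_cases h : Quotient.mk r v ∈ hidden r S
          · rw [dif_pos h, dif_pos (hq ▸ h)]
            simp only [hq]
          · have h' : Quotient.mk r w ∉ hidden r S := hq ▸ h
            rw [dif_neg h, dif_neg h']
            exact hg _ (hmeet v h).choose_spec.2 _ (hmeet w h').choose_spec.2
              (r.trans (hmeet v h).choose_spec.1 (r.trans hvw (r.symm (hmeet w h').choose_spec.1)))
        · intro v hv
          have h : Quotient.mk r v ∉ hidden r S := fun h => h v rfl hv
          refine (dif_neg h).trans ?_
          exact hg _ (hmeet v h).choose_spec.2 _ hv (hmeet v h).choose_spec.1⟩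
      left_inv := by
        rintro ⟨f, hf, hS⟩
        ext v
        by_cases h : Quotient.mk r v ∈ hidden r S
        · simp only [dif_pos h, Quotient.lift_mk]
        · simp only [dif_neg h]
          rw [← hS _ (hmeet v h).choose_spec.2]
          exact hf (hmeet v h).choose_spec.1
      right_inv := by
        intro c
        ext ⟨q, hq⟩
        induction q using Quotient.inductionOn with | _ v => ?_
        simp only [Quotient.lift_mk, dif_pos hq] }
  rw [Nat.card_congr e, Nat.card_fun, Nat.card_coe_set_eq, Nat.card_eq_fintype_card]

section Sat

variable {k : ℕ} {α : Type*}

/-- The coloring of the vertices of a diagram given by colorings of the two rows. -/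
def twoRows (x y : Fin k → α) (v : Fin 2 × Fin k) : α := if v.1 = 0 then x v.2 else y v.2

/-- The colorings `x` of the top row and `y` of the bottom row are constant on the blocks
of `d`. -/
def Sat (d : Diagram k) (x y : Fin k → α) : Prop := d ≤ Setoid.ker (twoRows x y)

theorem stack_le_ker (a b : Diagram k) (f : Fin 3 × Fin k → α) :
    stack a b ≤ Setoid.ker f ↔
      Sat a (fun j => f (0, j)) (fun j => f (1, j)) ∧
        Sat b (fun j => f (1, j)) (fun j => f (2, j)) := by
  have h : ∀ (i j : Fin 3), (Setoid.ker f).comap (rowMap k ![i, j]) =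
      Setoid.ker (twoRows (fun m => f (i, m)) (fun m => f (j, m))) := by
    intro i j
    have h' : f ∘ rowMap k ![i, j] = twoRows (fun m => f (i, m)) (fun m => f (j, m)) := by
      ext ⟨t, m⟩
      fin_cases t <;> rfl
    rw [← h']
    rfl
  rw [stack, sup_le_iff, map_le, map_le, Sat, Sat, h, h]

theorem Sat.comp {a b : Diagram k} {x y w : Fin k → α} (h1 : Sat a x y) (h2 : Sat b y w) :
    Sat (comp a b) x w := by
  have h := (stack_le_ker a b (fun v => ![x, y, w] v.1 v.2)).2 ⟨h1, h2⟩
  rintro ⟨i, j⟩ ⟨i', j'⟩ hv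
  have h' := h (x := rowMap k ![0, 2] (i, j)) (y := rowMap k ![0, 2] (i', j')) hv
  rw [Setoid.ker_def] at h' ⊢
  revert h'
  fin_cases i <;> fin_cases i' <;> exact id

-- A compatible middle row is an extension of the outer coloring to the stacked diagram. The colors
-- are forced except on the blocks confined to the middle row, which are colored freely; this is why
-- the number of colors plays the role of the parameter.
open scoped Classical in
theorem card_middle_rows [Fintype α] (a b : Diagram k) (x w : Fin k → α) :
    (Finset.univ.filter fun y : Fin k → α => Sat a x y ∧ Sat b y w).card =
      if Sat (PartAlg.comp a b) x w then Fintype.card α ^ loops a b else 0 := by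
  split_ifs with hs
  · let g : Fin 3 × Fin k → α := fun v => if v.1 = 0 then x v.2 else w v.2
    have hg : ∀ v ∈ {v : Fin 3 × Fin k | v.1 ≠ 1}, ∀ v' ∈ {v : Fin 3 × Fin k | v.1 ≠ 1},
        stack a b v v' → g v = g v' := by
      have key : ∀ v : Fin 3 × Fin k, v.1 ≠ 1 →
          ∃ v0 : Fin 2 × Fin k, rowMap k ![0, 2] v0 = v ∧ twoRows x w v0 = g v := by
        rintro ⟨i, j⟩ hi
        fin_cases i
        · exact ⟨(0, j), rfl, rfl⟩
        · exact absurd rfl hi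
        · exact ⟨(1, j), rfl, rfl⟩
      intro v hv v' hv' h
      obtain ⟨v0, rfl, h0⟩ := key v hv
      obtain ⟨v1, rfl, h1⟩ := key v' hv'
      rw [← h0, ← h1]
      exact hs h
    rw [loops, ← card_extensions (stack a b) {v | v.1 ≠ 1} g hg, ← Fintype.card_subtype,
      ← Nat.card_eq_fintype_card]
    refine Nat.card_congr
      { toFun := fun y => ⟨fun v => ![x, y.1, w] v.1 v.2, (stack_le_ker a b _).2 y.2, ?_⟩
        invFun := fun f => ⟨fun j => f.1 (1, j), ?_⟩
        left_inv := fun y => rfl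
        right_inv := ?_ }
    · rintro ⟨i, j⟩ hi
      fin_cases i
      · rfl
      · exact absurd rfl hi
      · rfl
    · have h := (stack_le_ker a b _).1 f.2.1
      have h0 : (fun j => f.1 (0, j)) = x := funext fun j => f.2.2 (0, j) (by simp)
      have h2 : (fun j => f.1 (2, j)) = w := funext fun j => f.2.2 (2, j) (by simp)
      rwa [h0, h2] at h
    · rintro ⟨f, hf, hS⟩
      ext ⟨i, j⟩
      fin_cases i
      · exact (hS (0, j) (by simp)).symm
      · rfl
      · exact (hS (2, j) (by simp)).symm
  · rw [Finset.card_eq_zero, Finset.filter_eq_empty_iff]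
    exact fun y _ h => hs (h.1.comp h.2)

/-- Turns composition of diagrams into composition of relations, so that identities between diagrams
reduce to statements about colorings. A color must exist in order to fill the blocks hidden in the
middle. -/
theorem sat_comp_iff [Finite α] [Nonempty α] {a b : Diagram k} {x w : Fin k → α} :
    Sat (PartAlg.comp a b) x w ↔ ∃ y, Sat a x y ∧ Sat b y w := by
  classical
  have := Fintype.ofFinite α
  constructor
  · intro h
    have hc := card_middle_rows a b x w
    rw [if_pos h] at hc
    have : 0 < Fintype.card α ^ loops a b := pow_pos Fintype.card_pos _
    rw [← hc, Finset.card_pos] at this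
    obtain ⟨y, hy⟩ := this
    exact ⟨y, (Finset.mem_filter.1 hy).2⟩
  · rintro ⟨y, h1, h2⟩
    exact h1.comp h2

/-- A diagram is determined by the colorings which are constant on its blocks. -/
theorem le_of_sat [Nontrivial α] {d e : Diagram k}
    (h : ∀ x y : Fin k → α, Sat e x y → Sat d x y) : d ≤ e := by
  classical
  obtain ⟨t, t', htt⟩ := exists_pair_ne α
  intro v w hvw
  by_contra hne
  let f : Fin 2 × Fin k → α := fun v' => if e v v' then t else t'
  have hf : twoRows (fun j => f (0, j)) (fun j => f (1, j)) = f := by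
    ext ⟨i, j⟩
    fin_cases i <;> rfl
  have hs : Sat e (fun j => f (0, j)) (fun j => f (1, j)) := by
    rw [Sat, hf]
    intro a b hab
    rw [Setoid.ker_def]
    have : e v a ↔ e v b := ⟨fun h => e.trans h hab, fun h => e.trans h (e.symm hab)⟩
    simp only [f, this]
  have := h _ _ hs
  rw [Sat, hf] at this
  have h' := this hvw
  rw [Setoid.ker_def] at h'
  simp only [f, if_pos (e.refl v), if_neg hne] at h'
  exact htt h'

theorem eq_of_sat [Nontrivial α] {d e : Diagram k}
    (h : ∀ x y : Fin k → α, Sat d x y ↔ Sat e x y) : d = e :=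
  le_antisymm (le_of_sat fun x y => (h x y).2) (le_of_sat fun x y => (h x y).1)

end Sat

-- The action on tensor space and its faithfulness.

section Rep

theorem finite_setoid (V : Type*) [Finite V] : Finite (Setoid V) :=
  Finite.of_injective (fun r : Setoid V => (r : V → V → Prop))
    fun _ _ h => Setoid.ext fun _ _ => iff_of_eq (congrFun (congrFun h _) _)

variable {S : Type*} [CommRing S] {k : ℕ} {α : Type*} [Fintype α]

/-- The linear operators on the `k`-th tensor power of the free module on `α`. -/
abbrev TensorEnd (S : Type*) [CommRing S] (k : ℕ) (α : Type*) : Type _ :=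
  Module.End S ((Fin k → α) → S)

open scoped Classical in
/-- The operator by which a diagram acts. -/
def diagramOp (S : Type*) [CommRing S] (d : Diagram k) : TensorEnd S k α where
  toFun f x := ∑ y, if Sat d x y then f y else 0
  map_add' f g := by
    ext x
    simp only [Pi.add_apply, ← Finset.sum_add_distrib]
    exact Finset.sum_congr rfl fun y _ => by split_ifs <;> simp
  map_smul' c f := by
    ext x
    simp only [Pi.smul_apply, smul_eq_mul, RingHom.id_apply, Finset.mul_sum]
    exact Finset.sum_congr rfl fun y _ => by split_ifs <;> simp

open scoped Classical in
theorem diagramOp_apply (d : Diagram k) (f : (Fin k → α) → S) (x : Fin k → α) :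
    diagramOp S d f x = ∑ y, if Sat d x y then f y else 0 := rfl

theorem diagramOp_mul (a b : Diagram k) :
    (diagramOp S a * diagramOp S b : TensorEnd S k α) =
      (Fintype.card α : S) ^ loops a b • diagramOp S (comp a b) := by
  classical
  refine LinearMap.ext fun f => funext fun x => ?_
  simp only [Module.End.mul_apply, LinearMap.smul_apply, Pi.smul_apply, diagramOp_apply,
    smul_eq_mul, Finset.mul_sum]
  have h1 : ∀ y : Fin k → α, (if Sat a x y then ∑ w, (if Sat b y w then f w else 0) else 0) =
      ∑ w, if Sat a x y ∧ Sat b y w then f w else 0 := by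
    intro y
    by_cases h : Sat a x y <;> simp [h]
  simp only [h1]
  rw [Finset.sum_comm]
  refine Finset.sum_congr rfl fun w _ => ?_
  rw [← Finset.sum_filter, Finset.sum_const, card_middle_rows, nsmul_eq_mul]
  split_ifs <;> simp

theorem diagramOp_id : diagramOp S (idDiagram k) = (1 : TensorEnd S k α) := by
  classical
  refine LinearMap.ext fun f => funext fun x => ?_
  have h : ∀ y : Fin k → α, Sat (idDiagram k) x y ↔ x = y := by
    intro y
    constructor
    · intro h
      ext j
      exact h (x := (0, j)) (y := (1, j)) rfl
    · rintro rfl ⟨i, j⟩ ⟨i', j'⟩ hv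
      obtain rfl : j = j' := hv
      rw [Setoid.ker_def]
      simp only [twoRows, ite_self]
  simp [diagramOp_apply, h]

/-- The action of the partition algebra with parameter `n` on the tensor powers of a free module of
rank `n`. -/
def rep {z : S} (hz : (Fintype.card α : S) = z) : PAlg S z k →+* TensorEnd S k α :=
  let φ : PAlg S z k →ₗ[S] TensorEnd S k α := (PAlg.basis S z k).constr S (diagramOp S)
  have hφ : ∀ d, φ (.of z d) = diagramOp S d := fun d => (PAlg.basis S z k).constr_basis S _ d
  { toFun := φ
    map_zero' := φ.map_zero
    map_add' := φ.map_add
    map_one' := by rw [PAlg.one_def, hφ, diagramOp_id]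
    map_mul' := by
      intro x y
      refine PAlg.induction_of (p := fun x => φ (x * y) = φ x * φ y) x (by simp) ?_ ?_
      · intro x x' h h'
        rw [add_mul, map_add, h, h', map_add, add_mul]
      intro c a
      refine PAlg.induction_of (p := fun y => φ (c • PAlg.of z a * y) = φ (c • .of z a) * φ y) y
        (by simp) ?_ ?_
      · intro x x' h h'
        rw [mul_add, map_add, h, h', map_add, mul_add]
      intro c' b
      rw [smul_mul_assoc, mul_smul_comm, PAlg.of_mul_of, map_smul, map_smul, map_smul, map_smul,
        map_smul, hφ, hφ, hφ, smul_mul_assoc, mul_smul_comm, diagramOp_mul, hz] }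

theorem rep_of {z : S} (hz : (Fintype.card α : S) = z) (d : Diagram k) :
    rep hz (.of z d) = (diagramOp S d : TensorEnd S k α) :=
  (PAlg.basis S z k).constr_basis S _ d

theorem rep_smul {z : S} (hz : (Fintype.card α : S) = z) (c : S) (a : PAlg S z k) :
    rep hz (c • a) = (c • rep hz a : TensorEnd S k α) :=
  map_smul ((PAlg.basis S z k).constr S (diagramOp S) : PAlg S z k →ₗ[S] TensorEnd S k α) c a

/-- The action is faithful when the rank is large. -/
theorem rep_injective {z : S} (hz : (Fintype.card α : S) = z) (hk : 2 * k ≤ Fintype.card α) :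
    Function.Injective (rep (k := k) hz) := by
  classical
  have := finite_setoid (Fin 2 × Fin k)
  have := Fintype.ofFinite (Diagram k)
  rw [injective_iff_map_eq_zero]
  intro a ha
  have hrep : ∀ f x, rep hz a f x =
      ∑ d : Diagram k, (PAlg.basis S z k).repr a d • diagramOp S (α := α) d f x := by
    intro f x
    conv_lhs => rw [← (PAlg.basis S z k).sum_repr a]
    rw [map_sum, LinearMap.sum_apply, Finset.sum_apply]
    refine Finset.sum_congr rfl fun d _ => ?_
    rw [rep_smul, LinearMap.smul_apply, Pi.smul_apply]
    exact congrArg (fun T : TensorEnd S k α => _ • T f x) (rep_of hz d)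
  have hemb : Nonempty (Fin 2 × Fin k ↪ α) :=
    Function.Embedding.nonempty_of_card_le (by simpa using hk)
  obtain ⟨ι⟩ := hemb
  have hcoef : ∀ d : Diagram k, (PAlg.basis S z k).repr a d = 0 := by
    intro d
    -- The matrices of the diagrams are unitriangular for refinement: the coefficients vanish by
    -- induction from the finest partitions upwards.
    induction d using WellFoundedLT.induction with | _ d ih => ?_
    -- A coloring separating the blocks of `d`; the `2k` available colors are used here. The matrix
    -- entry at its two rows sees exactly the diagrams finer than or equal to `d`.
    let F : Fin 2 × Fin k → α := fun v => ι (Quotient.out (Quotient.mk d v))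
    have hF : Setoid.ker F = d := by
      ext v w
      rw [Setoid.ker_def]
      constructor
      · intro h
        have := congrArg (Quotient.mk d) (ι.injective h)
        rw [Quotient.out_eq, Quotient.out_eq] at this
        exact Quotient.exact this
      · intro h
        have : Quotient.mk d v = Quotient.mk d w := Quotient.sound h
        simp only [F, this]
    have htwo : twoRows (fun j => F (0, j)) (fun j => F (1, j)) = F := by
      ext ⟨i, j⟩
      fin_cases i <;> rfl
    have h0 := hrep (Pi.single (fun j => F (1, j)) 1) (fun j => F (0, j))
    rw [ha, Finset.sum_eq_single d] at h0
    · simp only [diagramOp_apply, Pi.single_apply] at h0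
      have hs : Sat d (fun j => F (0, j)) (fun j => F (1, j)) := by
        rw [Sat, htwo, hF]
      simpa [← ite_and, Finset.sum_ite, Finset.filter_and, Finset.filter_eq', hs] using h0.symm
    · intro e _ hne
      by_cases hle : e ≤ d
      · rw [ih e (lt_of_le_of_ne hle hne), zero_smul]
      · simp only [diagramOp_apply]
        rw [Finset.sum_eq_zero, smul_zero]
        intro y _
        rw [Pi.single_apply]
        split_ifs with h1 h2
        · subst h2
          rw [Sat, htwo, hF] at h1
          exact absurd h1 hle
        · rfl
        · rfl
    · simp
  exact (PAlg.basis S z k).ext_elem fun d => by simpa using hcoef d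

end Rep

end PartAlg

end

-- The action of the generators in coordinates.

noncomputable section

namespace PartAlg

section Generators

variable {S : Type*} [CommRing S] {k : ℕ} {α : Type*}

theorem sat_ker {V : Type*} (g : Fin 2 × Fin k → V) (x y : Fin k → α) :
    Sat (Setoid.ker g) x y ↔ ∀ v w, g v = g w → twoRows x y v = twoRows x y w :=
  ⟨fun h _ _ hvw => h hvw, fun h _ _ hvw => h _ _ hvw⟩

theorem sat_sDiagram {m : ℕ} (hm : m + 1 < k) (x y : Fin k → α) :
    Sat (sDiagram k (m + 1)) x y ↔
      y = x ∘ Equiv.swap (⟨m, by lia⟩ : Fin k) ⟨m + 1, hm⟩ := by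
  set σ : Equiv.Perm (Fin k) := Equiv.swap (⟨m, by lia⟩ : Fin k) ⟨m + 1, hm⟩ with hσ
  have hval : ∀ j : Fin k, Equiv.swap (m + 1) (m + 2) ((j : ℕ) + 1) = (σ j : ℕ) + 1 := by
    intro j
    rw [hσ, Equiv.swap_apply_def, Equiv.swap_apply_def]
    simp only [Fin.ext_iff]
    split_ifs <;> first | rfl | lia
  rw [sDiagram, sat_ker]
  constructor
  · intro h
    ext j
    have := h (0, σ j) (1, j) (by simp [hval])
    simpa [twoRows] using this.symm
  · rintro rfl ⟨i, j⟩ ⟨i', j'⟩ h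
    have key : ∀ v : Fin 2 × Fin k, (if v.1 = 0 then (v.2 : ℕ) + 1
        else Equiv.swap (m + 1) (m + 1 + 1) ((v.2 : ℕ) + 1)) =
          ((if v.1 = 0 then v.2 else σ v.2 : Fin k) : ℕ) + 1 ∧
        twoRows x (x ∘ σ) v = x (if v.1 = 0 then v.2 else σ v.2) := by
      intro v
      by_cases hv : v.1 = 0
      · simp [hv, twoRows]
      · simp only [hv, if_false, twoRows]
        exact ⟨hval _, rfl⟩
    rw [(key _).2, (key _).2]
    congr 1
    exact Fin.ext (Nat.succ_injective ((key (i, j)).1.symm.trans (h.trans (key (i', j')).1)))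

theorem sat_pHalfDiagram {m : ℕ} (hm : m + 1 < k) (x y : Fin k → α) :
    Sat (pHalfDiagram k (m + 1)) x y ↔ y = x ∧ x ⟨m, by lia⟩ = x ⟨m + 1, hm⟩ := by
  rw [pHalfDiagram, sat_ker]
  constructor
  · intro h
    refine ⟨funext fun j => (h (0, j) (1, j) rfl).symm, ?_⟩
    exact h (0, ⟨m, by lia⟩) (0, ⟨m + 1, hm⟩) (by simp)
  · rintro ⟨rfl, h⟩ v w hvw
    have key : ∀ v, twoRows y y v = y v.2 := fun v => ite_self _
    rw [key, key]
    by_cases h1 : (v.2 : ℕ) = m + 1 <;> by_cases h2 : (w.2 : ℕ) = m + 1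
    · congr 1
      exact Fin.ext (h1.trans h2.symm)
    · simp only [h1, h2, if_true, add_left_inj, if_false] at hvw
      have e1 : v.2 = ⟨m + 1, hm⟩ := Fin.ext h1
      have e2 : w.2 = ⟨m, by lia⟩ := Fin.ext hvw.symm
      rw [e1, e2, h]
    · simp only [h1, h2, if_true, add_left_inj, if_false] at hvw
      have e1 : v.2 = ⟨m, by lia⟩ := Fin.ext hvw
      have e2 : w.2 = ⟨m + 1, hm⟩ := Fin.ext h2
      rw [e1, e2, h]
    · simp only [h1, h2, add_left_inj, if_false] at hvw
      congr 1
      exact Fin.ext hvw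

theorem sat_pDiagram {m : ℕ} (hm : m < k) (x y : Fin k → α) :
    Sat (pDiagram k (m + 1)) x y ↔ ∃ c, y = Function.update x ⟨m, hm⟩ c := by
  rw [pDiagram, sat_ker]
  constructor
  · intro h
    refine ⟨y ⟨m, hm⟩, funext fun j => ?_⟩
    by_cases hj : j = ⟨m, hm⟩
    · rw [hj, Function.update_self]
    · rw [Function.update_of_ne hj]
      have hj' : (j : ℕ) ≠ m := fun h => hj (Fin.ext h)
      exact (h (0, j) (1, j) (by simp [hj'])).symm
  · rintro ⟨c, rfl⟩ ⟨i, j⟩ ⟨i', j'⟩ hvw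
    simp only [Prod.mk.injEq, add_left_inj] at hvw
    obtain ⟨rfl, hi⟩ := hvw
    by_cases hj : (j : ℕ) = m
    · simp only [hj, if_true] at hi
      rw [hi]
    · have hj' : j ≠ ⟨m, hm⟩ := fun h => hj (congrArg Fin.val h)
      simp only [twoRows, Function.update_of_ne hj', ite_self]

variable [Fintype α] {z : S} (hz : (Fintype.card α : S) = z)

theorem rep_s {m : ℕ} (hm : m + 1 < k) (f : (Fin k → α) → S) (x : Fin k → α) :
    rep hz (s z k (m + 1)) f x = f (x ∘ Equiv.swap (⟨m, by lia⟩ : Fin k) ⟨m + 1, hm⟩) := by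
  classical
  rw [s, rep_of, diagramOp_apply]
  simp only [sat_sDiagram hm, Finset.sum_ite_eq', Finset.mem_univ, if_true]

theorem rep_pHalf [DecidableEq α] {m : ℕ} (hm : m + 1 < k) (f : (Fin k → α) → S) (x : Fin k → α) :
    rep hz (pHalf z k (m + 1)) f x = if x ⟨m, by lia⟩ = x ⟨m + 1, hm⟩ then f x else 0 := by
  rw [pHalf, rep_of, diagramOp_apply]
  simp only [sat_pHalfDiagram hm, ite_and, Finset.sum_ite_eq', Finset.mem_univ, if_true]

theorem rep_p {m : ℕ} (hm : m < k) (f : (Fin k → α) → S) (x : Fin k → α) :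
    rep hz (p z k (m + 1)) f x = ∑ c, f (Function.update x ⟨m, hm⟩ c) := by
  classical
  rw [p, rep_of, diagramOp_apply]
  simp only [sat_pDiagram hm]
  rw [← Finset.sum_filter]
  symm
  refine Finset.sum_bij (fun c _ => Function.update x ⟨m, hm⟩ c) ?_ ?_ ?_ ?_
  · intro c _
    simp only [Finset.mem_filter, Finset.mem_univ, true_and]
    exact ⟨c, rfl⟩
  · intro c _ c' _ h
    exact Function.update_injective _ _ h
  · intro y hy
    simp only [Finset.mem_filter, Finset.mem_univ, true_and] at hy
    obtain ⟨c, rfl⟩ := hy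
    exact ⟨c, Finset.mem_univ _, rfl⟩
  · intros; rfl

end Generators

section Slots

variable {S : Type*} [CommRing S] {k : ℕ} {α : Type*}

/-- The permutation `g` of colors, applied to the first `i` entries of a coloring. -/
def act (i : ℕ) (g : Equiv.Perm α) (x : Fin k → α) (j : Fin k) : α :=
  if (j : ℕ) < i then g (x j) else x j

/-- The coloring obtained from `x` by applying `g` to the first `m` entries and replacing the next
three entries by `a`, `b` and `c`. -/
def slots (m : ℕ) (g : Equiv.Perm α) (a b c : α) (x : Fin k → α) (j : Fin k) : α :=
  if (j : ℕ) < m then g (x j) else if (j : ℕ) = m then a else if (j : ℕ) = m + 1 then b else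
    if (j : ℕ) = m + 2 then c else x j

variable {m : ℕ} {g h : Equiv.Perm α} {a b c d : α} {x : Fin k → α}

theorem slots_zero (hm : m < k) : slots m g a b c x ⟨m, hm⟩ = a := by simp [slots]

theorem slots_one (hm : m + 1 < k) : slots m g a b c x ⟨m + 1, hm⟩ = b := by simp [slots]

theorem slots_two (hm : m + 2 < k) : slots m g a b c x ⟨m + 2, hm⟩ = c := by simp [slots]

theorem act_slots_zero : act m h (slots m g a b c x) = slots m (h * g) a b c x := by
  funext j
  simp only [act, slots]
  split_ifs <;> rfl

theorem act_slots_one : act (m + 1) h (slots m g a b c x) = slots m (h * g) (h a) b c x := by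
  funext j
  simp only [act, slots]
  split_ifs <;> first | rfl | lia

theorem act_slots_two :
    act (m + 2) h (slots m g a b c x) = slots m (h * g) (h a) (h b) c x := by
  funext j
  simp only [act, slots]
  split_ifs <;> first | rfl | lia

theorem act_slots_three :
    act (m + 3) h (slots m g a b c x) = slots m (h * g) (h a) (h b) (h c) x := by
  funext j
  simp only [act, slots]
  split_ifs <;> first | rfl | lia

theorem exists_slots (hm : m + 1 < k) (x : Fin k → α) : ∃ a b c, x = slots m 1 a b c x := by
  refine ⟨x ⟨m, by lia⟩, x ⟨m + 1, hm⟩,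
    -- If there is no column of index `m + 2`, the third entry is never read and its value is
    -- arbitrary.
    if h : m + 2 < k then x ⟨m + 2, h⟩ else x ⟨m, by lia⟩, funext fun j => ?_⟩
  simp only [slots, Equiv.Perm.one_apply]
  split_ifs with h1 h2 h3 h4 h5 <;> first | rfl | lia | (congr 1; exact Fin.ext (by simpa))

theorem slots_comp_swap (hm : m + 1 < k) :
    slots m g a b c x ∘ Equiv.swap (⟨m, by lia⟩ : Fin k) ⟨m + 1, hm⟩ = slots m g b a c x := by
  funext j
  simp only [Function.comp, Equiv.swap_apply_def]
  split_ifs with h1 h2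
  · rw [slots_one, h1, slots_zero]
  · rw [slots_zero, h2, slots_one]
  · rw [Fin.ext_iff] at h1 h2
    simp only at h1 h2
    simp only [slots, h1, h2, if_false]

theorem slots_comp_swap_succ (hm : m + 2 < k) :
    slots m g a b c x ∘ Equiv.swap (⟨m + 1, by lia⟩ : Fin k) ⟨m + 2, hm⟩ = slots m g a c b x := by
  funext j
  simp only [Function.comp, Equiv.swap_apply_def]
  split_ifs with h1 h2
  · rw [slots_two, h1, slots_one]
  · rw [slots_one, h2, slots_two]
  · rw [Fin.ext_iff] at h1 h2
    simp only at h1 h2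
    simp only [slots, h1, h2, if_false]

theorem update_slots_zero (hm : m < k) :
    Function.update (slots m g a b c x) ⟨m, hm⟩ d = slots m g d b c x := by
  funext j
  by_cases hj : j = ⟨m, hm⟩
  · rw [hj, Function.update_self, slots_zero]
  · rw [Function.update_of_ne hj]
    rw [Fin.ext_iff] at hj
    simp only at hj
    simp only [slots, hj, if_false]

theorem update_slots_one (hm : m + 1 < k) :
    Function.update (slots m g a b c x) ⟨m + 1, hm⟩ d = slots m g a d c x := by
  funext j
  by_cases hj : j = ⟨m + 1, hm⟩
  · rw [hj, Function.update_self, slots_one]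
  · rw [Function.update_of_ne hj]
    rw [Fin.ext_iff] at hj
    simp only at hj
    simp only [slots, hj, if_false]

end Slots

-- Closed formulas for the Jucys–Murphy elements.

section JucysMurphy

open Equiv (swap)

variable {S : Type*} [CommRing S] {k : ℕ} {α : Type*} [Fintype α]
  {z : S} (hz : (Fintype.card α : S) = z)

theorem rep_s_zero {m : ℕ} {g : Equiv.Perm α} {a b c : α} {x : Fin k → α} (hm : m + 1 < k)
    (f : (Fin k → α) → S) :
    rep hz (s z k (m + 1)) f (slots m g a b c x) = f (slots m g b a c x) := by
  rw [rep_s hz hm, slots_comp_swap]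

theorem rep_s_one {m : ℕ} {g : Equiv.Perm α} {a b c : α} {x : Fin k → α} (hm : m + 2 < k)
    (f : (Fin k → α) → S) :
    rep hz (s z k (m + 2)) f (slots m g a b c x) = f (slots m g a c b x) := by
  rw [rep_s hz hm, slots_comp_swap_succ]

theorem rep_pHalf_zero [DecidableEq α] {m : ℕ} {g : Equiv.Perm α} {a b c : α} {x : Fin k → α} (hm : m + 1 < k)
    (f : (Fin k → α) → S) :
    rep hz (pHalf z k (m + 1)) f (slots m g a b c x) =
      if a = b then f (slots m g a b c x) else 0 := by
  rw [rep_pHalf hz hm, slots_zero, slots_one]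

theorem rep_pHalf_one [DecidableEq α] {m : ℕ} {g : Equiv.Perm α} {a b c : α} {x : Fin k → α} (hm : m + 2 < k)
    (f : (Fin k → α) → S) :
    rep hz (pHalf z k (m + 2)) f (slots m g a b c x) =
      if b = c then f (slots m g a b c x) else 0 := by
  rw [rep_pHalf hz hm, slots_one, slots_two]

theorem rep_p_zero {m : ℕ} {g : Equiv.Perm α} {a b c : α} {x : Fin k → α} (hm : m < k)
    (f : (Fin k → α) → S) :
    rep hz (p z k (m + 1)) f (slots m g a b c x) = ∑ d, f (slots m g d b c x) := by
  simp only [rep_p hz hm, update_slots_zero]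

theorem rep_p_one {m : ℕ} {g : Equiv.Perm α} {a b c : α} {x : Fin k → α} (hm : m + 1 < k)
    (f : (Fin k → α) → S) :
    rep hz (p z k (m + 2)) f (slots m g a b c x) = ∑ d, f (slots m g a d c x) := by
  simp only [rep_p hz hm, update_slots_one]

variable [DecidableEq α]

/-- The two formulas are proved together because the definitions are mutually recursive. Only the
columns of index `m`, `m + 1`, `m + 2` matter individually; the earlier ones just carry a
permutation of colors, so each step is a comparison of colors `a`, `b`, `c` of three slots. -/
theorem rep_L_and_sigmaSucc (m : ℕ) :
    (∀ hm : m < k, ∀ f x, rep hz (L z k (m + 1)) f x =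
      ∑ d, f (act (m + 1) (swap (x ⟨m, hm⟩) d) x)) ∧
    (∀ hm : m + 1 < k, ∀ f x, rep hz (sigmaSucc z k (m + 1)) f x =
      f (act (m + 2) (swap (x ⟨m, by lia⟩) (x ⟨m + 1, hm⟩)) x)) := by
  induction m with
  | zero =>
    constructor
    · intro hm f x
      rw [L, rep_p hz hm]
      refine Finset.sum_congr rfl fun d _ => congrArg f (funext fun j => ?_)
      simp only [act, Function.update_apply, Fin.ext_iff]
      by_cases hj : (j : ℕ) = 0
      · have : j = ⟨0, hm⟩ := Fin.ext hj
        simp [this]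
      · have : ¬ (j : ℕ) < 0 + 1 := by lia
        simp [hj]
    · intro hm f x
      rw [sigmaSucc, rep_s hz hm]
      refine congrArg f (funext fun j => ?_)
      by_cases h0 : (j : ℕ) = 0
      · have : j = ⟨0, by lia⟩ := Fin.ext h0
        simp [this, act]
      · by_cases h1 : (j : ℕ) = 1
        · have : j = ⟨1, hm⟩ := Fin.ext h1
          simp [this, act]
        · have h2 : ¬ (j : ℕ) < 2 := by lia
          rw [Function.comp, Equiv.swap_apply_of_ne_of_ne]
          · simp [act, h2]
          · exact fun h => h0 (congrArg Fin.val h)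
          · exact fun h => h1 (congrArg Fin.val h)
  | succ m ih =>
    obtain ⟨ihL, ihσ⟩ := ih
    constructor
    · intro hm f x
      obtain ⟨a, b, c, hx⟩ := exists_slots hm x
      rw [hx, L]
      -- The computation is uniform in the permutation already applied to the first `m` entries.
      generalize (1 : Equiv.Perm α) = g
      simp only [map_add, map_sub, map_neg, map_mul, LinearMap.add_apply, LinearMap.sub_apply,
        LinearMap.neg_apply, Module.End.mul_apply, Pi.add_apply, Pi.sub_apply, Pi.neg_apply,
        rep_s_zero hz hm, rep_pHalf_zero hz hm, ihL (by lia), ihσ hm,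
        rep_p_one hz hm, act_slots_one, act_slots_two, slots_zero, slots_one, 
        Equiv.swap_apply_left, Equiv.swap_apply_right]
      -- For `a = b`, the third term of the recursion is already the answer, and the other terms
      -- cancel in pairs.
      by_cases hab : a = b
      · subst hab
        simp only [Equiv.swap_self, Equiv.swap_apply_left, Finset.sum_ite_eq, Finset.sum_ite_eq',
          Finset.mem_univ, if_true]
        ring
      -- For `a ≠ b`, the answer differs from `s L s` only in the summand `d = a`: the first term of
      -- the recursion removes the wrong summand and `σ` supplies the right one.
      · simp only [hab, Finset.sum_ite_eq', Finset.mem_univ, if_true, if_false]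
        rw [← Finset.add_sum_erase _ _ (Finset.mem_univ a),
          ← Finset.add_sum_erase Finset.univ
            (fun d => f (slots m (swap b d * g) (swap b d a) d c x)) (Finset.mem_univ a),
          Finset.sum_congr rfl fun d hd => by
            rw [← Equiv.swap_apply_of_ne_of_ne hab (Finset.ne_of_mem_erase hd).symm]]
        simp only [Equiv.swap_apply_right, Equiv.swap_comm a b, sub_zero, add_zero]
        ring
    · intro hm f x
      obtain ⟨a, b, c, hx⟩ := exists_slots (m := m) (by lia) x
      rw [hx, sigmaSucc]
      generalize (1 : Equiv.Perm α) = g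
      simp only [map_add, map_sub, map_mul, LinearMap.add_apply, LinearMap.sub_apply,
        Module.End.mul_apply, Pi.add_apply, Pi.sub_apply,
        rep_s_zero hz (show m + 1 < k by lia), rep_pHalf_zero hz (show m + 1 < k by lia),
        rep_s_one hz hm, rep_pHalf_one hz hm,
        ihL (by lia), ihσ (show m + 1 < k by lia),
        rep_p_one hz (show m + 1 < k by lia), act_slots_one, act_slots_two, act_slots_three,
        slots_zero, slots_one, slots_two,
        Equiv.swap_apply_left, Equiv.swap_apply_right]
      by_cases hab : a = b
      · subst hab
        by_cases hac : a = c
        · subst hac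
          simp
        · simp [hac, Equiv.swap_comm c a]
      · by_cases hac : a = c
        · subst hac
          simp [hab, Equiv.swap_comm b a]
        · by_cases hbc : b = c
          · subst hbc
            simp [hab]
          · simp [hac, hab, Equiv.swap_apply_of_ne_of_ne hab hac]

theorem rep_L {m : ℕ} (hm : m < k) (f : (Fin k → α) → S) (x : Fin k → α) :
    rep hz (L z k (m + 1)) f x = ∑ d, f (act (m + 1) (swap (x ⟨m, hm⟩) d) x) :=
  (rep_L_and_sigmaSucc hz m).1 hm f x

/-- The transposition read off from columns `m` and `m + 1` acts here on the first `m` entries only,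
whereas for `sigmaSucc` it also acts on those two columns, where it exchanges their entries. -/
theorem rep_sigmaHalf {m : ℕ} (hm : m + 1 < k) (f : (Fin k → α) → S) (x : Fin k → α) :
    rep hz (sigmaHalf z k (m + 1)) f x =
      f (act m (swap (x ⟨m, by lia⟩) (x ⟨m + 1, hm⟩)) x) := by
  induction m generalizing f x with
  | zero =>
    rw [sigmaHalf, map_one]
    refine congrArg f (funext fun j => ?_)
    simp [act]
  | succ m ih =>
    obtain ⟨a, b, c, hx⟩ := exists_slots (m := m) (by lia) x
    rw [hx, sigmaHalf]
    generalize (1 : Equiv.Perm α) = g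
    simp only [map_add, map_sub, map_mul, LinearMap.add_apply, LinearMap.sub_apply,
      Module.End.mul_apply, Pi.add_apply, Pi.sub_apply,
      rep_s_zero hz (show m + 1 < k by lia), rep_pHalf_zero hz (show m + 1 < k by lia),
      rep_s_one hz hm, rep_pHalf_one hz hm,
      rep_L hz (show m < k by lia), ih (show m + 1 < k by lia),
      rep_p_one hz (show m + 1 < k by lia), act_slots_zero, act_slots_one,
      slots_zero, slots_one, slots_two,
      Equiv.swap_apply_left]
    by_cases hab : a = b
    · subst hab
      by_cases hac : a = c
      · subst hac
        simp
      · simp [hac]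
    · by_cases hac : a = c
      · subst hac
        simp [hab, Equiv.swap_comm b a]
      · by_cases hbc : b = c
        · subst hbc
          simp [hab]
        · simp [hac, hab, Equiv.swap_apply_of_ne_of_ne hab hac]

/-- The same bookkeeping as for `rep_L`. When the two last colors differ, `σ` cancels the summand `d
= a` of `s L s`, and `-L p` puts the correct one in its place. -/
theorem rep_LHalf {m : ℕ} (hm : m < k) (f : (Fin k → α) → S) (x : Fin k → α) :
    rep hz (LHalf z k m) f x = z * f x - ∑ d, f (act m (swap (x ⟨m, hm⟩) d) x) := by
  induction m generalizing f x with
  | zero =>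
    have h : ∀ g : Equiv.Perm α, act 0 g x = x := fun g => funext fun j => by simp [act]
    simp [LHalf, h, ← hz]
  | succ m ih =>
    obtain ⟨a, b, c, hx⟩ := exists_slots hm x
    rw [hx, LHalf]
    generalize (1 : Equiv.Perm α) = g
    simp only [map_add, map_sub, map_neg, map_mul, LinearMap.add_apply, LinearMap.sub_apply,
      LinearMap.neg_apply, Module.End.mul_apply, Pi.add_apply, Pi.sub_apply, Pi.neg_apply,
      rep_s_zero hz hm, rep_pHalf_zero hz hm, rep_L hz (show m < k by lia),
      ih (show m < k by lia), rep_sigmaHalf hz hm, rep_p_zero hz (show m < k by lia),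
      act_slots_zero, act_slots_one, slots_zero, slots_one,
      Equiv.swap_apply_left]
    by_cases hab : a = b
    · subst hab
      simp only [Equiv.swap_self, Equiv.swap_apply_left, Finset.sum_ite_eq', Finset.mem_univ,
        if_true]
      ring
    · simp only [hab, Finset.sum_ite_eq', Finset.mem_univ, if_true, if_false]
      rw [← Finset.add_sum_erase _ _ (Finset.mem_univ a),
        ← Finset.add_sum_erase Finset.univ
          (fun d => f (slots m (swap b d * g) (swap b d a) b c x)) (Finset.mem_univ a),
        Finset.sum_congr rfl fun d hd => by
          rw [← Equiv.swap_apply_of_ne_of_ne hab (Finset.ne_of_mem_erase hd).symm]]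
      simp only [Equiv.swap_apply_right, Equiv.swap_comm a b, sub_zero, add_zero]
      ring

end JucysMurphy

end PartAlg

end

-- Resolvent identities in a noncommutative ring.

noncomputable section

namespace PartAlg

section Resolvent

variable {Q ι : Type*} [Ring Q] {w κ B Z : Q}

theorem commute_resolvents {U A Z B : Q} (hAU : A * U = 1) (hUA : U * A = 1) (hBZ : B * Z = 1)
    (hZB : Z * B = 1) (hUZ : Commute U Z) : Commute A B := by
  have h1 : A * Z = Z * A := by
    calc A * Z = A * (Z * U) * A := by rw [mul_assoc, mul_assoc, hUA, mul_one]
      _ = Z * A := by rw [← hUZ.eq, ← mul_assoc, hAU, one_mul]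
  calc A * B = B * (Z * A) * B := by rw [← mul_assoc, hBZ, one_mul]
    _ = B * A := by rw [← h1, mul_assoc, mul_assoc, hZB, mul_one]

/-- The resolvent form of the relation `s u = z s - w`. -/
theorem resolvent_mul_swap {s U A : Q} (hw : ∀ q : Q, Commute w q) (hUA : U * A = 1)
    (hBZ : B * Z = 1) (hsU : s * U = Z * s - w) : B * s = s * A - w * (B * A) := by
  have h : B * (s * U) * A = B * (Z * s - w) * A := by rw [hsU]
  have h1 : B * (s * U) * A = B * s := by rw [mul_assoc, mul_assoc, hUA, mul_one]
  have h2 : B * (Z * s - w) * A = s * A - w * (B * A) := by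
    rw [mul_sub, ← mul_assoc, hBZ, one_mul, sub_mul, ← (hw B).eq, mul_assoc]
  rw [← h1, h, h2]

theorem swap_mul_resolvent {s U A : Q} (hw : ∀ q : Q, Commute w q) (hAU : A * U = 1)
    (hZB : Z * B = 1) (hs : s * s = 1) (hsU : s * U = Z * s - w) :
    A * s = s * B + w * (A * B) := by
  have hU : U * s = s * Z - w := by
    calc U * s = s * (s * U) * s := by rw [← mul_assoc, hs, one_mul]
      _ = s * Z * (s * s) - s * w * s := by rw [hsU, mul_sub, sub_mul]; simp only [mul_assoc]
      _ = s * Z - w := by rw [← (hw s).eq, mul_assoc w, hs, mul_one, mul_one]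
  calc A * s = A * (s * Z) * B := by rw [mul_assoc, mul_assoc, hZB, mul_one]
    _ = A * (U * s + w) * B := by rw [hU, sub_add_cancel]
    _ = s * B + w * (A * B) := by
      rw [mul_add, ← mul_assoc, hAU, one_mul, add_mul, ← (hw A).eq, mul_assoc w]

/-- Here `a` and `b` stand for scaled resolvents, and the two hypotheses are the degenerate affine
Hecke relation for them. Moving `s` past `b` and then past `a` leaves a single `s`, sandwiched
between two copies of `b`. -/
theorem conj_resolvent {s a b : Q} (hs : s * s = 1) (hab : Commute a b)
    (h1 : b * s = s * a - b * a) (h2 : a * s = s * b + a * b) :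
    s * b * s = a * (1 - b ^ 2) - b * s * b := by
  calc s * b * s = s * (b * s) := by rw [mul_assoc]
    _ = a - s * b * a := by rw [h1, mul_sub, ← mul_assoc, hs, one_mul, mul_assoc]
    _ = a - (a * s - a * b) * a := by rw [h2, add_sub_cancel_right]
    _ = a - a * (s * a - b * a) := by noncomm_ring
    _ = a - b * (a * s) := by rw [← h1, ← mul_assoc, hab.eq, mul_assoc]
    _ = a - (b * a) * b - b * s * b := by rw [h2]; noncomm_ring
    _ = a * (1 - b ^ 2) - b * s * b := by rw [← hab.eq]; noncomm_ring

variable (I : Finset ι) {s A U : ι → Q}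

/-- In `conj_resolvent` the involution survives only in the term `b s b`. Summed over all
involutions it becomes `B (Z - κ) (w B)`, which collapses because `B` inverts `Z`; what remains
factors. -/
theorem sum_resolvents (hw : ∀ q : Q, Commute w q) (hκ : ∀ q : Q, Commute κ q)
    (hAU : ∀ i ∈ I, A i * U i = 1) (hUA : ∀ i ∈ I, U i * A i = 1)
    (hBZ : B * Z = 1) (hZB : Z * B = 1) (hUZ : ∀ i ∈ I, Commute (U i) Z)
    (hs : ∀ i ∈ I, s i * s i = 1)
    (hsU : ∀ i ∈ I, s i * U i = Z * s i - w) (hsum : w * ∑ i ∈ I, s i = Z - κ) :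
    κ - w ^ 2 * (B + ∑ i ∈ I, s i * B * s i) =
      (κ - w ^ 2 * ∑ i ∈ I, A i) * (1 - w ^ 2 * B ^ 2) := by
  have hterm : ∀ i ∈ I, w * (s i * B * s i) =
      w * A i * (1 - (w * B) ^ 2) - B * (w * s i) * (w * B) := by
    intro i hi
    have key := conj_resolvent (s := s i) (a := w * A i) (b := w * B) (hs i hi)
      ((hw _).mul_left ((hw _).symm.mul_right
        (commute_resolvents (hAU i hi) (hUA i hi) hBZ hZB (hUZ i hi))))
      (by
        rw [mul_assoc, resolvent_mul_swap hw (hUA i hi) hBZ (hsU i hi), mul_sub, ← mul_assoc w,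
          (hw (s i)).eq, mul_assoc, mul_assoc w B, ← mul_assoc B w, ← (hw B).eq, mul_assoc w B])
      (by
        rw [mul_assoc, swap_mul_resolvent hw (hAU i hi) hZB (hs i hi) (hsU i hi), mul_add,
          ← mul_assoc w, (hw (s i)).eq, mul_assoc, mul_assoc w (A i), ← mul_assoc (A i) w,
          ← (hw (A i)).eq, mul_assoc w (A i)])
    calc w * (s i * B * s i) = s i * (w * B) * s i := by
          rw [← mul_assoc (s i) w, ← (hw (s i)).eq]; simp only [mul_assoc]
      _ = _ := key
      _ = _ := by rw [← mul_assoc B w, (hw B).eq]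
  have hsq : (w * B) ^ 2 = w ^ 2 * B ^ 2 := (hw B).mul_pow 2
  -- The term `- w B` produced here cancels against the isolated `B` of the goal.
  have hsum' : w * ∑ i ∈ I, s i * B * s i =
      w * (∑ i ∈ I, A i) * (1 - w ^ 2 * B ^ 2) - w * B + κ * (w * B ^ 2) := by
    rw [Finset.mul_sum, Finset.sum_congr rfl hterm, Finset.sum_sub_distrib, ← Finset.sum_mul,
      ← Finset.sum_mul, ← Finset.mul_sum, ← Finset.mul_sum, ← Finset.mul_sum, hsum, mul_sub B, hBZ,
      hsq, ← (hκ B).eq, sub_mul, one_mul, mul_assoc κ, ← mul_assoc B w, ← (hw B).eq, mul_assoc w B,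
      ← pow_two]
    abel
  rw [mul_add, pow_two w, mul_assoc w w (∑ i ∈ I, s i * B * s i), hsum', mul_add w, mul_sub w,
    (hw κ).left_comm]
  noncomm_ring

/-- Compressing `B s = s A - w B A` by `P` kills the term `s A`, since `P` commutes with `A` and `P
s P = 0`. Summing over the involutions and using `B Z = 1` turns this into a linear equation for `P
B P`. -/
theorem compressed_resolvent {P : Q} (hw : ∀ q : Q, Commute w q) (hκ : ∀ q : Q, Commute κ q)
    (hUA : ∀ i ∈ I, U i * A i = 1) (hBZ : B * Z = 1)
    (hsU : ∀ i ∈ I, s i * U i = Z * s i - w) (hsum : w * ∑ i ∈ I, s i = Z - κ)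
    (hP : P * P = P) (hPA : ∀ i ∈ I, Commute P (A i)) (hPs : ∀ i ∈ I, P * s i * P = 0) :
    P * B * P * (κ - w ^ 2 * ∑ i ∈ I, A i) = P := by
  have hterm : ∀ i ∈ I, P * (B * s i) * P = -(w * (P * B * P * A i)) := by
    intro i hi
    rw [resolvent_mul_swap hw (hUA i hi) hBZ (hsU i hi), mul_sub, sub_mul, ← mul_assoc P (s i),
      mul_assoc (P * s i), ← (hPA i hi).eq, ← mul_assoc, hPs i hi, zero_mul, zero_sub,
      ← mul_assoc P w, ← (hw P).eq, mul_assoc w, mul_assoc w, ← mul_assoc P B, mul_assoc (P * B),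
      ← (hPA i hi).eq, mul_assoc (P * B)]
  have h1 : w * ∑ i ∈ I, P * (B * s i) * P = P - κ * (P * B * P) := by
    rw [← Finset.sum_mul, ← Finset.mul_sum, ← Finset.mul_sum, ← mul_assoc w, ← mul_assoc w,
      (hw P).eq, mul_assoc P w, ← mul_assoc w, (hw B).eq, mul_assoc B w, hsum, mul_sub, hBZ,
      mul_sub, sub_mul, mul_one, hP, ← (hκ B).eq, ← mul_assoc P, ← (hκ P).eq]
    simp only [mul_assoc]
  rw [Finset.sum_congr rfl hterm, Finset.sum_neg_distrib, ← Finset.mul_sum, ← Finset.mul_sum] at h1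
  rw [mul_sub, ← (hκ _).eq, ← mul_assoc _ (w ^ 2), ← ((hw _).pow_left 2).eq, pow_two, mul_assoc,
    mul_assoc w w]
  have h2 : w * (w * (P * B * P * ∑ i ∈ I, A i)) = κ * (P * B * P) - P := by
    rw [← neg_sub P, ← h1]
    noncomm_ring
  simp only [← mul_assoc] at h2 ⊢
  rw [h2]
  abel

end Resolvent

section Geometric

variable {E : Type*} [Ring E]

/-- The geometric series `1 / (1 - y X)`. -/
def geo (y : E) : PowerSeries E := PowerSeries.mk fun j => y ^ j

open PowerSeries in
theorem geo_mul (y : E) : geo y * (1 - X * C y) = 1 := by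
  ext n
  rw [mul_sub, mul_one, ← mul_assoc, ← X_mul, map_sub]
  cases n with
  | zero => simp [geo]
  | succ n =>
    rw [mul_assoc, coeff_succ_X_mul, coeff_mul_C, geo, coeff_mk, coeff_mk, pow_succ, sub_self,
      coeff_one, if_neg n.succ_ne_zero]

open PowerSeries in
theorem mul_geo (y : E) : (1 - X * C y) * geo y = 1 := by
  ext n
  rw [sub_mul, one_mul, map_sub]
  cases n with
  | zero => simp [geo]
  | succ n =>
    rw [mul_assoc, coeff_succ_X_mul, coeff_C_mul, geo, coeff_mk, coeff_mk, pow_succ', sub_self,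
      coeff_one, if_neg n.succ_ne_zero]

open PowerSeries in
theorem C_mul_geo_of_mul_eq {q y y' : E} (h : q * y = y' * q) : C q * geo y = geo y' * C q := by
  ext n
  rw [coeff_C_mul, coeff_mul_C, geo, geo, coeff_mk, coeff_mk]
  exact (SemiconjBy.pow_right h n).eq

theorem commute_geo {y y' : E} (h : Commute y y') : Commute (geo y) (geo y') :=
  commute_resolvents (geo_mul y) (mul_geo y) (geo_mul y') (mul_geo y') (by
    have h1 : Commute (PowerSeries.C y) (PowerSeries.C y') := h.map PowerSeries.C
    have h2 : ∀ q : PowerSeries E, Commute PowerSeries.X q := fun q => (PowerSeries.commute_X q).symm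
    exact (Commute.one_left _).sub_left
      ((Commute.one_right _).sub_right (((h2 _).mul_left ((h2 _).symm.mul_right h1)))))

end Geometric

end PartAlg

end

-- Sums of transpositions and their generating series.

noncomputable section

namespace PartAlg

open Equiv (swap)

section Pow

variable {E : Type*} [Monoid E] {P T T' : E}

/-- An equality after multiplication by a projector does not pass to powers by itself. This version
is for `L_{m+1}`, whose local model commutes with it; the next is for `L_{m+1/2}`, whose local model
commutes with the projector. -/
theorem mul_pow_of_commute (h : P * T = P * T') (hT : Commute T T') (n : ℕ) :
    P * T ^ n = P * T' ^ n := by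
  induction n with
  | zero => simp
  | succ n ih => rw [pow_succ, ← mul_assoc, ih, mul_assoc, ← (hT.pow_right n).eq, ← mul_assoc, h,
      mul_assoc, pow_succ']

theorem mul_pow_of_commute_left (h : P * T = P * T') (hP : Commute P T') (n : ℕ) :
    P * T ^ n = P * T' ^ n := by
  induction n with
  | zero => simp
  | succ n ih => rw [pow_succ, ← mul_assoc, ih, (hP.pow_right n).eq, mul_assoc, h, ← mul_assoc,
      ← (hP.pow_right n).eq, mul_assoc, pow_succ]

end Pow

section Jucys

variable {S E : Type*} [CommRing S] [Ring E] [Algebra S E] {α : Type*} [Fintype α] [DecidableEq α]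
  (π : Equiv.Perm α →* E)

/-- The sum of the transpositions moving `b`, plus one, under a representation `π` of the symmetric
group. -/
def jucys (b : α) : E := ∑ c, π (swap b c)

/-- The analogue of `jucys π b` for the stabilizer of `a`. -/
def jucysErase (a b : α) : E := ∑ c ∈ Finset.univ.erase a, π (swap b c)

theorem map_mul_jucys (g : Equiv.Perm α) (b : α) : π g * jucys π b = jucys π (g b) * π g := by
  rw [jucys, jucys, Finset.mul_sum, Finset.sum_mul, ← Equiv.sum_comp g fun c => π (swap (g b) c) * π g]
  refine Finset.sum_congr rfl fun c _ => ?_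
  rw [← map_mul, ← map_mul, Equiv.mul_swap_eq_swap_mul]

omit [Fintype α] in
theorem map_swap_mul_self (a b : α) : π (swap a b) * π (swap a b) = 1 := by
  rw [← map_mul, Equiv.swap_mul_self, map_one]

theorem commute_jucysErase {x : E} {a b : α} (hb : b ≠ a)
    (h : ∀ g : Equiv.Perm α, g a = a → Commute x (π g)) : Commute x (jucysErase π a b) :=
  Commute.sum_right _ _ _ fun _ hc =>
    h _ (Equiv.swap_apply_of_ne_of_ne hb.symm (Finset.ne_of_mem_erase hc).symm)

theorem commute_jucys_of_apply_eq {g : Equiv.Perm α} {a : α} (h : g a = a) :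
    Commute (jucys π a) (π g) := by
  have := map_mul_jucys π g a
  rw [h] at this
  exact this.symm

/-- Conjugation by `(a b)` carries the transpositions `(b c)`, `c ≠ a`, to the `(a c)`, `c ≠ b`. The
missing `(a b)` accounts for the correction `-1`. -/
theorem swap_mul_jucysErase (a b : α) :
    π (swap a b) * jucysErase π a b = jucys π a * π (swap a b) - 1 := by
  have h : jucys π a - π (swap a b) = ∑ c ∈ Finset.univ.erase b, π (swap a c) := by
    rw [jucys, ← Finset.add_sum_erase _ _ (Finset.mem_univ b), add_sub_cancel_left]
  rw [← map_swap_mul_self π a b, ← sub_mul, h, jucysErase, Finset.mul_sum, Finset.sum_mul]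
  refine Finset.sum_equiv (swap a b) ?_ ?_
  · intro c
    simp only [Finset.mem_erase, Finset.mem_univ, and_true, ne_eq]
    rw [not_iff_not, Equiv.swap_apply_eq_iff, Equiv.swap_apply_right]
  · intro c _
    rw [← map_mul, ← map_mul, Equiv.mul_swap_eq_swap_mul, Equiv.swap_apply_right]

theorem sum_swap_erase (a : α) : ∑ b ∈ Finset.univ.erase a, π (swap a b) = jucys π a - 1 := by
  rw [jucys, ← Finset.add_sum_erase _ _ (Finset.mem_univ a), Equiv.swap_self, ← Equiv.Perm.one_def,
    map_one, add_sub_cancel_left]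

open PowerSeries in
theorem commute_C_algebraMap (c : S) (q : PowerSeries E) : Commute (C (algebraMap S E c)) q := by
  ext n
  rw [coeff_C_mul, coeff_mul_C]
  exact Algebra.commutes c _

/-- The element `ε (h - y)`. -/
def signedShift (ε h : S) (y : E) : E := algebraMap S E ε * (algebraMap S E h - y)

theorem commute_signedShift {ε h : S} {x y : E} (hxy : Commute x y) : Commute x (signedShift ε h y) :=
  (Algebra.commute_algebraMap_right _ _).mul_right
    ((Algebra.commute_algebraMap_right _ _).sub_right hxy)

theorem mul_signedShift_of_mul_eq {ε h : S} {q y y' : E} (hy : q * y = y' * q) :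
    q * signedShift ε h y = signedShift ε h y' * q := by
  rw [signedShift, signedShift, ← mul_assoc, ← Algebra.commutes ε q, mul_assoc, mul_assoc, mul_sub, sub_mul, hy,
    Algebra.commutes h q]

theorem mul_signedShift_congr {ε h : S} {q y y' : E} (hy : q * y = q * y') :
    q * signedShift ε h y = q * signedShift ε h y' := by
  rw [signedShift, signedShift, ← mul_assoc, ← mul_assoc, ← Algebra.commutes ε q, mul_assoc, mul_assoc, mul_sub q,
    mul_sub q, hy]

/-- The polynomial `1 - ε (h - 1) X`. -/
def leadPoly (E : Type*) [Ring E] [Algebra S E] (ε h : S) : PowerSeries E :=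
  1 - PowerSeries.X * PowerSeries.C (algebraMap S E (ε * (h - 1)))

/-- The generating series of the central elements `∑_b (ε (h - J_b)) ^ j`, normalised to have
constant coefficient `1`. -/
def hat (ε h : S) : PowerSeries E :=
  leadPoly E ε h - PowerSeries.X ^ 2 * ∑ b, geo (signedShift ε h (jucys π b))

/-- The analogue of `hat ε h π` for the stabilizer of `a`. -/
def hatErase (ε h : S) (a : α) : PowerSeries E :=
  leadPoly E ε h -
    PowerSeries.X ^ 2 * ∑ b ∈ Finset.univ.erase a, geo (signedShift ε h (jucysErase π a b))

theorem commute_leadPoly (ε h : S) (q : PowerSeries E) : Commute (leadPoly E ε h) q :=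
  (Commute.one_left _).sub_left
    ((PowerSeries.commute_X q).symm.mul_left (commute_C_algebraMap _ _))

variable {ε : S} (h : S)

-- The relation of `swap_mul_jucysErase` in the shape `s U = Z s - w` required by the resolvent
-- identities, with `w = ε X`.
open PowerSeries in
theorem swap_mul_one_sub (a b : α) :
    C (π (swap a b)) * (1 - X * C (signedShift ε h (jucysErase π a b))) =
      (1 - X * C (signedShift ε h (jucys π a))) * C (π (swap a b)) - X * C (algebraMap S E ε) := by
  have h1 : π (swap a b) * signedShift ε h (jucysErase π a b) =
      signedShift ε h (jucys π a) * π (swap a b) + algebraMap S E ε := by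
    rw [signedShift, ← mul_assoc, ← Algebra.commutes ε, mul_assoc, mul_sub, swap_mul_jucysErase π a b,
      ← Algebra.commutes h, signedShift]
    noncomm_ring
  rw [mul_sub, sub_mul, mul_one, one_mul, ← mul_assoc, (commute_X _).eq, mul_assoc, ← map_mul, h1,
    mul_assoc, ← map_mul, map_add, mul_add]
  abel

open PowerSeries in
theorem X_mul_sum_swap (a : α) :
    X * C (algebraMap S E ε) * ∑ b ∈ Finset.univ.erase a, C (π (swap a b)) =
      (1 - X * C (signedShift ε h (jucys π a))) - leadPoly E ε h := by
  rw [← map_sum, sum_swap_erase, mul_assoc, ← map_mul, leadPoly, sub_sub_sub_cancel_left, ← mul_sub,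
    ← map_sub, signedShift]
  congr 2
  simp only [map_mul, map_sub, map_one]
  noncomm_ring

theorem commute_X_mul_C_algebraMap (c : S) (q : PowerSeries E) :
    Commute (PowerSeries.X * PowerSeries.C (algebraMap S E c)) q :=
  (PowerSeries.commute_X q).symm.mul_left (commute_C_algebraMap _ _)

open PowerSeries in
theorem sq_X_mul_C (hε : ε * ε = 1) : (X * C (algebraMap S E ε)) ^ 2 = X ^ 2 := by
  rw [(commute_X _).symm.mul_pow, pow_two (C _), ← map_mul, ← map_mul, hε, map_one, map_one, mul_one]

-- An instance of `sum_resolvents`: the `A`'s are the resolvents of the `J_b'`, `B` is that of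
-- `J_a`, and `π((a b))` conjugates `B` to the resolvent of `J_b`. Since `w = ε X`, the condition
-- `ε² = 1` makes `w² = X²` for both choices of sign.
open PowerSeries in
theorem hat_eq (hε : ε * ε = 1) (a : α) :
    hat π ε h = hatErase π ε h a * (1 - X ^ 2 * geo (signedShift ε h (jucys π a)) ^ 2) := by
  have key := sum_resolvents (Finset.univ.erase a)
    (w := X * C (algebraMap S E ε)) (κ := leadPoly E ε h)
    (B := geo (signedShift ε h (jucys π a))) (Z := 1 - X * C (signedShift ε h (jucys π a)))
    (s := fun b => C (π (swap a b)))
    (A := fun b => geo (signedShift ε h (jucysErase π a b)))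
    (U := fun b => 1 - X * C (signedShift ε h (jucysErase π a b)))
    (commute_X_mul_C_algebraMap ε) (commute_leadPoly ε h)
    (fun _ _ => geo_mul _) (fun _ _ => mul_geo _) (geo_mul _) (mul_geo _)
    (fun b hb => by
      have h1 : Commute (signedShift ε h (jucysErase π a b)) (signedShift ε h (jucys π a)) :=
        (commute_signedShift (commute_signedShift (commute_jucysErase π (Finset.ne_of_mem_erase hb)
          fun g hg => commute_jucys_of_apply_eq π hg)).symm)
      have h2 := h1.map (C (R := E))
      have h3 : ∀ q : PowerSeries E, Commute X q := fun q => (commute_X q).symm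
      exact (Commute.one_left _).sub_left
        ((Commute.one_right _).sub_right ((h3 _).mul_left ((h3 _).symm.mul_right h2))))
    (fun b _ => by rw [← map_mul, map_swap_mul_self, map_one])
    (fun b _ => swap_mul_one_sub π h a b)
    (X_mul_sum_swap π h a)
  rw [sq_X_mul_C hε] at key
  rw [hatErase, ← key, hat, ← Finset.add_sum_erase _ _ (Finset.mem_univ a)]
  congr 3
  refine Finset.sum_congr rfl fun b _ => ?_
  -- Identifies the conjugate of the resolvent of `J_a` with the resolvent of `J_b`.
  have h1 := map_mul_jucys π (swap a b) a
  rw [Equiv.swap_apply_left] at h1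
  rw [C_mul_geo_of_mul_eq (mul_signedShift_of_mul_eq h1), mul_assoc, ← map_mul, map_swap_mul_self, map_one,
    mul_one]

-- `P` is to be the projector onto the color `a` in one factor: a transposition moving `a` sends its
-- range to another color, hence `P s P = 0`, while the stabilizer of `a` preserves the range.
open PowerSeries in
theorem compressed_geo_mul_hatErase (hε : ε * ε = 1) {a : α} {P : E} (hP : P * P = P)
    (hPs : ∀ b, b ≠ a → P * π (swap a b) * P = 0)
    (hPg : ∀ g : Equiv.Perm α, g a = a → Commute P (π g)) :
    C P * geo (signedShift ε h (jucys π a)) * C P * hatErase π ε h a = C P := by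
  have key := compressed_resolvent (Finset.univ.erase a) (P := C P)
    (w := X * C (algebraMap S E ε)) (κ := leadPoly E ε h)
    (B := geo (signedShift ε h (jucys π a))) (Z := 1 - X * C (signedShift ε h (jucys π a)))
    (s := fun b => C (π (swap a b)))
    (A := fun b => geo (signedShift ε h (jucysErase π a b)))
    (U := fun b => 1 - X * C (signedShift ε h (jucysErase π a b)))
    (commute_X_mul_C_algebraMap ε) (commute_leadPoly ε h)
    (fun _ _ => mul_geo _) (geo_mul _)
    (fun b _ => swap_mul_one_sub π h a b)
    (X_mul_sum_swap π h a) (by rw [← map_mul, hP])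
    (fun b hb => C_mul_geo_of_mul_eq
      (commute_signedShift (commute_jucysErase π (Finset.ne_of_mem_erase hb) hPg)).eq)
    (fun b hb => by rw [← map_mul, ← map_mul, hPs b (Finset.ne_of_mem_erase hb), map_zero])
  rwa [sq_X_mul_C hε] at key

open PowerSeries in
theorem commute_hatErase {a : α} {P : E} (hPg : ∀ g : Equiv.Perm α, g a = a → Commute P (π g)) :
    Commute (C P) (hatErase π ε h a) := by
  refine (commute_leadPoly ε h _).symm.sub_right (((commute_X_pow _ _)).mul_right
    (Commute.sum_right _ _ _ fun b hb => ?_))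
  exact C_mul_geo_of_mul_eq
    (commute_signedShift (commute_jucysErase π (Finset.ne_of_mem_erase hb) hPg)).eq

open PowerSeries in
theorem C_mul_geo_congr {P T T' : E} (h : ∀ n, P * T ^ n = P * T' ^ n) :
    C P * geo T = C P * geo T' := by
  ext n
  rw [coeff_C_mul, coeff_C_mul, geo, geo, coeff_mk, coeff_mk, h]

-- `hatErase` is built only from transpositions fixing `a`, so two representations agreeing on the
-- stabilizer of `a` after multiplication by `P` give the same series.
open PowerSeries in
theorem C_mul_hatErase_congr (ε : S) {π' : Equiv.Perm α →* E} {a : α} {P : E}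
    (hP : ∀ g : Equiv.Perm α, g a = a → Commute P (π' g))
    (hππ : ∀ g : Equiv.Perm α, g a = a → P * π g = P * π' g) :
    C P * hatErase π ε h a = C P * hatErase π' ε h a := by
  rw [hatErase, hatErase, mul_sub, mul_sub, ← mul_assoc, ← mul_assoc, (commute_X_pow _ 2).eq,
    mul_assoc, mul_assoc, Finset.mul_sum _ _ (C P), Finset.mul_sum _ _ (C P)]
  refine congrArg (fun t => C P * leadPoly E ε h - X ^ 2 * t)
    (Finset.sum_congr rfl fun b hb => C_mul_geo_congr fun n => ?_)
  refine mul_pow_of_commute_left (mul_signedShift_congr ?_) (commute_signedShift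
    (commute_jucysErase π' (Finset.ne_of_mem_erase hb) hP)) n
  rw [jucysErase, jucysErase, Finset.mul_sum, Finset.mul_sum]
  refine Finset.sum_congr rfl fun c hc => hππ _ ?_
  exact Equiv.swap_apply_of_ne_of_ne (Finset.ne_of_mem_erase hb).symm
    (Finset.ne_of_mem_erase hc).symm

open PowerSeries in
theorem C_mul_hat (hε : ε * ε = 1) {a : α} {P y : E}
    (hPg : ∀ g : Equiv.Perm α, g a = a → Commute P (π g))
    (hy : C P * geo y ^ 2 = C P * geo (signedShift ε h (jucys π a)) ^ 2) :
    C P * hat π ε h = hatErase π ε h a * C P * (1 - X ^ 2 * geo y ^ 2) := by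
  rw [hat_eq π h hε a, ← mul_assoc, (commute_hatErase π h hPg).eq, mul_assoc, mul_assoc]
  congr 1
  rw [mul_sub, mul_sub, ← mul_assoc, ← mul_assoc, (commute_X_pow _ 2).eq, mul_assoc, mul_assoc, hy]

open PowerSeries in
theorem commute_one_sub_sq {y y' : E} (hy : Commute y y') :
    Commute (1 - X ^ 2 * geo y ^ 2) (1 - X ^ 2 * geo y' ^ 2) :=
  (Commute.one_left _).sub_left ((Commute.one_right _).sub_right
    (((commute_X_pow _ 2).symm).mul_left
      ((commute_X_pow _ 2).mul_right ((commute_geo hy).pow_pow 2 2))))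

end Jucys

section Sum

variable {Q ι : Type*} [Ring Q] [Fintype ι] {P F G : ι → Q} {H H' Y Y' : Q}

/-- Eliminates the local factors `F a` without inverting them: both sides equal `∑ F a P a Y Y'`. -/
theorem mul_eq_mul_of_blocks (hP : ∑ a, P a = 1) (h : ∀ a, P a * H = F a * P a * Y)
    (h' : ∀ a, P a * H' = F a * P a * Y') (hY : Commute Y Y') : H * Y' = H' * Y := by
  rw [← one_mul H, ← one_mul H', ← hP, Finset.sum_mul, Finset.sum_mul, Finset.sum_mul,
    Finset.sum_mul]
  refine Finset.sum_congr rfl fun a _ => ?_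
  rw [h, h', mul_assoc, hY.eq, ← mul_assoc]

/-- Each compressed block `P G P` undoes its own factor `F`, leaving the common right factor `Y`;
the projectors then add up to `1`. -/
theorem sum_blocks_mul (hP : ∑ a, P a = 1) (hPP : ∀ a, P a * P a = P a)
    (hF : ∀ a, P a * G a * P a * F a = P a) (h : ∀ a, P a * H = F a * P a * Y) :
    (∑ a, P a * G a * P a) * H = Y := by
  have key : ∀ a, P a * G a * P a * H = P a * Y := by
    intro a
    calc P a * G a * P a * H = P a * G a * P a * (P a * H) := by
          rw [← mul_assoc, mul_assoc _ (P a) (P a), hPP]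
      _ = P a * G a * P a * F a * P a * Y := by rw [h]; simp only [mul_assoc]
      _ = P a * Y := by rw [hF, hPP]
  rw [Finset.sum_mul, Finset.sum_congr rfl fun a _ => key a, ← Finset.sum_mul, hP, one_mul]

end Sum

end PartAlg

end

-- The symmetric group on tensor space and the two recursions.

noncomputable section

namespace PartAlg

open Equiv (swap)

section Operators

variable {S : Type*} [CommRing S] {k : ℕ} {α : Type*}

theorem act_mul (m : ℕ) (g h : Equiv.Perm α) (x : Fin k → α) :
    act m (g * h) x = act m g (act m h x) := by
  funext j
  simp only [act]
  split_ifs <;> rfl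

theorem act_one (m : ℕ) (x : Fin k → α) : act m 1 x = x := by
  funext j
  simp [act]

/-- The action of permutations on the first `m` tensor factors. -/
def permOp (S : Type*) [CommRing S] (k : ℕ) (m : ℕ) : Equiv.Perm α →* TensorEnd S k α where
  -- Operators pull back functions of colorings, which reverses products; the inverse restores
  -- multiplicativity and is invisible on transpositions.
  toFun g := LinearMap.funLeft S S (act m g⁻¹)
  map_one' := LinearMap.ext fun f => funext fun x => congrArg f (by rw [inv_one, act_one])
  map_mul' g h := LinearMap.ext fun f => funext fun x =>
    congrArg f (by rw [mul_inv_rev, act_mul])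

theorem permOp_apply (m : ℕ) (g : Equiv.Perm α) (f : (Fin k → α) → S) (x : Fin k → α) :
    permOp S k m g f x = f (act m g⁻¹ x) := rfl

variable [DecidableEq α]

/-- The projector onto the span of the basis tensors whose `j`-th factor is `a`. -/
def proj (S : Type*) [CommRing S] {k : ℕ} (j : Fin k) (a : α) : TensorEnd S k α where
  toFun f x := if x j = a then f x else 0
  map_add' f g := by
    ext x
    simp only [Pi.add_apply]
    split_ifs <;> simp
  map_smul' c f := by
    ext x
    simp only [Pi.smul_apply, RingHom.id_apply]
    split_ifs <;> simp

theorem proj_apply (j : Fin k) (a : α) (f : (Fin k → α) → S) (x : Fin k → α) :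
    proj S j a f x = if x j = a then f x else 0 := rfl

theorem permOp_mul_proj_of_lt {m : ℕ} {j : Fin k} (hj : (j : ℕ) < m) (g : Equiv.Perm α) (a : α) :
    permOp S k m g * proj S j a = proj S j (g a) * permOp S k m g := by
  refine LinearMap.ext fun f => funext fun x => ?_
  simp only [Module.End.mul_apply, permOp_apply, proj_apply]
  have : act m g⁻¹ x j = a ↔ x j = g a := by
    rw [act, if_pos hj, Equiv.Perm.inv_eq_iff_eq, eq_comm]
  simp only [this]

theorem commute_permOp_proj {m : ℕ} {j : Fin k} (hj : m ≤ j) (g : Equiv.Perm α) (a : α) :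
    Commute (permOp S k m g) (proj S j a) := by
  refine LinearMap.ext fun f => funext fun x => ?_
  simp only [Module.End.mul_apply, permOp_apply, proj_apply]
  rw [act, if_neg (not_lt.2 hj)]

theorem proj_mul_self (j : Fin k) (a : α) : proj S j a * proj S j a = proj S j a := by
  refine LinearMap.ext fun f => funext fun x => ?_
  simp only [Module.End.mul_apply, proj_apply]
  split_ifs <;> rfl

theorem proj_mul_proj (j : Fin k) {a b : α} (hab : a ≠ b) : proj S j a * proj S j b = 0 := by
  refine LinearMap.ext fun f => funext fun x => ?_
  simp only [Module.End.mul_apply, proj_apply]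
  split_ifs with h1 h2
  · exact absurd (h1.symm.trans h2) hab
  · rfl
  · rfl

theorem commute_proj (i j : Fin k) (a b : α) : Commute (proj S i a) (proj S j b) := by
  refine LinearMap.ext fun f => funext fun x => ?_
  simp only [Module.End.mul_apply, proj_apply]
  split_ifs <;> rfl

/-- The levels `m` and `m + 1` differ only in the factor of index `m`, whose color `a` is fixed by
`g`. This is what links two consecutive levels. -/
theorem proj_mul_permOp_succ {m : ℕ} (hm : m < k) {g : Equiv.Perm α} {a : α} (hg : g a = a) :
    proj S (⟨m, hm⟩ : Fin k) a * permOp S k (m + 1) g =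
      proj S (⟨m, hm⟩ : Fin k) a * permOp S k m g := by
  refine LinearMap.ext fun f => funext fun x => ?_
  simp only [Module.End.mul_apply, permOp_apply, proj_apply]
  split_ifs with hx
  · refine congrArg f (funext fun j => ?_)
    simp only [act]
    by_cases h1 : (j : ℕ) < m
    · rw [if_pos h1, if_pos (by lia)]
    · rw [if_neg h1]
      split_ifs with h2
      · have : j = ⟨m, hm⟩ := Fin.ext (by simp only; lia)
        rw [this, hx, Equiv.Perm.inv_eq_iff_eq, hg]
      · rfl
  · rfl

omit [DecidableEq α] in
theorem permOp_mul_permOp {m n : ℕ} (hmn : m ≤ n) (g h : Equiv.Perm α) :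
    permOp S k n g * permOp S k m h = permOp S k m (g * h * g⁻¹) * permOp S k n g := by
  refine LinearMap.ext fun f => funext fun x => congrArg f (funext fun j => ?_)
  simp only [act]
  by_cases h1 : (j : ℕ) < m
  · simp [h1, lt_of_lt_of_le h1 hmn, mul_inv_rev, mul_assoc]
  · simp [h1]

variable [Fintype α]

theorem sum_proj (j : Fin k) : ∑ a, proj S j a = (1 : TensorEnd S k α) := by
  refine LinearMap.ext fun f => funext fun x => ?_
  simp [LinearMap.sum_apply, proj_apply]

/-- The operator of the Jucys–Murphy element `L_{m+1}`. -/
def opL (S : Type*) [CommRing S] (α : Type*) [DecidableEq α] [Fintype α] {m : ℕ} (hm : m < k) :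
    TensorEnd S k α :=
  ∑ a, proj S (⟨m, hm⟩ : Fin k) a * jucys (permOp S k (m + 1)) a

/-- The operator of `z - L_{m+1/2}`. -/
def opLHalf (S : Type*) [CommRing S] (α : Type*) [DecidableEq α] [Fintype α] {m : ℕ}
    (hm : m < k) : TensorEnd S k α :=
  ∑ a, proj S (⟨m, hm⟩ : Fin k) a * jucys (permOp S k m) a

theorem jucys_permOp_apply (m : ℕ) (a : α) (f : (Fin k → α) → S) (x : Fin k → α) :
    jucys (permOp S k m) a f x = ∑ c, f (act m (swap a c) x) := by
  simp only [jucys, LinearMap.sum_apply, Finset.sum_apply, permOp_apply, Equiv.swap_inv]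

theorem sum_proj_mul_apply (j : Fin k) (T : α → TensorEnd S k α) (f : (Fin k → α) → S)
    (x : Fin k → α) : (∑ a, proj S j a * T a) f x = T (x j) f x := by
  simp [LinearMap.sum_apply, Module.End.mul_apply, proj_apply]

theorem rep_L_eq {z : S} (hz : (Fintype.card α : S) = z) {m : ℕ} (hm : m < k) :
    rep hz (L z k (m + 1)) = opL S α hm := by
  refine LinearMap.ext fun f => funext fun x => ?_
  rw [rep_L hz hm, opL, sum_proj_mul_apply, jucys_permOp_apply]

theorem rep_LHalf_eq {z : S} (hz : (Fintype.card α : S) = z) {m : ℕ} (hm : m < k) :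
    rep hz (LHalf z k m) = algebraMap S (TensorEnd S k α) z - opLHalf S α hm := by
  refine LinearMap.ext fun f => funext fun x => ?_
  rw [rep_LHalf hz hm, opLHalf, LinearMap.sub_apply, Pi.sub_apply, sum_proj_mul_apply,
    jucys_permOp_apply]
  rfl

variable {m : ℕ} (hm : m < k)

theorem proj_mul_sum_proj_mul (j : Fin k) (T : α → TensorEnd S k α) (a : α) :
    proj S j a * ∑ b, proj S j b * T b = proj S j a * T a := by
  rw [Finset.mul_sum, Finset.sum_eq_single a, ← mul_assoc, proj_mul_self]
  · intro b _ hb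
    rw [← mul_assoc, proj_mul_proj j hb.symm, zero_mul]
  · simp

/-- A permutation of the colors merely permutes the summands of `opL`. -/
theorem commute_opL_permOp (g : Equiv.Perm α) : Commute (opL S α hm) (permOp S k (m + 1) g) := by
  refine Commute.symm ?_
  rw [Commute, SemiconjBy, opL, Finset.mul_sum, Finset.sum_mul,
    ← Equiv.sum_comp g fun a => proj S (⟨m, hm⟩ : Fin k) a * jucys (permOp S k (m + 1)) a *
      permOp S k (m + 1) g]
  refine Finset.sum_congr rfl fun a _ => ?_
  rw [← mul_assoc, permOp_mul_proj_of_lt (by simp), mul_assoc, map_mul_jucys, mul_assoc]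

theorem permOp_mul_jucys_of_le {n : ℕ} (hmn : m ≤ n) (g : Equiv.Perm α) (a : α) :
    permOp S k n g * jucys (permOp S k m) a = jucys (permOp S k m) (g a) * permOp S k n g := by
  rw [jucys, jucys, Finset.mul_sum, Finset.sum_mul,
    ← Equiv.sum_comp g fun c => permOp S k m (swap (g a) c) * permOp S k n g]
  refine Finset.sum_congr rfl fun c _ => ?_
  rw [permOp_mul_permOp hmn, Equiv.mul_swap_eq_swap_mul, mul_assoc, mul_inv_cancel, mul_one]

theorem commute_opLHalf_permOp (g : Equiv.Perm α) :
    Commute (opLHalf S α hm) (permOp S k (m + 1) g) := by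
  refine Commute.symm ?_
  rw [Commute, SemiconjBy, opLHalf, Finset.mul_sum, Finset.sum_mul,
    ← Equiv.sum_comp g fun a => proj S (⟨m, hm⟩ : Fin k) a * jucys (permOp S k m) a *
      permOp S k (m + 1) g]
  refine Finset.sum_congr rfl fun a _ => ?_
  rw [← mul_assoc, permOp_mul_proj_of_lt (by simp), mul_assoc,
    permOp_mul_jucys_of_le (Nat.le_succ m), mul_assoc]

theorem commute_jucys_proj {n : ℕ} {j : Fin k} (hj : n ≤ j) (a b : α) :
    Commute (jucys (permOp S k n) a) (proj S j b) :=
  Commute.sum_left _ _ _ fun _ _ => commute_permOp_proj hj _ _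

theorem commute_opLHalf_proj (j : Fin k) (hj : m ≤ j) (a : α) :
    Commute (opLHalf S α hm) (proj S j a) :=
  Commute.sum_left _ _ _ fun _ _ => (commute_proj _ _ _ _).mul_left (commute_jucys_proj hj _ _)

theorem commute_opL_proj (j : Fin k) (hj : m < j) (a : α) :
    Commute (opL S α hm) (proj S j a) :=
  Commute.sum_left _ _ _ fun _ _ => (commute_proj _ _ _ _).mul_left (commute_jucys_proj hj _ _)

theorem commute_opL_opLHalf : Commute (opL S α hm) (opLHalf S α hm) :=
  Commute.sum_left _ _ _ fun _ _ => ((commute_opLHalf_proj hm _ le_rfl _).symm).mul_left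
    (Commute.sum_left _ _ _ fun _ _ => (commute_opLHalf_permOp hm _).symm)

theorem proj_mul_opL (a : α) : proj S (⟨m, hm⟩ : Fin k) a * opL S α hm =
    proj S (⟨m, hm⟩ : Fin k) a * jucys (permOp S k (m + 1)) a :=
  proj_mul_sum_proj_mul _ _ _

theorem proj_mul_opLHalf (a : α) : proj S (⟨m, hm⟩ : Fin k) a * opLHalf S α hm =
    proj S (⟨m, hm⟩ : Fin k) a * jucys (permOp S k m) a :=
  proj_mul_sum_proj_mul _ _ _

variable (ε h : S)

theorem proj_mul_pow_opL (a : α) (n : ℕ) :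
    proj S (⟨m, hm⟩ : Fin k) a * signedShift ε h (opL S α hm) ^ n =
      proj S (⟨m, hm⟩ : Fin k) a * signedShift ε h (jucys (permOp S k (m + 1)) a) ^ n :=
  mul_pow_of_commute (mul_signedShift_congr (proj_mul_opL hm a))
    (commute_signedShift (commute_signedShift (Commute.sum_right _ _ _ fun _ _ =>
      commute_opL_permOp hm _)).symm).symm n

theorem proj_mul_pow_opLHalf (a : α) (n : ℕ) :
    proj S (⟨m, hm⟩ : Fin k) a * signedShift ε h (opLHalf S α hm) ^ n =
      proj S (⟨m, hm⟩ : Fin k) a * signedShift ε h (jucys (permOp S k m) a) ^ n :=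
  mul_pow_of_commute_left (mul_signedShift_congr (proj_mul_opLHalf hm a))
    (commute_signedShift (commute_jucys_proj le_rfl _ _).symm) n

open PowerSeries

theorem C_proj_mul_geo_opL_sq (a : α) :
    C (proj S (⟨m, hm⟩ : Fin k) a) * geo (signedShift ε h (opL S α hm)) ^ 2 =
      C (proj S (⟨m, hm⟩ : Fin k) a) * geo (signedShift ε h (jucys (permOp S k (m + 1)) a)) ^ 2 :=
  mul_pow_of_commute (C_mul_geo_congr (proj_mul_pow_opL hm ε h a))
    (commute_geo (commute_signedShift (commute_signedShift (Commute.sum_right _ _ _ fun _ _ =>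
      commute_opL_permOp hm _)).symm).symm) 2

theorem C_proj_mul_geo_opLHalf_sq (a : α) :
    C (proj S (⟨m, hm⟩ : Fin k) a) * geo (signedShift ε h (opLHalf S α hm)) ^ 2 =
      C (proj S (⟨m, hm⟩ : Fin k) a) * geo (signedShift ε h (jucys (permOp S k m) a)) ^ 2 :=
  mul_pow_of_commute_left (C_mul_geo_congr (proj_mul_pow_opLHalf hm ε h a))
    (C_mul_geo_of_mul_eq (commute_signedShift (commute_jucys_proj le_rfl _ _).symm).eq) 2

omit [Fintype α] in
theorem commute_proj_permOp_of_apply_eq {g : Equiv.Perm α} {a : α} (hg : g a = a) :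
    Commute (proj S (⟨m, hm⟩ : Fin k) a) (permOp S k (m + 1) g) := by
  have := permOp_mul_proj_of_lt (S := S) (m := m + 1) (j := (⟨m, hm⟩ : Fin k)) (by simp) g a
  rw [hg] at this
  exact this.symm

theorem proj_mul_hatErase_succ (a : α) :
    C (proj S (⟨m, hm⟩ : Fin k) a) * hatErase (permOp S k (m + 1)) ε h a =
      C (proj S (⟨m, hm⟩ : Fin k) a) * hatErase (permOp S k m) ε h a :=
  C_mul_hatErase_congr _ h ε (fun g _ => (commute_permOp_proj le_rfl g a).symm)
    fun _ hg => proj_mul_permOp_succ hm hg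

variable {ε}

/-- The factor is written at level `m`, not `m + 1`, so that it coincides with the one in
`C_proj_mul_hat` and can be eliminated. -/
theorem C_proj_mul_hat_succ (hε : ε * ε = 1) (a : α) :
    C (proj S (⟨m, hm⟩ : Fin k) a) * hat (permOp S k (m + 1)) ε h =
      hatErase (permOp S k m) ε h a * C (proj S (⟨m, hm⟩ : Fin k) a) *
        (1 - X ^ 2 * geo (signedShift ε h (opL S α hm)) ^ 2) := by
  have h1 := C_mul_hat (permOp S k (m + 1)) h hε (a := a) (P := proj S (⟨m, hm⟩ : Fin k) a)
    (fun _ hg => commute_proj_permOp_of_apply_eq hm hg) (C_proj_mul_geo_opL_sq hm ε h a)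
  have h2 := commute_hatErase (permOp S k (m + 1)) (ε := ε) h (a := a)
    (P := proj S (⟨m, hm⟩ : Fin k) a) fun _ hg => commute_proj_permOp_of_apply_eq hm hg
  have h3 := commute_hatErase (permOp S k m) (ε := ε) h (a := a)
    (P := proj S (⟨m, hm⟩ : Fin k) a) fun g _ => (commute_permOp_proj le_rfl g a).symm
  rw [h1, ← h2.eq, proj_mul_hatErase_succ, h3.eq]

theorem C_proj_mul_hat (hε : ε * ε = 1) (a : α) :
    C (proj S (⟨m, hm⟩ : Fin k) a) * hat (permOp S k m) ε h =
      hatErase (permOp S k m) ε h a * C (proj S (⟨m, hm⟩ : Fin k) a) *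
        (1 - X ^ 2 * geo (signedShift ε h (opLHalf S α hm)) ^ 2) :=
  C_mul_hat _ h hε (fun g _ => (commute_permOp_proj le_rfl g a).symm)
    (C_proj_mul_geo_opLHalf_sq hm ε h a)

theorem sum_C_proj (j : Fin k) : ∑ a, C (proj S j a) = (1 : PowerSeries (TensorEnd S k α)) := by
  rw [← map_sum, sum_proj, map_one]

/-- The recursion for the generating series of the central elements of the symmetric group. -/
theorem hat_recursion (hε : ε * ε = 1) :
    hat (permOp S k (m + 1)) ε h * (1 - X ^ 2 * geo (signedShift ε h (opLHalf S α hm)) ^ 2) =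
      hat (permOp S k m) ε h * (1 - X ^ 2 * geo (signedShift ε h (opL S α hm)) ^ 2) :=
  mul_eq_mul_of_blocks (sum_C_proj (S := S) (⟨m, hm⟩ : Fin k)) (C_proj_mul_hat_succ hm h hε)
    (C_proj_mul_hat hm h hε) (commute_one_sub_sq (commute_signedShift (commute_signedShift
      (commute_opL_opLHalf hm).symm).symm))

/-- The diagonal blocks of the resolvents of the Jucys–Murphy elements. -/
def diagSeries (S : Type*) [CommRing S] (α : Type*) [DecidableEq α] [Fintype α] {m : ℕ}
    (hm : m < k) (ε h : S) : PowerSeries (TensorEnd S k α) :=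
  ∑ a, C (proj S (⟨m, hm⟩ : Fin k) a) *
    geo (signedShift ε h (jucys (permOp S k (m + 1)) a)) * C (proj S (⟨m, hm⟩ : Fin k) a)

theorem diag_mul_hatErase (hε : ε * ε = 1) (a : α) :
    C (proj S (⟨m, hm⟩ : Fin k) a) * geo (signedShift ε h (jucys (permOp S k (m + 1)) a)) *
      C (proj S (⟨m, hm⟩ : Fin k) a) * hatErase (permOp S k m) ε h a =
        C (proj S (⟨m, hm⟩ : Fin k) a) := by
  have key := compressed_geo_mul_hatErase (permOp S k (m + 1)) h hε (a := a)
    (P := proj S (⟨m, hm⟩ : Fin k) a) (proj_mul_self _ _)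
    (fun b hb => by
      rw [mul_assoc, permOp_mul_proj_of_lt (by simp), Equiv.swap_apply_left, ← mul_assoc,
        proj_mul_proj _ hb.symm, zero_mul])
    (fun g hg => commute_proj_permOp_of_apply_eq hm hg)
  rwa [mul_assoc _ (C (proj S (⟨m, hm⟩ : Fin k) a)) (hatErase _ ε h a), proj_mul_hatErase_succ,
    ← mul_assoc] at key

/-- Together with `diagSeries_mul_hat` this evaluates the diagonal series against `hat` at both
neighbouring levels; the second recursion compares two consecutive diagonal series against the level
they share. -/
theorem diagSeries_mul_hat_succ (hε : ε * ε = 1) :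
    diagSeries S α hm ε h * hat (permOp S k (m + 1)) ε h =
      1 - X ^ 2 * geo (signedShift ε h (opL S α hm)) ^ 2 :=
  sum_blocks_mul (sum_C_proj (S := S) (⟨m, hm⟩ : Fin k))
    (fun a => by rw [← map_mul, proj_mul_self]) (diag_mul_hatErase hm h hε)
    (C_proj_mul_hat_succ hm h hε)

theorem diagSeries_mul_hat (hε : ε * ε = 1) :
    diagSeries S α hm ε h * hat (permOp S k m) ε h =
      1 - X ^ 2 * geo (signedShift ε h (opLHalf S α hm)) ^ 2 :=
  sum_blocks_mul (sum_C_proj (S := S) (⟨m, hm⟩ : Fin k))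
    (fun a => by rw [← map_mul, proj_mul_self]) (diag_mul_hatErase hm h hε)
    (C_proj_mul_hat hm h hε)

theorem coeff_diagSeries (ε : S) (n : ℕ) : coeff n (diagSeries S α hm ε h) =
    ∑ a, proj S (⟨m, hm⟩ : Fin k) a * signedShift ε h (opL S α hm) ^ n *
      proj S (⟨m, hm⟩ : Fin k) a := by
  rw [diagSeries, map_sum]
  refine Finset.sum_congr rfl fun a _ => ?_
  rw [coeff_mul_C, coeff_C_mul, geo, coeff_mk, proj_mul_pow_opL]

end Operators

end PartAlg

end

-- The subalgebras in terms of colorings.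

noncomputable section

namespace PartAlg

section Membership

variable {k : ℕ} {α : Type*}

theorem rel_of_sat [Nontrivial α] {d : Diagram k} {v w : Fin 2 × Fin k}
    (h : ∀ x y : Fin k → α, Sat d x y → twoRows x y v = twoRows x y w) : d v w := by
  classical
  obtain ⟨t, t', htt⟩ := exists_pair_ne α
  by_contra hne
  let f : Fin 2 × Fin k → α := fun v' => if d v v' then t else t'
  have hf : twoRows (fun j => f (0, j)) (fun j => f (1, j)) = f := by
    ext ⟨i, j⟩
    fin_cases i <;> rfl
  have hs : Sat d (fun j => f (0, j)) (fun j => f (1, j)) := by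
    rw [Sat, hf]
    intro a b hab
    rw [Setoid.ker_def]
    have : d v a ↔ d v b := ⟨fun h => d.trans h hab, fun h => d.trans h (d.symm hab)⟩
    simp only [f, this]
  have h' := h _ _ hs
  rw [hf] at h'
  simp only [f, if_pos (d.refl v), if_neg hne] at h'
  exact htt h'

theorem sat_const (d : Diagram k) (t : α) : Sat d (fun _ => t) (fun _ => t) := by
  intro v w _
  rw [Setoid.ker_def]
  simp [twoRows]

theorem diagrams_rel {i : ℕ} {d : Diagram k} (hd : d ∈ diagrams k i) {v w : Fin 2 × Fin k}
    (h : d v w) (hv : i ≤ v.2) : v.2 = w.2 := by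
  have h0 := hd v.2 (by lia)
  have hv0 : d (0, v.2) v := (h0 v).2 (by
    rcases v with ⟨r, j⟩
    fin_cases r <;> simp)
  rcases (h0 w).1 (d.trans hv0 h) with rfl | rfl <;> rfl

theorem diagrams_sat_eq {i : ℕ} {d : Diagram k} (hd : d ∈ diagrams k i) {x y : Fin k → α}
    (h : Sat d x y) {j : Fin k} (hj : i ≤ j) : x j = y j := by
  have : d (0, j) (1, j) := (hd j (by lia) _).2 (Or.inr rfl)
  exact h this

/-- A block either lies within the first `i` columns or is a single vertical edge, so recoloring by
a rule that is uniform on the first `i` columns keeps the coloring constant on blocks. -/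
theorem diagrams_sat_map {i : ℕ} {d : Diagram k} (hd : d ∈ diagrams k i) {x y : Fin k → α}
    (h : Sat d x y) (F : Fin k → α → α) (hF : ∀ j j' : Fin k, (j : ℕ) < i → (j' : ℕ) < i → F j = F j') :
    Sat d (fun j => F j (x j)) (fun j => F j (y j)) := by
  intro v w hvw
  have h1 : twoRows x y v = twoRows x y w := h hvw
  have h2 : ∀ v, twoRows (fun j => F j (x j)) (fun j => F j (y j)) v = F v.2 (twoRows x y v) := by
    intro v
    simp only [twoRows]
    split_ifs <;> rfl
  have h3 : F v.2 = F w.2 := by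
    by_cases hv : i ≤ v.2
    · rw [diagrams_rel hd hvw hv]
    · by_cases hw : i ≤ w.2
      · rw [diagrams_rel hd (d.symm hvw) hw]
      · exact hF _ _ (not_le.1 hv) (not_le.1 hw)
  rw [Setoid.ker_def, h2, h2, h1, h3]

theorem diagrams_sat_update {i : ℕ} {d : Diagram k} (hd : d ∈ diagrams k i) {x y : Fin k → α}
    (h : Sat d x y) {j : Fin k} (hj : i ≤ j) (c : α) :
    Sat d (Function.update x j c) (Function.update y j c) := by
  have key : ∀ x : Fin k → α, Function.update x j c =
      fun j' => (fun (j' : Fin k) (t : α) => if j' = j then c else t) j' (x j') := by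
    intro x
    ext j'
    simp only [Function.update_apply]
  rw [key x, key y]
  refine diagrams_sat_map hd h _ fun a b ha hb => funext fun t => ?_
  have h1 : a ≠ j := fun h => by rw [h] at ha; lia
  have h2 : b ≠ j := fun h => by rw [h] at hb; lia
  rw [if_neg h1, if_neg h2]

/-- The first condition makes each late column a vertical edge, the second isolates that edge:
recoloring one column of a constant coloring would break any larger block. This criterion is stable
under composition. -/
theorem mem_diagrams_of_sat [Nontrivial α] {i : ℕ} {d : Diagram k}
    (h1 : ∀ (j : Fin k), i ≤ j → ∀ x y : Fin k → α, Sat d x y → x j = y j)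
    (h2 : ∀ (j : Fin k), i ≤ j → ∀ (x y : Fin k → α) (c : α), Sat d x y →
      Sat d (Function.update x j c) (Function.update y j c)) : d ∈ diagrams k i := by
  intro j hj v
  have hj' : i ≤ j := by lia
  have hjj : d (0, j) (1, j) := rel_of_sat (α := α) fun x y h => h1 j hj' x y h
  constructor
  · intro h
    by_contra hv
    have hvj : v.2 ≠ j := by
      rintro rfl
      rcases v with ⟨r, j⟩
      fin_cases r <;> simp at hv
    obtain ⟨t, t', htt⟩ := exists_pair_ne α
    have := h2 j hj' _ _ t' (sat_const d t) h
    rw [Setoid.ker_def] at this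
    simp only [twoRows, Function.update_self, Function.update_of_ne hvj, ite_self] at this
    exact htt this.symm
  · rintro (rfl | rfl)
    · exact d.refl _
    · exact hjj

theorem diagrams_mono {i i' : ℕ} (h : i ≤ i') : diagrams k i ⊆ diagrams k i' :=
  fun _ hd m hm => hd m (by lia)

theorem diagramsHalf_subset {i : ℕ} : diagramsHalf k i ⊆ diagrams k (i + 1) := fun _ hd => hd.1

theorem diagrams_subset_diagramsHalf {i : ℕ} : diagrams k i ⊆ diagramsHalf k i :=
  fun _ hd => ⟨diagrams_mono (Nat.le_succ i) hd, fun m hm => (hd m (by lia) _).2 (Or.inr rfl)⟩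

theorem comp_mem_diagrams {i : ℕ} {d e : Diagram k} (hd : d ∈ diagrams k i)
    (he : e ∈ diagrams k i) : comp d e ∈ diagrams k i := by
  refine mem_diagrams_of_sat (α := Bool) ?_ ?_
  · intro j hj x y h
    obtain ⟨b, h1, h2⟩ := sat_comp_iff.1 h
    rw [diagrams_sat_eq hd h1 hj, diagrams_sat_eq he h2 hj]
  · intro j hj x y c h
    obtain ⟨b, h1, h2⟩ := sat_comp_iff.1 h
    exact (diagrams_sat_update hd h1 hj c).comp (diagrams_sat_update he h2 hj c)

theorem idDiagram_mem (i : ℕ) : idDiagram k ∈ diagrams k i := by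
  intro j _ v
  rw [idDiagram, Setoid.ker_def]
  rcases v with ⟨r, j'⟩
  constructor
  · rintro rfl
    fin_cases r <;> simp
  · rintro (h | h) <;> exact (congrArg Prod.snd h).symm

theorem sDiagram_mem {i m : ℕ} (hm : m + 1 < i) (hi : i ≤ k) :
    sDiagram k (m + 1) ∈ diagrams k i := by
  have hk : m + 1 < k := by lia
  refine mem_diagrams_of_sat (α := Bool) ?_ ?_
  · intro j hj x y h
    rw [sat_sDiagram hk] at h
    rw [h, Function.comp, Equiv.swap_apply_of_ne_of_ne]
    · rintro rfl
      simp only at hj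
      lia
    · rintro rfl
      simp only at hj
      lia
  · intro j hj x y c h
    rw [sat_sDiagram hk] at h ⊢
    have hj0 : j ≠ ⟨m, by lia⟩ := by rintro rfl; simp only at hj; lia
    have hj1 : j ≠ ⟨m + 1, hk⟩ := by rintro rfl; simp only at hj; lia
    rw [h, Function.update_comp_equiv, Equiv.symm_swap, Equiv.swap_apply_of_ne_of_ne hj0 hj1]

theorem pDiagram_mem {i m : ℕ} (hm : m < i) (hi : i ≤ k) : pDiagram k (m + 1) ∈ diagrams k i := by
  have hk : m < k := by lia
  have hne : ∀ j : Fin k, i ≤ j → j ≠ ⟨m, hk⟩ := by rintro j hj rfl; simp only at hj; lia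
  refine mem_diagrams_of_sat (α := Bool) ?_ ?_
  · intro j hj x y h
    obtain ⟨c, rfl⟩ := (sat_pDiagram hk _ _).1 h
    rw [Function.update_of_ne (hne j hj)]
  · intro j hj x y c h
    obtain ⟨c', rfl⟩ := (sat_pDiagram hk _ _).1 h
    exact (sat_pDiagram hk _ _).2 ⟨c', Function.update_comm (hne j hj).symm _ _ _⟩

theorem pHalfDiagram_mem {i m : ℕ} (hm : m + 1 < i) (hi : i ≤ k) :
    pHalfDiagram k (m + 1) ∈ diagrams k i := by
  have hk : m + 1 < k := by lia
  refine mem_diagrams_of_sat (α := Bool) ?_ ?_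
  · intro j hj x y h
    rw [((sat_pHalfDiagram hk _ _).1 h).1]
  · intro j hj x y c h
    obtain ⟨rfl, h1⟩ := (sat_pHalfDiagram hk _ _).1 h
    refine (sat_pHalfDiagram hk _ _).2 ⟨rfl, ?_⟩
    have hj0 : (⟨m, by lia⟩ : Fin k) ≠ j := by rintro rfl; simp only at hj; lia
    have hj1 : (⟨m + 1, hk⟩ : Fin k) ≠ j := by rintro rfl; simp only at hj; lia
    rw [Function.update_of_ne hj0, Function.update_of_ne hj1, h1]

end Membership

section Subalgebra

variable {R : Type*} [CommRing R] {z : R} {k : ℕ} {i : ℕ}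

theorem of_mem_A {d : Diagram k} (hd : d ∈ diagrams k i) : PAlg.of z d ∈ A z k i :=
  Submodule.subset_span ⟨d, hd, rfl⟩

theorem A_mono {i' : ℕ} (h : i ≤ i') : A z k i ≤ A z k i' :=
  Submodule.span_mono (Set.image_mono (diagrams_mono h))

theorem AHalf_le_A : AHalf z k i ≤ A z k (i + 1) :=
  Submodule.span_mono (Set.image_mono diagramsHalf_subset)

theorem A_le_AHalf : A z k i ≤ AHalf z k i :=
  Submodule.span_mono (Set.image_mono diagrams_subset_diagramsHalf)

theorem mul_mem_A {a b : PAlg R z k} (ha : a ∈ A z k i) (hb : b ∈ A z k i) : a * b ∈ A z k i := by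
  have h : A z k i * A z k i ≤ A z k i := by
    conv_lhs => rw [A, Submodule.span_mul_span]
    rw [Submodule.span_le]
    rintro _ ⟨_, ⟨d, hd, rfl⟩, _, ⟨e, he, rfl⟩, rfl⟩
    simp only [PAlg.of_mul_of]
    exact Submodule.smul_mem _ _ (of_mem_A (comp_mem_diagrams hd he))
  exact h (Submodule.mul_mem_mul ha hb)

theorem one_mem_A : (1 : PAlg R z k) ∈ A z k i := of_mem_A (idDiagram_mem i)

theorem algebraMap_mem_A (c : R) : algebraMap R (PAlg R z k) c ∈ A z k i := by
  rw [Algebra.algebraMap_eq_smul_one]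
  exact Submodule.smul_mem _ _ one_mem_A

theorem pow_mem_A {a : PAlg R z k} (ha : a ∈ A z k i) (n : ℕ) : a ^ n ∈ A z k i := by
  induction n with
  | zero => rw [pow_zero]; exact one_mem_A
  | succ n ih => rw [pow_succ]; exact mul_mem_A ih ha

theorem s_mem_A {m : ℕ} (hm : m + 1 < i) (hi : i ≤ k) : s z k (m + 1) ∈ A z k i :=
  of_mem_A (sDiagram_mem hm hi)

theorem p_mem_A {m : ℕ} (hm : m < i) (hi : i ≤ k) : p z k (m + 1) ∈ A z k i :=
  of_mem_A (pDiagram_mem hm hi)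

theorem pHalf_mem_A {m : ℕ} (hm : m + 1 < i) (hi : i ≤ k) : pHalf z k (m + 1) ∈ A z k i :=
  of_mem_A (pHalfDiagram_mem hm hi)

theorem L_and_sigmaSucc_mem_A (m : ℕ) :
    (m + 1 ≤ k → L z k (m + 1) ∈ A z k (m + 1)) ∧
      (m + 2 ≤ k → sigmaSucc z k (m + 1) ∈ A z k (m + 2)) := by
  induction m with
  | zero =>
    exact ⟨fun h => by rw [L]; exact p_mem_A (by simp) h,
      fun h => by rw [sigmaSucc]; exact s_mem_A (by simp) h⟩
  | succ m ih =>
    constructor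
    · intro hk
      have hL : L z k (m + 1) ∈ A z k (m + 2) := A_mono (by lia) (ih.1 (by lia))
      have hs : s z k (m + 1) ∈ A z k (m + 2) := s_mem_A (by lia) hk
      have hp : p z k (m + 2) ∈ A z k (m + 2) := p_mem_A (by lia) hk
      have hh : pHalf z k (m + 1) ∈ A z k (m + 2) := pHalf_mem_A (by lia) hk
      rw [L]
      exact add_mem (add_mem (add_mem (sub_mem (neg_mem
        (mul_mem_A (mul_mem_A hs hL) hh))
        (mul_mem_A (mul_mem_A hh hL) hs))
        (mul_mem_A (mul_mem_A (mul_mem_A hh hL) hp) hh))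
        (mul_mem_A (mul_mem_A hs hL) hs))
        (ih.2 hk)
    · intro hk
      have hL : L z k (m + 1) ∈ A z k (m + 3) := A_mono (by lia) (ih.1 (by lia))
      have hσ : sigmaSucc z k (m + 1) ∈ A z k (m + 3) := A_mono (by lia) (ih.2 (by lia))
      have hs : s z k (m + 1) ∈ A z k (m + 3) := s_mem_A (by lia) hk
      have hs' : s z k (m + 2) ∈ A z k (m + 3) := s_mem_A (by lia) hk
      have hp : p z k (m + 2) ∈ A z k (m + 3) := p_mem_A (by lia) hk
      have hh : pHalf z k (m + 1) ∈ A z k (m + 3) := pHalf_mem_A (by lia) hk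
      have hh' : pHalf z k (m + 2) ∈ A z k (m + 3) := pHalf_mem_A (by lia) hk
      rw [sigmaSucc]
      exact sub_mem (sub_mem (add_mem (add_mem
        (mul_mem_A (mul_mem_A (mul_mem_A (mul_mem_A hs hs') hσ) hs') hs)
        (mul_mem_A (mul_mem_A (mul_mem_A (mul_mem_A (mul_mem_A hs' hh) hL) hs') hh) hs'))
        (mul_mem_A (mul_mem_A (mul_mem_A hh hL) hs') hh))
        (mul_mem_A (mul_mem_A (mul_mem_A (mul_mem_A (mul_mem_A (mul_mem_A hs' hh) hL) hs) hh') hp) hh))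
        (mul_mem_A (mul_mem_A (mul_mem_A (mul_mem_A (mul_mem_A (mul_mem_A hh hp) hh') hs) hL) hh) hs')

theorem L_mem_A {m : ℕ} (hm : m + 1 ≤ k) : L z k (m + 1) ∈ A z k (m + 1) :=
  (L_and_sigmaSucc_mem_A m).1 hm

theorem sigmaHalf_mem_A {m : ℕ} (hm : m + 2 ≤ k) : sigmaHalf z k (m + 1) ∈ A z k (m + 2) := by
  induction m with
  | zero => rw [sigmaHalf]; exact one_mem_A
  | succ m ih =>
    have hL : L z k (m + 1) ∈ A z k (m + 3) := A_mono (by lia) (L_mem_A (by lia))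
    have hσ : sigmaHalf z k (m + 1) ∈ A z k (m + 3) := A_mono (by lia) (ih (by lia))
    have hs : s z k (m + 1) ∈ A z k (m + 3) := s_mem_A (by lia) hm
    have hs' : s z k (m + 2) ∈ A z k (m + 3) := s_mem_A (by lia) hm
    have hp : p z k (m + 2) ∈ A z k (m + 3) := p_mem_A (by lia) hm
    have hh : pHalf z k (m + 1) ∈ A z k (m + 3) := pHalf_mem_A (by lia) hm
    have hh' : pHalf z k (m + 2) ∈ A z k (m + 3) := pHalf_mem_A (by lia) hm
    rw [sigmaHalf]
    exact sub_mem (sub_mem (add_mem (add_mem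
      (mul_mem_A (mul_mem_A (mul_mem_A (mul_mem_A hs hs') hσ) hs') hs)
      (mul_mem_A (mul_mem_A (mul_mem_A (mul_mem_A hh hL) hs') hh) hs'))
      (mul_mem_A (mul_mem_A (mul_mem_A (mul_mem_A hs' hh) hL) hs') hh))
      (mul_mem_A (mul_mem_A (mul_mem_A (mul_mem_A (mul_mem_A hh hL) hs) hh') hp) hh))
      (mul_mem_A (mul_mem_A (mul_mem_A (mul_mem_A (mul_mem_A (mul_mem_A (mul_mem_A hs' hh) hp) hh') hs) hL) hh) hs')

theorem LHalf_mem_A {m : ℕ} (hm : m + 1 ≤ k) : LHalf z k m ∈ A z k (m + 1) := by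
  induction m with
  | zero => rw [LHalf]; exact zero_mem _
  | succ m ih =>
    have hL : L z k (m + 1) ∈ A z k (m + 2) := A_mono (by lia) (L_mem_A (by lia))
    have hσ : sigmaHalf z k (m + 1) ∈ A z k (m + 2) := sigmaHalf_mem_A hm
    have hLH : LHalf z k m ∈ A z k (m + 2) := A_mono (by lia) (ih (by lia))
    have hs : s z k (m + 1) ∈ A z k (m + 2) := s_mem_A (by lia) hm
    have hp : p z k (m + 1) ∈ A z k (m + 2) := p_mem_A (by lia) hm
    have hh : pHalf z k (m + 1) ∈ A z k (m + 2) := pHalf_mem_A (by lia) hm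
    rw [LHalf]
    exact add_mem (add_mem (add_mem (sub_mem (neg_mem
      (mul_mem_A hL hh))
      (mul_mem_A hh hL))
      (mul_mem_A (mul_mem_A (mul_mem_A hh hL) hp) hh))
      (mul_mem_A (mul_mem_A hs hLH) hs))
      hσ

end Subalgebra

end PartAlg

end

-- Existence and uniqueness of the contracted elements.

noncomputable section

namespace PartAlg

section Contraction

variable {k : ℕ} {α : Type*} {R : Type*} [CommRing R] {z : R}

/-- Two colors already distinguish partitions, and a unique middle row means `2 ^ ℓ = 1`, so no
block is lost in the product. -/
theorem of_mul_of_eq {d e c : Diagram k}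
    (h : ∀ x y : Fin k → Bool, Sat c x y → ∃! b, Sat d x b ∧ Sat e b y)
    (h' : ∀ x b y : Fin k → Bool, Sat d x b → Sat e b y → Sat c x y) :
    PAlg.of z d * PAlg.of z e = PAlg.of z c := by
  classical
  have hc : comp d e = c := eq_of_sat (α := Bool) fun x y => by
    rw [sat_comp_iff]
    exact ⟨fun ⟨b, h1, h2⟩ => h' x b y h1 h2, fun h1 => (h x y h1).exists⟩
  have hl : loops d e = 0 := by
    have h1 := card_middle_rows d e (fun _ => true) (fun _ => true)
    have h2 : Sat (comp d e) (fun _ => true) (fun _ => true) := sat_const _ _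
    rw [if_pos h2, Finset.card_eq_one.2] at h1
    · rw [Fintype.card_bool] at h1
      exact (Nat.pow_eq_one.1 h1.symm).resolve_left (by decide)
    · rw [hc] at h2
      obtain ⟨b, hb, hu⟩ := h _ _ h2
      refine ⟨b, ?_⟩
      ext b'
      simp only [Finset.mem_filter, Finset.mem_univ, true_and, Finset.mem_singleton]
      exact ⟨hu b', by rintro rfl; exact hb⟩
  rw [PAlg.of_mul_of, hc, hl, pow_zero, one_smul]

/-- The diagram obtained from `d` by joining the two vertices of column `j`. -/
def joinColumn (j : Fin k) (d : Diagram k) : Diagram k :=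
  d ⊔ Relation.EqvGen.setoid fun v w => v = (0, j) ∧ w = (1, j)

theorem sat_joinColumn {j : Fin k} {d : Diagram k} {x y : Fin k → α} :
    Sat (joinColumn j d) x y ↔ Sat d x y ∧ x j = y j := by
  rw [Sat, joinColumn, sup_le_iff]
  refine and_congr_right fun _ => ⟨fun h => ?_, fun h => ?_⟩
  · exact h (Relation.EqvGen.rel (0, j) (1, j) ⟨rfl, rfl⟩)
  · refine Setoid.eqvGen_le ?_
    rintro _ _ ⟨rfl, rfl⟩
    exact h

/-- The diagram obtained from `d` by merging column `j'` into column `j` and replacing it by a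
vertical edge. -/
def mergeColumn (j j' : Fin k) (d : Diagram k) : Diagram k :=
  joinColumn j' (d.map (Prod.map id (Function.update id j' j)))

theorem sat_mergeColumn {j j' : Fin k} {d : Diagram k} {x y : Fin k → α} :
    Sat (mergeColumn j j' d) x y ↔
      Sat d (Function.update x j' (x j)) (Function.update y j' (y j)) ∧ x j' = y j' := by
  rw [mergeColumn, sat_joinColumn, Sat, map_le, Sat]
  have h : (Setoid.ker (twoRows x y)).comap (Prod.map id (Function.update id j' j)) =
      Setoid.ker (twoRows (Function.update x j' (x j)) (Function.update y j' (y j))) := by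
    have h1 : twoRows x y ∘ Prod.map id (Function.update id j' j) =
        twoRows (Function.update x j' (x j)) (Function.update y j' (y j)) := by
      ext ⟨r, i⟩
      simp only [twoRows, Function.comp, Prod.map_apply, id, Function.update_apply]
      by_cases hi : i = j' <;> simp [hi]
    rw [← h1]
    rfl
  rw [h]

variable {m : ℕ}

/-- In `e = p d p` the two vertices of column `m` are isolated. Joining them by a vertical edge
gives an element of `A_m`, and multiplying by `p` cuts this edge again without creating a loop; the
loops of `p d p` provide the scalar. -/
theorem exists_contraction_diagram (hm : m < k) {d : Diagram k} (hd : d ∈ diagrams k (m + 1)) :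
    ∃ w ∈ A z k m, w * p z k (m + 1) = p z k (m + 1) * PAlg.of z d * p z k (m + 1) := by
  set P := pDiagram k (m + 1) with hP
  set e := comp (comp P d) P with he
  have hPm : P ∈ diagrams k (m + 1) := pDiagram_mem (by simp) hm
  have hem : e ∈ diagrams k (m + 1) := comp_mem_diagrams (comp_mem_diagrams hPm hd) hPm
  have hsat : ∀ {x y : Fin k → Bool}, Sat e x y ↔
      ∃ c c', Sat d (Function.update x ⟨m, hm⟩ c) (Function.update y ⟨m, hm⟩ c') := by
    intro x y
    rw [he, sat_comp_iff]
    constructor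
    · rintro ⟨b, h1, h2⟩
      obtain ⟨b', h3, h4⟩ := sat_comp_iff.1 h1
      obtain ⟨c, rfl⟩ := (sat_pDiagram hm _ _).1 h3
      obtain ⟨c', rfl⟩ := (sat_pDiagram hm _ _).1 h2
      exact ⟨c, b ⟨m, hm⟩, by rwa [Function.update_idem, Function.update_eq_self]⟩
    · rintro ⟨c, c', h⟩
      refine ⟨_, sat_comp_iff.2 ⟨_, (sat_pDiagram hm _ _).2 ⟨c, rfl⟩, h⟩,
        (sat_pDiagram hm _ _).2 ⟨y ⟨m, hm⟩, ?_⟩⟩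
      rw [Function.update_idem, Function.update_eq_self]
  have hupd : ∀ {x y : Fin k → Bool} (t t' : Bool), Sat e x y →
      Sat e (Function.update x ⟨m, hm⟩ t) (Function.update y ⟨m, hm⟩ t') := by
    intro x y t t' h
    rw [hsat] at h ⊢
    simpa only [Function.update_idem] using h
  have hupd' : ∀ {x y : Fin k → Bool} (t : Bool), Sat e x y →
      Sat e x (Function.update y ⟨m, hm⟩ t) := by
    intro x y t h
    simpa only [Function.update_eq_self] using hupd (x ⟨m, hm⟩) t h
  have hw : joinColumn ⟨m, hm⟩ e ∈ diagrams k m := by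
    refine mem_diagrams_of_sat (α := Bool) ?_ ?_
    · intro j hj x y h
      rw [sat_joinColumn] at h
      rcases eq_or_lt_of_le hj with h1 | h1
      · obtain rfl : j = ⟨m, hm⟩ := Fin.ext h1.symm
        exact h.2
      · exact diagrams_sat_eq hem h.1 h1
    · intro j hj x y c h
      rw [sat_joinColumn] at h ⊢
      rcases eq_or_lt_of_le hj with h1 | h1
      · obtain rfl : j = ⟨m, hm⟩ := Fin.ext h1.symm
        exact ⟨hupd c c h.1, by simp⟩
      · have hne : (⟨m, hm⟩ : Fin k) ≠ j := by rintro rfl; simp at h1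
        exact ⟨diagrams_sat_update hem h.1 h1 c, by simp [Function.update_of_ne hne, h.2]⟩
  have hmul : PAlg.of z (joinColumn ⟨m, hm⟩ e) * PAlg.of z P = PAlg.of z e := by
    refine of_mul_of_eq ?_ ?_
    · intro x y h
      refine ⟨Function.update y ⟨m, hm⟩ (x ⟨m, hm⟩), ⟨sat_joinColumn.2 ⟨hupd' _ h, by simp⟩,
        (sat_pDiagram hm _ _).2 ⟨y ⟨m, hm⟩, by simp⟩⟩, ?_⟩
      rintro b ⟨h1, h2⟩
      obtain ⟨c, rfl⟩ := (sat_pDiagram hm _ _).1 h2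
      rw [(sat_joinColumn.1 h1).2, Function.update_idem, Function.update_eq_self]
    · intro x b y h1 h2
      obtain ⟨c, rfl⟩ := (sat_pDiagram hm _ _).1 h2
      exact hupd' c (sat_joinColumn.1 h1).1
  refine ⟨z ^ loops P d • z ^ loops (comp P d) P • PAlg.of z (joinColumn ⟨m, hm⟩ e),
    Submodule.smul_mem _ _ (Submodule.smul_mem _ _ (of_mem_A hw)), ?_⟩
  rw [p, ← hP, smul_mul_assoc, smul_mul_assoc, hmul, PAlg.of_mul_of, smul_mul_assoc, PAlg.of_mul_of]

theorem exists_contraction (hm : m < k) {a : PAlg R z k} (ha : a ∈ A z k (m + 1)) :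
    ∃ w ∈ A z k m, w * p z k (m + 1) = p z k (m + 1) * a * p z k (m + 1) := by
  induction ha using Submodule.span_induction with
  | mem x hx =>
    obtain ⟨d, hd, rfl⟩ := hx
    exact exists_contraction_diagram hm hd
  | zero => exact ⟨0, zero_mem _, by simp⟩
  | add x y _ _ hx hy =>
    obtain ⟨w, hw, h⟩ := hx
    obtain ⟨w', hw', h'⟩ := hy
    exact ⟨w + w', add_mem hw hw', by rw [add_mul, h, h', mul_add, add_mul]⟩
  | smul c x _ hx =>
    obtain ⟨w, hw, h⟩ := hx
    exact ⟨c • w, Submodule.smul_mem _ _ hw, by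
      rw [smul_mul_assoc, h, mul_smul_comm, smul_mul_assoc]⟩

/-- On diagrams of `A_m`, joining column `m` is a left inverse of multiplication by `p`. Extended
linearly, it gives injectivity over any `R`. -/
theorem mul_p_injOn (hm : m < k) : Set.InjOn (fun w => w * p z k (m + 1)) (A z k m) := by
  let φ : PAlg R z k →ₗ[R] PAlg R z k :=
    (PAlg.basis R z k).constr R fun d => PAlg.of z (joinColumn ⟨m, hm⟩ d)
  have hφ : ∀ d, φ (.of z d) = .of z (joinColumn ⟨m, hm⟩ d) :=
    fun d => (PAlg.basis R z k).constr_basis R _ d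
  refine Set.LeftInvOn.injOn (f₁' := φ) fun a ha => ?_
  induction ha using Submodule.span_induction with
  | mem x hx =>
    obtain ⟨d, hd, rfl⟩ := hx
    have hsat : ∀ {x b y : Fin k → Bool}, Sat d x b ∧ Sat (pDiagram k (m + 1)) b y →
        b = Function.update y ⟨m, hm⟩ (x ⟨m, hm⟩) := by
      rintro x b y ⟨h1, h2⟩
      obtain ⟨c, rfl⟩ := (sat_pDiagram hm _ _).1 h2
      rw [diagrams_sat_eq hd h1 (j := ⟨m, hm⟩) (by simp), Function.update_idem,
        Function.update_eq_self]
    rw [p, of_mul_of_eq (c := comp d (pDiagram k (m + 1))) ?_ fun _ _ _ h1 h2 => h1.comp h2, hφ]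
    · congr 1
      refine eq_of_sat (α := Bool) fun x y => ?_
      rw [sat_joinColumn, sat_comp_iff]
      constructor
      · rintro ⟨⟨b, hb⟩, hxy⟩
        rw [hsat hb, hxy, Function.update_eq_self] at hb
        exact hb.1
      · intro h
        exact ⟨⟨y, h, (sat_pDiagram hm _ _).2 ⟨y ⟨m, hm⟩, by simp⟩⟩,
          diagrams_sat_eq hd h (j := ⟨m, hm⟩) (by simp)⟩
    · intro x y h
      obtain ⟨b, hb⟩ := sat_comp_iff.1 h
      exact ⟨b, hb, fun b' hb' => (hsat hb').trans (hsat hb).symm⟩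
  | zero => simp
  | add x y _ _ hx hy => rw [add_mul, map_add, hx, hy]
  | smul c x _ hx => rw [smul_mul_assoc, map_smul, hx]

/-- In `e = p d p` the four vertices of columns `m` and `m + 1` lie in one block: `d` has a vertical
edge in column `m + 1`, and `p` ties that column to column `m` on both sides. Detaching column `m +
1` as a vertical edge leaves the block of column `m` intact, and `p` attaches it again. -/
theorem exists_contractionHalf_diagram (hm : m + 1 < k) {d : Diagram k}
    (hd : d ∈ diagrams k (m + 1)) :
    ∃ w ∈ AHalf z k m,
      w * pHalf z k (m + 1) = pHalf z k (m + 1) * PAlg.of z d * pHalf z k (m + 1) := by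
  set P := pHalfDiagram k (m + 1) with hP
  set j0 : Fin k := ⟨m, by lia⟩ with hj0
  set j1 : Fin k := ⟨m + 1, hm⟩ with hj1
  have h01 : j0 ≠ j1 := by simp [hj0, hj1]
  set e := comp (comp P d) P with he
  have hPm : P ∈ diagrams k (m + 2) := pHalfDiagram_mem (by simp) hm
  have hem : e ∈ diagrams k (m + 2) :=
    comp_mem_diagrams (comp_mem_diagrams hPm (diagrams_mono (by lia) hd)) hPm
  have hblock : ∀ {x y : Fin k → Bool}, Sat e x y → x j0 = x j1 ∧ y j0 = y j1 ∧ x j0 = y j0 := by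
    intro x y h
    obtain ⟨b, h1, h2⟩ := sat_comp_iff.1 h
    obtain ⟨b', h3, h4⟩ := sat_comp_iff.1 h1
    obtain ⟨rfl, h5⟩ := (sat_pHalfDiagram hm _ _).1 h3
    obtain ⟨rfl, h6⟩ := (sat_pHalfDiagram hm _ _).1 h2
    have h7 := diagrams_sat_eq hd h4 (j := j1) (by simp [hj1])
    exact ⟨h5, h6, h5.trans (h7.trans h6.symm)⟩
  have hw : mergeColumn j0 j1 e ∈ diagramsHalf k m := by
    refine ⟨mem_diagrams_of_sat (α := Bool) ?_ ?_, ?_⟩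
    · intro j hj x y h
      rw [sat_mergeColumn] at h
      rcases eq_or_lt_of_le hj with h1 | h1
      · obtain rfl : j = j1 := Fin.ext h1.symm
        exact h.2
      · have hne : j ≠ j1 := by rintro rfl; simp [hj1] at h1
        have := diagrams_sat_eq hem h.1 (j := j) h1
        rwa [Function.update_of_ne hne, Function.update_of_ne hne] at this
    · intro j hj x y c h
      rw [sat_mergeColumn] at h ⊢
      have hne0 : j0 ≠ j := by rintro rfl; simp [hj0] at hj
      rw [Function.update_of_ne hne0, Function.update_of_ne hne0]
      rcases eq_or_lt_of_le hj with h1 | h1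
      · obtain rfl : j = j1 := Fin.ext h1.symm
        simpa only [Function.update_idem, Function.update_self, and_true] using h.1
      · have hne : j1 ≠ j := by rintro rfl; simp [hj1] at h1
        rw [Function.update_comm hne.symm, Function.update_comm hne.symm, Function.update_of_ne hne,
          Function.update_of_ne hne]
        exact ⟨diagrams_sat_update hem h.1 h1 c, h.2⟩
    · intro j hj
      obtain rfl : j = j0 := Fin.ext (by simp only [hj0]; lia)
      refine rel_of_sat (α := Bool) fun x y h => ?_
      have := (hblock (sat_mergeColumn.1 h).1).2.2
      rwa [Function.update_of_ne h01, Function.update_of_ne h01] at this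
  have hmul : PAlg.of z (mergeColumn j0 j1 e) * PAlg.of z P = PAlg.of z e := by
    refine of_mul_of_eq ?_ ?_
    · intro x y h
      obtain ⟨h1, h2, h3⟩ := hblock h
      refine ⟨y, ⟨sat_mergeColumn.2 ?_, (sat_pHalfDiagram hm _ _).2 ⟨rfl, h2⟩⟩, ?_⟩
      · rw [h1, h2, Function.update_eq_self, Function.update_eq_self]
        exact ⟨h, h1.symm.trans (h3.trans h2)⟩
      · rintro b ⟨-, h4⟩
        exact ((sat_pHalfDiagram hm _ _).1 h4).1.symm
    · intro x b y h1 h2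
      obtain ⟨rfl, h3⟩ := (sat_pHalfDiagram hm _ _).1 h2
      obtain ⟨h4, h5⟩ := sat_mergeColumn.1 h1
      have h6 := (hblock h4).2.2
      rw [Function.update_of_ne h01, Function.update_of_ne h01] at h6
      have h7 : x j0 = x j1 := h6.trans (h3.trans h5.symm)
      rwa [h7, Function.update_eq_self, show y j0 = y j1 from h3, Function.update_eq_self] at h4
  refine ⟨z ^ loops P d • z ^ loops (comp P d) P • PAlg.of z (mergeColumn j0 j1 e),
    Submodule.smul_mem _ _ (Submodule.smul_mem _ _ (Submodule.subset_span ⟨_, hw, rfl⟩)), ?_⟩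
  rw [pHalf, ← hP, smul_mul_assoc, smul_mul_assoc, hmul, PAlg.of_mul_of, smul_mul_assoc,
    PAlg.of_mul_of]

theorem exists_contractionHalf (hm : m + 1 < k) {a : PAlg R z k} (ha : a ∈ A z k (m + 1)) :
    ∃ w ∈ AHalf z k m, w * pHalf z k (m + 1) = pHalf z k (m + 1) * a * pHalf z k (m + 1) := by
  induction ha using Submodule.span_induction with
  | mem x hx =>
    obtain ⟨d, hd, rfl⟩ := hx
    exact exists_contractionHalf_diagram hm hd
  | zero => exact ⟨0, zero_mem _, by simp⟩
  | add x y _ _ hx hy =>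
    obtain ⟨w, hw, h⟩ := hx
    obtain ⟨w', hw', h'⟩ := hy
    exact ⟨w + w', add_mem hw hw', by rw [add_mul, h, h', mul_add, add_mul]⟩
  | smul c x _ hx =>
    obtain ⟨w, hw, h⟩ := hx
    exact ⟨c • w, Submodule.smul_mem _ _ hw, by
      rw [smul_mul_assoc, h, mul_smul_comm, smul_mul_assoc]⟩

/-- The left inverse merges column `m + 1` into column `m` and restores the vertical edge. It
recovers `d` because `d` connects the two vertices of column `m`. -/
theorem mul_pHalf_injOn (hm : m + 1 < k) :
    Set.InjOn (fun w => w * pHalf z k (m + 1)) (AHalf z k m) := by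
  set j0 : Fin k := ⟨m, by lia⟩ with hj0
  set j1 : Fin k := ⟨m + 1, hm⟩ with hj1
  let φ : PAlg R z k →ₗ[R] PAlg R z k :=
    (PAlg.basis R z k).constr R fun d => PAlg.of z (mergeColumn j0 j1 d)
  have hφ : ∀ d, φ (.of z d) = .of z (mergeColumn j0 j1 d) :=
    fun d => (PAlg.basis R z k).constr_basis R _ d
  have h01 : j0 ≠ j1 := by simp [hj0, hj1]
  refine Set.LeftInvOn.injOn (f₁' := φ) fun a ha => ?_
  induction ha using Submodule.span_induction with
  | mem x hx =>
    obtain ⟨d, ⟨hd, hd0⟩, rfl⟩ := hx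
    rw [pHalf, of_mul_of_eq (c := comp d (pHalfDiagram k (m + 1))) ?_
      fun _ _ _ h1 h2 => h1.comp h2, hφ]
    · congr 1
      refine eq_of_sat (α := Bool) fun x y => ?_
      rw [sat_mergeColumn, sat_comp_iff]
      constructor
      · rintro ⟨⟨b, h1, h2⟩, hxy⟩
        obtain ⟨rfl, -⟩ := (sat_pHalfDiagram hm _ _).1 h2
        have := diagrams_sat_update hd h1 (j := j1) (by simp [hj1]) (x j1)
        rw [Function.update_idem, Function.update_idem, Function.update_eq_self, hxy,
          Function.update_eq_self] at this
        exact this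
      · intro h
        have h1 := diagrams_sat_eq hd h (j := j1) (by simp [hj1])
        refine ⟨⟨Function.update y j1 (y j0), ?_, (sat_pHalfDiagram hm _ _).2 ⟨rfl, ?_⟩⟩, h1⟩
        · have h2 : x j0 = y j0 := h (hd0 j0 (by simp [hj0]))
          have h3 := diagrams_sat_update hd h (j := j1) (by simp [hj1]) (y j0)
          rwa [h2]
        · rw [← hj0, ← hj1, Function.update_self, Function.update_of_ne h01]
    · intro x y h
      obtain ⟨b, hb⟩ := sat_comp_iff.1 h
      exact ⟨b, hb, fun b' hb' => ((sat_pHalfDiagram hm _ _).1 hb'.2).1.symm.trans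
        ((sat_pHalfDiagram hm _ _).1 hb.2).1⟩
  | zero => simp
  | add x y _ _ hx hy => rw [add_mul, map_add, hx, hy]
  | smul c x _ hx => rw [smul_mul_assoc, map_smul, hx]

end Contraction

end PartAlg

end

-- Base change and the generic partition algebra.

noncomputable section

namespace PartAlg

section BaseChange

variable {R R' : Type*} [CommRing R] [CommRing R'] {z : R} {z' : R'} {k : ℕ}

/-- Change of scalars for partition algebras. -/
def baseChange (φ : R →+* R') (hz : φ z = z') : PAlg R z k →+* PAlg R' z' k :=
  let ψ : PAlg R z k →+ PAlg R' z' k :=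
    (Finsupp.mapRange.addMonoidHom φ.toAddMonoidHom : (Diagram k →₀ R) →+ (Diagram k →₀ R'))
  have hψ : ∀ c d, ψ (c • .of z d) = φ c • .of z' d := by
    intro c d
    exact (congrArg (Finsupp.mapRange φ (map_zero φ)) (Finsupp.smul_single_one d c)).trans
      (Finsupp.mapRange_single.trans (Finsupp.smul_single_one d (φ c)).symm)
  have hof : ∀ d, ψ (.of z d) = .of z' d := fun d => by
    have := hψ 1 d
    rwa [one_smul, map_one, one_smul] at this
  { toFun := ψ
    map_zero' := ψ.map_zero
    map_add' := ψ.map_add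
    map_one' := by rw [PAlg.one_def, hof, PAlg.one_def]
    map_mul' := by
      intro x y
      refine PAlg.induction_of (p := fun x => ψ (x * y) = ψ x * ψ y) x (by simp) ?_ ?_
      · intro x x' h h'
        rw [add_mul, map_add, h, h', map_add, add_mul]
      intro c a
      refine PAlg.induction_of (p := fun y => ψ (c • PAlg.of z a * y) = ψ (c • .of z a) * ψ y) y
        (by simp) ?_ ?_
      · intro x x' h h'
        rw [mul_add, map_add, h, h', map_add, mul_add]
      intro c' b
      rw [smul_mul_assoc, mul_smul_comm, PAlg.of_mul_of, smul_smul, smul_smul, hψ, hψ, hψ,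
        smul_mul_assoc, mul_smul_comm, PAlg.of_mul_of, smul_smul, smul_smul, map_mul, map_mul,
        map_pow, hz] }

variable (φ : R →+* R') (hz : φ z = z')

theorem baseChange_smul_of (c : R) (d : Diagram k) :
    baseChange φ hz (c • PAlg.of z d) = φ c • .of z' d :=
  (congrArg (Finsupp.mapRange φ (map_zero φ)) (Finsupp.smul_single_one d c)).trans
    (Finsupp.mapRange_single.trans (Finsupp.smul_single_one d (φ c)).symm)

theorem baseChange_of (d : Diagram k) : baseChange φ hz (PAlg.of z d) = .of z' d := by
  have := baseChange_smul_of φ hz 1 d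
  rwa [one_smul, map_one, one_smul] at this

theorem baseChange_smul (c : R) (a : PAlg R z k) :
    baseChange φ hz (c • a) = φ c • baseChange φ hz a := by
  refine PAlg.induction_of (p := fun a => baseChange φ hz (c • a) = φ c • baseChange φ hz a) a
    (by simp) ?_ ?_
  · intro x y hx hy
    rw [smul_add, map_add, hx, hy, map_add, smul_add]
  · intro c' d
    rw [smul_smul, baseChange_smul_of, baseChange_smul_of, map_mul, smul_smul]

theorem baseChange_algebraMap (c : R) :
    baseChange φ hz (algebraMap R (PAlg R z k) c) = algebraMap R' (PAlg R' z' k) (φ c) := by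
  rw [Algebra.algebraMap_eq_smul_one, Algebra.algebraMap_eq_smul_one, baseChange_smul, map_one]

theorem repr_baseChange (a : PAlg R z k) (d : Diagram k) :
    (PAlg.basis R' z' k).repr (baseChange φ hz a) d = φ ((PAlg.basis R z k).repr a d) := rfl

theorem baseChange_s (i : ℕ) : baseChange φ hz (s z k i) = s z' k i := baseChange_of φ hz _

theorem baseChange_p (i : ℕ) : baseChange φ hz (p z k i) = p z' k i := baseChange_of φ hz _

theorem baseChange_pHalf (i : ℕ) : baseChange φ hz (pHalf z k i) = pHalf z' k i :=
  baseChange_of φ hz _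

theorem baseChange_L_and_sigmaSucc (m : ℕ) :
    baseChange φ hz (L z k (m + 1)) = L z' k (m + 1) ∧
      baseChange φ hz (sigmaSucc z k (m + 1)) = sigmaSucc z' k (m + 1) := by
  induction m with
  | zero => exact ⟨by rw [L, L, baseChange_p], by rw [sigmaSucc, sigmaSucc, baseChange_s]⟩
  | succ m ih =>
    constructor
    · rw [L, L]
      simp only [map_add, map_sub, map_neg, map_mul, ih.1, ih.2, baseChange_s, baseChange_p,
        baseChange_pHalf]
    · rw [sigmaSucc, sigmaSucc]
      simp only [map_add, map_sub, map_mul, ih.1, ih.2, baseChange_s, baseChange_p,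
        baseChange_pHalf]

theorem baseChange_L (m : ℕ) : baseChange φ hz (L z k m) = L z' k m := by
  cases m with
  | zero => rw [L, L, map_zero]
  | succ m => exact (baseChange_L_and_sigmaSucc φ hz m).1

theorem baseChange_sigmaHalf (m : ℕ) :
    baseChange φ hz (sigmaHalf z k (m + 1)) = sigmaHalf z' k (m + 1) := by
  induction m with
  | zero => rw [sigmaHalf, sigmaHalf, map_one]
  | succ m ih =>
    rw [sigmaHalf, sigmaHalf]
    simp only [map_add, map_sub, map_mul, ih, baseChange_L, baseChange_s, baseChange_p,
      baseChange_pHalf]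

theorem baseChange_LHalf (m : ℕ) : baseChange φ hz (LHalf z k m) = LHalf z' k m := by
  induction m with
  | zero => rw [LHalf, LHalf, map_zero]
  | succ m ih =>
    rw [LHalf, LHalf]
    simp only [map_add, map_sub, map_neg, map_mul, ih, baseChange_L, baseChange_sigmaHalf,
      baseChange_s, baseChange_p, baseChange_pHalf]

theorem baseChange_mem_span {D : Set (Diagram k)} {a : PAlg R z k}
    (ha : a ∈ Submodule.span R (PAlg.of z '' D)) :
    baseChange φ hz a ∈ Submodule.span R' (PAlg.of z' '' D) := by
  induction ha using Submodule.span_induction with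
  | mem x hx =>
    obtain ⟨d, hd, rfl⟩ := hx
    rw [baseChange_of]
    exact Submodule.subset_span ⟨d, hd, rfl⟩
  | zero => rw [map_zero]; exact zero_mem _
  | add x y _ _ hx hy => rw [map_add]; exact add_mem hx hy
  | smul c x _ hx => rw [baseChange_smul]; exact Submodule.smul_mem _ _ hx

end BaseChange

theorem signedShift_one {S E : Type*} [CommRing S] [Ring E] [Algebra S E] (h : S) (y : E) :
    signedShift 1 h y = algebraMap S E h - y := by
  rw [signedShift, map_one, one_mul]

theorem signedShift_neg_one {S E : Type*} [CommRing S] [Ring E] [Algebra S E] (h : S) (y : E) :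
    signedShift (-1) h y = y - algebraMap S E h := by
  rw [signedShift, map_neg, map_one, neg_one_mul, neg_sub]

section Generic

open Polynomial

variable {k : ℕ}

/-- The partition algebra with indeterminate parameter `2 h`, over the polynomials in `h`. -/
abbrev GenericAlg (k : ℕ) : Type := PAlg ℤ[X] (2 * X : ℤ[X]) k

/-- The action of the generic partition algebra on tensors over `2 n` colors, where `h`
acts by `n`. -/
def genericRep (k n : ℕ) : GenericAlg k →+* TensorEnd ℤ k (Fin (2 * n)) :=
  (rep (z := (2 * n : ℤ)) (by simp)).comp (baseChange (evalRingHom (n : ℤ)) (by simp))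

/-- For `n ≥ k` there are at least `2k` colors, so faithfulness gives equality of all coefficients
at `h = n`. A polynomial with infinitely many roots vanishes. -/
theorem genericRep_ext {a b : GenericAlg k} (h : ∀ n, k ≤ n → genericRep k n a = genericRep k n b) :
    a = b := by
  refine (PAlg.basis _ _ k).ext_elem fun d => ?_
  rw [← sub_eq_zero]
  refine eq_zero_of_infinite_isRoot _ (Set.Infinite.mono (s := Nat.cast '' Set.Ici k) ?_
    ((Set.Ici_infinite k).image Nat.cast_injective.injOn))
  rintro _ ⟨n, hn, rfl⟩
  have h1 := rep_injective (S := ℤ) (α := Fin (2 * n)) (k := k) (z := (2 * n : ℤ)) (by simp)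
    (by simpa using Nat.mul_le_mul_left 2 hn) (h n hn)
  have h2 := congrArg (fun a => (PAlg.basis ℤ (2 * n : ℤ) k).repr a d) h1
  simp only [repr_baseChange, coe_evalRingHom] at h2
  rw [Set.mem_ofPred_eq, IsRoot.def, eval_sub, h2, sub_self]

theorem genericRep_of (n : ℕ) (d : Diagram k) : genericRep k n (.of _ d) = diagramOp ℤ d := by
  rw [genericRep, RingHom.comp_apply, baseChange_of, rep_of]

theorem genericRep_smul (n : ℕ) (c : ℤ[X]) (a : GenericAlg k) :
    genericRep k n (c • a) = c.eval (n : ℤ) • genericRep k n a := by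
  rw [genericRep, RingHom.comp_apply, baseChange_smul, rep_smul]
  rfl

theorem genericRep_algebraMap (n : ℕ) (c : ℤ[X]) :
    genericRep k n (algebraMap _ _ c) = algebraMap ℤ _ (c.eval (n : ℤ)) := by
  rw [Algebra.algebraMap_eq_smul_one, Algebra.algebraMap_eq_smul_one, genericRep_smul, map_one]

theorem genericRep_L (n : ℕ) {m : ℕ} (hm : m < k) :
    genericRep k n (L _ k (m + 1)) = opL ℤ (Fin (2 * n)) hm := by
  rw [genericRep, RingHom.comp_apply, baseChange_L, rep_L_eq _ hm]

theorem genericRep_LHalf (n : ℕ) {m : ℕ} (hm : m < k) :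
    genericRep k n (LHalf _ k m) =
      algebraMap ℤ _ (2 * n : ℤ) - opLHalf ℤ (Fin (2 * n)) hm := by
  rw [genericRep, RingHom.comp_apply, baseChange_LHalf, rep_LHalf_eq _ hm]

/-- The generic version of `x_i`. -/
def genericX (k i : ℕ) : GenericAlg k := L _ k i - algebraMap ℤ[X] _ X

/-- The generic version of `x_{i+1/2}`. -/
def genericXHalf (k i : ℕ) : GenericAlg k := LHalf _ k i - algebraMap ℤ[X] _ X

/-- Since `z / 2` acts by `n`, `x_{m+1}` carries the sign `ε = -1` and `x_{m+1/2}` the sign `ε = 1`.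
Changing `ε` negates both, which is how `x_i` and `-x_{i-1/2}`, or `-x_i` and `x_{i-1/2}`, fit a
common generating series. -/
theorem genericRep_genericX (n : ℕ) {m : ℕ} (hm : m < k) :
    genericRep k n (genericX k (m + 1)) =
      signedShift (-1 : ℤ) (n : ℤ) (opL ℤ (Fin (2 * n)) hm) := by
  rw [genericX, map_sub, genericRep_L n hm, genericRep_algebraMap, eval_X,
    signedShift_neg_one]

theorem genericRep_neg_genericX (n : ℕ) {m : ℕ} (hm : m < k) :
    genericRep k n (-genericX k (m + 1)) =
      signedShift (1 : ℤ) (n : ℤ) (opL ℤ (Fin (2 * n)) hm) := by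
  rw [map_neg, genericRep_genericX n hm, signedShift_one, signedShift_neg_one, neg_sub]

theorem genericRep_genericXHalf (n : ℕ) {m : ℕ} (hm : m < k) :
    genericRep k n (genericXHalf k m) =
      signedShift (1 : ℤ) (n : ℤ) (opLHalf ℤ (Fin (2 * n)) hm) := by
  have h (T : TensorEnd ℤ k (Fin (2 * n))) : algebraMap ℤ _ (2 * n : ℤ) - T - algebraMap ℤ _ (n : ℤ) =
      algebraMap ℤ _ (n : ℤ) - T := by
    rw [show (2 * n : ℤ) = n + n from two_mul _, map_add]
    abel
  rw [genericXHalf, map_sub, genericRep_LHalf n hm, genericRep_algebraMap, eval_X,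
    signedShift_one, h]

theorem genericRep_neg_genericXHalf (n : ℕ) {m : ℕ} (hm : m < k) :
    genericRep k n (-genericXHalf k m) =
      signedShift (-1 : ℤ) (n : ℤ) (opLHalf ℤ (Fin (2 * n)) hm) := by
  rw [map_neg, genericRep_genericXHalf n hm, signedShift_one, signedShift_neg_one, neg_sub]

end Generic

end PartAlg

end

-- The action of the contracted elements.

noncomputable section

namespace PartAlg

open Equiv (swap)

section ColorOp

variable {S : Type*} [CommRing S] {k : ℕ} {α : Type*}

/-- The action of permutations of the colors on each tensor factor. -/
def colorOp (S : Type*) [CommRing S] (F : Fin k → Equiv.Perm α) : TensorEnd S k α :=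
  LinearMap.funLeft S S fun x j => F j (x j)

theorem colorOp_apply (F : Fin k → Equiv.Perm α) (f : (Fin k → α) → S) (x : Fin k → α) :
    colorOp S F f x = f fun j => F j (x j) := rfl

theorem permOp_eq_colorOp (m : ℕ) (g : Equiv.Perm α) :
    permOp S k m g = colorOp S fun j => if (j : ℕ) < m then g⁻¹ else 1 := by
  refine LinearMap.ext fun f => funext fun x => congrArg f (funext fun j => ?_)
  change (if (j : ℕ) < m then g⁻¹ (x j) else x j) = (if (j : ℕ) < m then g⁻¹ else 1) (x j)
  split_ifs <;> rfl

/-- The action of a permutation of the colors on the `j`-th tensor factor. -/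
def columnOp (S : Type*) [CommRing S] {k : ℕ} {α : Type*} (j : Fin k) (g : Equiv.Perm α) :
    TensorEnd S k α :=
  colorOp S (Function.update 1 j g)

theorem columnOp_apply (j : Fin k) (g : Equiv.Perm α) (f : (Fin k → α) → S) (x : Fin k → α) :
    columnOp S j g f x = f (Function.update x j (g (x j))) := by
  rw [columnOp, colorOp_apply]
  refine congrArg f (funext fun j' => ?_)
  rcases eq_or_ne j' j with rfl | h
  · simp
  · simp [h]

theorem columnOp_mul_self {j : Fin k} {g : Equiv.Perm α} (hg : g * g = 1) :
    columnOp S j g * columnOp S j g = 1 := by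
  refine LinearMap.ext fun f => funext fun x => ?_
  have h : g (g (x j)) = x j := Equiv.congr_fun hg _
  simp [Module.End.mul_apply, columnOp_apply, h]

theorem commute_columnOp_permOp {m : ℕ} {j : Fin k} (hj : m ≤ j) (g g' : Equiv.Perm α) :
    Commute (columnOp S j g) (permOp S k m g') := by
  refine LinearMap.ext fun f => funext fun x => ?_
  simp only [Module.End.mul_apply, columnOp_apply, permOp_apply]
  refine congrArg f (funext fun j' => ?_)
  rcases eq_or_ne j' j with rfl | h
  · simp [act, not_lt.2 hj]
  · simp [act, h]

section Proj

variable [DecidableEq α]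

theorem columnOp_mul_proj (j : Fin k) (a b : α) :
    columnOp S j (swap a b) * proj S j a = proj S j b * columnOp S j (swap a b) := by
  refine LinearMap.ext fun f => funext fun x => ?_
  simp only [Module.End.mul_apply, columnOp_apply, proj_apply, Function.update_self,
    Equiv.swap_apply_eq_iff, Equiv.swap_apply_left]

theorem commute_columnOp_proj {j j' : Fin k} (hj : j' ≠ j) (g : Equiv.Perm α) (a : α) :
    Commute (columnOp S j g) (proj S j' a) := by
  refine LinearMap.ext fun f => funext fun x => ?_
  simp only [Module.End.mul_apply, columnOp_apply, proj_apply, Function.update_of_ne hj]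

theorem commute_columnOp_opL [Fintype α] {m : ℕ} (hm : m < k) {j : Fin k} (hj : m < j)
    (g : Equiv.Perm α) : Commute (columnOp S j g) (opL S α hm) :=
  Commute.sum_right _ _ _ fun _ _ =>
    (commute_columnOp_proj (by rintro rfl; simp at hj) _ _).mul_right
      (Commute.sum_right _ _ _ fun _ _ => commute_columnOp_permOp hj _ _)

end Proj

variable [Fintype α] {i : ℕ} {d : Diagram k}

/-- Recoloring both rows preserves compatibility with `d` and is undone by the inverse recoloring,
so it is a symmetry of the matrix of `d`. -/
theorem commute_colorOp_diagramOp (hd : d ∈ diagrams k i) {F : Fin k → Equiv.Perm α}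
    (hF : ∀ j j' : Fin k, (j : ℕ) < i → (j' : ℕ) < i → F j = F j') :
    Commute (colorOp S F) (diagramOp S d) := by
  classical
  have hsat : ∀ x y : Fin k → α, Sat d (fun j => F j (x j)) (fun j => F j (y j)) ↔ Sat d x y := by
    intro x y
    constructor
    · intro h
      have := diagrams_sat_map hd h (fun j => (F j).symm) fun j j' hj hj' => by rw [hF j j' hj hj']
      simpa using this
    · intro h
      exact diagrams_sat_map hd h (fun j => F j) fun j j' hj hj' => by rw [hF j j' hj hj']
  refine LinearMap.ext fun f => funext fun x => ?_
  simp only [Module.End.mul_apply, diagramOp_apply, colorOp_apply]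
  rw [← Equiv.sum_comp (Equiv.piCongrRight F)]
  refine Finset.sum_congr rfl fun y _ => ?_
  change (if Sat d (fun j => F j (x j)) (fun j => F j (y j)) then _ else _) = _
  simp only [hsat]
  rfl

theorem commute_permOp_diagramOp (hd : d ∈ diagrams k i) {m : ℕ} (hm : i ≤ m)
    (g : Equiv.Perm α) : Commute (permOp S k m g) (diagramOp S d) := by
  rw [permOp_eq_colorOp]
  refine commute_colorOp_diagramOp hd fun j j' hj hj' => ?_
  rw [if_pos (by lia), if_pos (by lia)]

theorem commute_columnOp_diagramOp (hd : d ∈ diagrams k i) {j : Fin k} (hj : i ≤ j)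
    (g : Equiv.Perm α) : Commute (columnOp S j g) (diagramOp S d) := by
  refine commute_colorOp_diagramOp hd fun j₁ j₂ h₁ h₂ => ?_
  rw [Function.update_of_ne (by rintro rfl; lia), Function.update_of_ne (by rintro rfl; lia)]
  rfl

theorem commute_proj_diagramOp_of_sat [DecidableEq α] {j : Fin k}
    (hj : ∀ x y : Fin k → α, Sat d x y → x j = y j) (a : α) :
    Commute (proj S j a) (diagramOp S d) := by
  refine LinearMap.ext fun f => funext fun x => ?_
  simp only [Module.End.mul_apply, diagramOp_apply, proj_apply]
  split_ifs with hx
  · refine Finset.sum_congr rfl fun y _ => ?_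
    split_ifs with h1 h2
    · rfl
    · exact absurd ((hj x y h1).symm.trans hx) h2
    · rfl
  · refine (Finset.sum_eq_zero fun y _ => ?_).symm
    split_ifs with h1 h2
    · exact absurd ((hj x y h1).trans h2) hx
    · rfl
    · rfl

theorem commute_proj_diagramOp [DecidableEq α] (hd : d ∈ diagrams k i) {j : Fin k} (hj : i ≤ j)
    (a : α) : Commute (proj S j a) (diagramOp S d) :=
  commute_proj_diagramOp_of_sat (fun _ _ h => diagrams_sat_eq hd h hj) a

theorem commute_proj_diagramOp_half [DecidableEq α] {m : ℕ} (hm : m < k)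
    (hd : d ∈ diagramsHalf k m) (a : α) :
    Commute (proj S (⟨m, hm⟩ : Fin k) a) (diagramOp S d) :=
  commute_proj_diagramOp_of_sat (fun _ _ h => h (hd.2 ⟨m, hm⟩ rfl)) a

theorem commute_opL_diagramOp_half [DecidableEq α] {m : ℕ} (hm : m < k)
    (hd : d ∈ diagramsHalf k m) : Commute (opL S α hm) (diagramOp S d) :=
  Commute.sum_left _ _ _ fun _ _ => (commute_proj_diagramOp_half hm hd _).mul_left
    (Commute.sum_left _ _ _ fun _ _ => commute_permOp_diagramOp hd.1 le_rfl _)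

theorem commute_rep_of_mem_span {z : S} (hz : (Fintype.card α : S) = z) {D : Set (Diagram k)}
    {T : TensorEnd S k α} (hT : ∀ d ∈ D, Commute T (diagramOp S d)) {a : PAlg S z k}
    (ha : a ∈ Submodule.span S (PAlg.of z '' D)) : Commute T (rep hz a) := by
  induction ha using Submodule.span_induction with
  | mem x hx =>
    obtain ⟨d, hd, rfl⟩ := hx
    rw [rep_of]
    exact hT d hd
  | zero => rw [map_zero]; exact Commute.zero_right _
  | add x y _ _ hx hy => rw [map_add]; exact hx.add_right hy
  | smul c x _ hx => rw [rep_smul]; exact hx.smul_right c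

end ColorOp

section Abstract

variable {E ι : Type*} [Ring E] [Fintype ι] {q q' : ι → E} {P T T' : E}

/-- `T q = q (T P) q`, so `T` is recovered from `T P`. -/
theorem eq_of_mul_eq_of_compress (hq : ∑ a, q a = 1) (hP : ∀ a, q a * P * q a = q a)
    (hT : ∀ a, Commute (q a) T) (hT' : ∀ a, Commute (q a) T') (h : T * P = T' * P) : T = T' := by
  have key : ∀ T, (∀ a, Commute (q a) T) → ∀ a, T * q a = q a * (T * P) * q a := by
    intro T hT a
    rw [← mul_assoc, (hT a).eq, mul_assoc, mul_assoc, ← mul_assoc (q a) P, hP]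
  rw [← mul_one T, ← mul_one T', ← hq, Finset.mul_sum, Finset.mul_sum]
  exact Finset.sum_congr rfl fun a _ => by rw [key T hT, key T' hT', h]

/-- `T P` shows `T` only on the diagonal blocks `q a q' a`. The symmetries `Q a b` commute with `T`
and with every `q c` and carry `q' a` to `q' b`, so they move every block `q a q' b` to a diagonal
one. -/
theorem eq_of_mul_eq_of_swap (hq : ∑ a, q a = 1) (hq' : ∑ a, q' a = 1)
    (hP : ∀ a, P * (q a * q' a) = q a * q' a) {Q : ι → ι → E} (hQ : ∀ a b, Q a b * Q a b = 1)
    (hQq : ∀ a b c, Commute (Q a b) (q c)) (hQq' : ∀ a b, Q a b * q' a = q' b * Q a b)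
    (hT : ∀ a b, Commute (Q a b) T) (hT' : ∀ a b, Commute (Q a b) T') (h : T * P = T' * P) :
    T = T' := by
  have key : ∀ T, (∀ a b, Commute (Q a b) T) → ∀ a b,
      T * (q a * q' b) = Q a b * (T * P) * (q a * q' a) * Q a b := by
    intro T hT a b
    rw [mul_assoc (Q a b), mul_assoc T, hP, ← mul_assoc (Q a b), (hT a b).eq, mul_assoc T,
      ← mul_assoc (Q a b), (hQq a b a).eq, mul_assoc (q a), hQq', mul_assoc, mul_assoc, mul_assoc,
      hQ, mul_one]
  have hsum : ∀ T : E, T = ∑ a, ∑ b, T * (q a * q' b) := by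
    intro T
    simp only [← Finset.mul_sum, hq', mul_one, hq]
  rw [hsum T, hsum T']
  exact Finset.sum_congr rfl fun a _ => Finset.sum_congr rfl fun b _ => by
    rw [key T hT, key T' hT', h]

end Abstract

section Contraction

variable {S : Type*} [CommRing S] {k : ℕ} {α : Type*} [Fintype α] [DecidableEq α] {z : S}
  (hz : (Fintype.card α : S) = z) {m : ℕ}

omit [DecidableEq α] in
theorem commute_permOp_rep_p (hm : m < k) (g : Equiv.Perm α) :
    Commute (permOp S k m g) (rep hz (p z k (m + 1))) := by
  refine LinearMap.ext fun f => funext fun x => ?_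
  simp only [Module.End.mul_apply, rep_p hz hm, permOp_apply]
  refine Finset.sum_congr rfl fun c _ => congrArg f (funext fun j => ?_)
  rcases eq_or_ne j ⟨m, hm⟩ with rfl | h
  · simp [act]
  · simp [act, h]

theorem proj_mul_rep_p_mul_proj (hm : m < k) (a : α) :
    proj S (⟨m, hm⟩ : Fin k) a * rep hz (p z k (m + 1)) * proj S (⟨m, hm⟩ : Fin k) a =
      proj S (⟨m, hm⟩ : Fin k) a := by
  refine LinearMap.ext fun f => funext fun x => ?_
  simp only [Module.End.mul_apply, rep_p hz hm, proj_apply, Function.update_self,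
    Finset.sum_ite_eq', Finset.mem_univ, if_true]
  split_ifs with h
  · rw [← h, Function.update_eq_self]
  · rfl

theorem rep_p_mul_proj_mul_rep_p (hm : m < k) (a : α) :
    rep hz (p z k (m + 1)) * proj S (⟨m, hm⟩ : Fin k) a * rep hz (p z k (m + 1)) =
      rep hz (p z k (m + 1)) := by
  refine LinearMap.ext fun f => funext fun x => ?_
  simp only [Module.End.mul_apply, rep_p hz hm, proj_apply, Function.update_self,
    Finset.sum_ite_eq', Finset.mem_univ, if_true, Function.update_idem]

/-- Splitting by the color `b` of factor `m`, the middle operator becomes `J_b` on the first `m`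
factors. It commutes with `p`, and what remains is `p · proj_b · p = p`. -/
theorem rep_p_mul_pow_mul_rep_p (hm : m < k) (ε h : S) (n : ℕ) :
    rep hz (p z k (m + 1)) * signedShift ε h (opLHalf S α hm) ^ n * rep hz (p z k (m + 1)) =
      (∑ b, signedShift ε h (jucys (permOp S k m) b) ^ n) * rep hz (p z k (m + 1)) := by
  have hc : ∀ b, Commute (signedShift ε h (jucys (permOp S k m) b) ^ n)
      (rep hz (p z k (m + 1))) := fun b =>
    ((commute_signedShift (Commute.sum_right _ _ _ fun _ _ =>
      (commute_permOp_rep_p hz hm _).symm)).pow_right n).symm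
  rw [← one_mul (signedShift ε h (opLHalf S α hm) ^ n), ← sum_proj (⟨m, hm⟩ : Fin k),
    Finset.sum_mul, Finset.mul_sum, Finset.sum_mul, Finset.sum_mul]
  refine Finset.sum_congr rfl fun b _ => ?_
  rw [proj_mul_pow_opLHalf, mul_assoc, mul_assoc, (hc b).eq, ← mul_assoc, ← mul_assoc,
    rep_p_mul_proj_mul_rep_p]

theorem commute_permOp_sum_pow_jucys (ε h : S) (n : ℕ) {T : TensorEnd S k α}
    (hT : ∀ g, Commute T (permOp S k m g)) :
    Commute T (∑ b, signedShift ε h (jucys (permOp S k m) b) ^ n) :=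
  Commute.sum_right _ _ _ fun _ _ =>
    (commute_signedShift (Commute.sum_right _ _ _ fun _ _ => hT _)).pow_right n

theorem rep_contractionHalf (hm : m < k) (ε h : S) (n : ℕ) {w : PAlg S z k} (hw : w ∈ A z k m)
    (h' : rep hz w * rep hz (p z k (m + 1)) = rep hz (p z k (m + 1)) *
      signedShift ε h (opLHalf S α hm) ^ n * rep hz (p z k (m + 1))) :
    rep hz w = ∑ b, signedShift ε h (jucys (permOp S k m) b) ^ n :=
  eq_of_mul_eq_of_compress (sum_proj (⟨m, hm⟩ : Fin k)) (proj_mul_rep_p_mul_proj hz hm)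
    (fun a => commute_rep_of_mem_span hz (fun _ hd => commute_proj_diagramOp hd le_rfl a) hw)
    (fun a => commute_permOp_sum_pow_jucys ε h n fun g => (commute_permOp_proj le_rfl g a).symm)
    (h'.trans (rep_p_mul_pow_mul_rep_p hz hm ε h n))

theorem rep_pHalf_eq_sum (hm : m + 1 < k) : rep hz (pHalf z k (m + 1)) =
    ∑ a, proj S (⟨m, by lia⟩ : Fin k) a * proj S (⟨m + 1, hm⟩ : Fin k) (a : α) := by
  refine LinearMap.ext fun f => funext fun x => ?_
  rw [rep_pHalf hz hm, sum_proj_mul_apply, proj_apply]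
  simp only [eq_comm]

/-- The diagonal part of the powers of the Jucys–Murphy element. -/
def diagPow (S : Type*) [CommRing S] (α : Type*) [DecidableEq α] [Fintype α] (hm : m < k) (ε h : S)
    (n : ℕ) : TensorEnd S k α :=
  ∑ a, proj S (⟨m, hm⟩ : Fin k) a * signedShift ε h (opL S α hm) ^ n *
    proj S (⟨m, hm⟩ : Fin k) a

theorem commute_diagPow (hm : m < k) (ε h : S) (n : ℕ) {T : TensorEnd S k α}
    (hT : ∀ a, Commute T (proj S (⟨m, hm⟩ : Fin k) a)) (hT' : Commute T (opL S α hm)) :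
    Commute T (diagPow S α hm ε h n) :=
  Commute.sum_right _ _ _ fun a _ =>
    ((hT a).mul_right ((commute_signedShift hT').pow_right n)).mul_right (hT a)

theorem rep_pHalf_mul_proj (hm : m + 1 < k) (a : α) :
    rep hz (pHalf z k (m + 1)) *
        (proj S (⟨m, by lia⟩ : Fin k) a * proj S (⟨m + 1, hm⟩ : Fin k) a) =
      proj S (⟨m, by lia⟩ : Fin k) a * proj S (⟨m + 1, hm⟩ : Fin k) a := by
  refine LinearMap.ext fun f => funext fun x => ?_
  simp only [Module.End.mul_apply, rep_pHalf hz hm, proj_apply]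
  split_ifs <;> simp_all

theorem rep_pHalf_mul_pow_mul_rep_pHalf (hm : m + 1 < k) (ε h : S) (n : ℕ) :
    rep hz (pHalf z k (m + 1)) * signedShift ε h (opL S α (by lia : m < k)) ^ n *
        rep hz (pHalf z k (m + 1)) =
      diagPow S α (by lia : m < k) ε h n * rep hz (pHalf z k (m + 1)) := by
  set j : Fin k := ⟨m, by lia⟩ with hj
  set j' : Fin k := ⟨m + 1, hm⟩ with hj'
  set Y := signedShift ε h (opL S α (by lia : m < k)) ^ n with hY
  set P := rep (α := α) hz (pHalf z k (m + 1)) with hP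
  have hYc : ∀ a, Commute (proj S j' a) Y := fun a =>
    (commute_signedShift (commute_opL_proj _ j' (by simp [hj']) a).symm).pow_right n
  have h1 : ∀ a, P * proj S j a = proj S j a * proj S j' a := by
    intro a
    rw [hP, rep_pHalf_eq_sum hz hm, Finset.sum_mul, Finset.sum_eq_single a]
    · rw [mul_assoc, (commute_proj j' j a a).eq, ← mul_assoc, proj_mul_self]
    · intro b _ hb
      rw [mul_assoc, (commute_proj j' j b a).eq, ← mul_assoc, proj_mul_proj j hb, zero_mul]
    · simp
  have h2 : ∀ a, proj S j a * P = proj S j a * proj S j' a := by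
    intro a
    rw [hP, rep_pHalf_eq_sum hz hm, proj_mul_sum_proj_mul]
  have h3 : ∀ a, proj S j' a * P = proj S j a * proj S j' a := by
    intro a
    rw [hP, rep_pHalf_eq_sum hz hm, Finset.mul_sum, Finset.sum_eq_single a]
    · rw [← mul_assoc, (commute_proj j' j a a).eq, mul_assoc, proj_mul_self]
    · intro b _ hb
      rw [← mul_assoc, (commute_proj j' j a b).eq, mul_assoc, proj_mul_proj j' hb.symm, mul_zero]
    · simp
  rw [diagPow, Finset.sum_mul, ← one_mul (P * Y * P), ← sum_proj j, Finset.sum_mul]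
  refine Finset.sum_congr rfl fun a _ => ?_
  rw [← mul_assoc, ← mul_assoc, h2, mul_assoc (proj S j a), (hYc a).eq, mul_assoc, mul_assoc Y,
    h3, mul_assoc, mul_assoc, ← hj, h2]

/-- `pHalf` is the projector onto tensors whose factors `m` and `m + 1` have equal colors. Neither
`w` nor the diagonal part touches factor `m + 1`, so recoloring that factor alone reaches all
tensors. -/
theorem rep_contractionSucc (hm : m + 1 < k) (ε h : S) (n : ℕ) {w : PAlg S z k}
    (hw : w ∈ AHalf z k m)
    (h' : rep hz w * rep hz (pHalf z k (m + 1)) = rep hz (pHalf z k (m + 1)) *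
      signedShift ε h (opL S α (by lia : m < k)) ^ n * rep hz (pHalf z k (m + 1))) :
    rep hz w = diagPow S α (by lia : m < k) ε h n := by
  refine eq_of_mul_eq_of_swap (sum_proj (⟨m, by lia⟩ : Fin k)) (sum_proj (⟨m + 1, hm⟩ : Fin k))
    (rep_pHalf_mul_proj hz hm) (Q := fun a b => columnOp S (⟨m + 1, hm⟩ : Fin k) (swap a b))
    (fun a b => columnOp_mul_self (Equiv.swap_mul_self a b))
    (fun a b c => commute_columnOp_proj (by simp) _ c) (columnOp_mul_proj _) (fun a b => ?_)
    (fun a b => ?_) (h'.trans (rep_pHalf_mul_pow_mul_rep_pHalf hz hm ε h n))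
  · exact commute_rep_of_mem_span hz (fun _ hd => commute_columnOp_diagramOp hd le_rfl _)
      (AHalf_le_A hw)
  · exact commute_diagPow _ ε h n (fun c => commute_columnOp_proj (by simp) _ c)
      (commute_columnOp_opL _ (by simp) _)

end Contraction

end PartAlg

end

-- Fractions of Laurent series in the inverse of `u`.

noncomputable section

namespace PartAlg

section Fractions

/-- Both sides equal `Ox / Oy`: on the right the squares `Q` and `Z` cancel. The commutation
hypotheses justify each fraction and this cancellation. -/
theorem frac_eq_of_mul_eq {E : Type*} [Ring E] {a b D P Q Z Ox Oy : E} (hb : IsUnit b)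
    (hQ : IsUnit Q) (hZ : IsUnit Z) (hOy : IsUnit Oy) (hP : P = Z * Ox) (hD : D = Q * Oy)
    (hab : Commute a b) (hxy : Commute Ox Oy) (hxQ : Commute Ox Q) (hxZ : Commute Ox Z)
    (hyQ : Commute Oy Q) (hyZ : Commute Oy Z) (hQZ : Commute Q Z) (h : a * Oy = b * Ox) :
    IsFraction a b ∧ IsFraction P D ∧ IsFraction Q Z ∧ frac a b = frac P D * frac Q Z := by
  subst hP hD
  refine ⟨⟨hb, hab⟩, ⟨hQ.mul hOy, ?_⟩, ⟨hZ, hQZ⟩, ?_⟩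
  · exact (hQZ.symm.mul_left hxQ).mul_right (hyZ.symm.mul_left hxy)
  obtain ⟨b, rfl⟩ := hb
  obtain ⟨Q, rfl⟩ := hQ
  obtain ⟨Z, rfl⟩ := hZ
  obtain ⟨Oy, rfl⟩ := hOy
  have h1 : a = b * (Ox * ↑Oy⁻¹) := by
    rw [← mul_assoc, Units.eq_mul_inv_iff_mul_eq, h]
  have h2 : frac a (b : E) = Ox * ↑Oy⁻¹ := by
    rw [frac, Ring.inverse_unit, hab.units_inv_right.eq, Units.inv_mul_eq_iff_eq_mul, ← h1]
  have h3 : Commute (Ox * ↑Oy⁻¹) (Z : E) := hxZ.mul_left hyZ.units_inv_left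
  rw [h2, frac, frac, ← Units.val_mul, Ring.inverse_unit, Ring.inverse_unit, mul_inv_rev,
    Units.val_mul, mul_assoc, mul_assoc, mul_assoc, Units.inv_mul_cancel_left, ← mul_assoc Ox,
    h3.units_inv_right.eq, Units.mul_inv_cancel_left]

theorem sq_mul_one_sub_sq {E : Type*} [Ring E] {q g t : E} (h : q * g = 1) (h' : g * q = 1)
    (ht : Commute q t) : q ^ 2 * (1 - t ^ 2 * g ^ 2) = q ^ 2 - t ^ 2 := by
  have hq : q ^ 2 * g ^ 2 = 1 := by
    rw [← Commute.mul_pow (h.trans h'.symm), h, one_pow]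
  rw [mul_sub, mul_one, ← mul_assoc, (ht.pow_pow 2 2).eq, mul_assoc, hq, mul_one]

open PowerSeries

variable {S : Type*} [Ring S]

theorem commute_u (f : LaurentSeries S) : Commute u f := by
  ext n
  obtain ⟨m, rfl⟩ : ∃ m, n = m + -1 := ⟨n + 1, by ring⟩
  rw [u, HahnSeries.coeff_single_mul_add, HahnSeries.coeff_mul_single_add, one_mul, mul_one]

theorem u_mul_ofPowerSeries_X : u * HahnSeries.ofPowerSeries ℤ S X = 1 := by
  rw [u, HahnSeries.ofPowerSeries_X, HahnSeries.single_mul_single]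
  simp

theorem isUnit_u : IsUnit (u : LaurentSeries S) :=
  ⟨⟨u, HahnSeries.ofPowerSeries ℤ S X, u_mul_ofPowerSeries_X,
    (commute_u _).eq.symm.trans u_mul_ofPowerSeries_X⟩, rfl⟩

theorem isUnit_of_constantCoeff_eq_one {F : PowerSeries S} (hF : constantCoeff F = 1) :
    IsUnit F := by
  rw [PowerSeries.isUnit_iff_constantCoeff, hF]
  exact isUnit_one

theorem u_sub_C (y : S) :
    u - HahnSeries.C y = u * HahnSeries.ofPowerSeries ℤ S (1 - X * C y) := by
  rw [map_sub, map_one, map_mul, mul_sub, mul_one, ← mul_assoc, u_mul_ofPowerSeries_X, one_mul,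
    HahnSeries.ofPowerSeries_C]

theorem u_sub_C_sq (y : S) :
    (u - HahnSeries.C y) ^ 2 = u ^ 2 * HahnSeries.ofPowerSeries ℤ S ((1 - X * C y) ^ 2) := by
  rw [u_sub_C, (commute_u _).mul_pow, map_pow]

theorem commute_X_mul_C {q : PowerSeries S} {y : S} (h : Commute q (C y)) :
    Commute q (1 - X * C y) :=
  (Commute.one_right _).sub_right ((commute_X q).mul_right h)

theorem commute_geo_C {x y : S} (h : Commute x y) : Commute (geo x) (C y) :=
  (C_mul_geo_of_mul_eq h.symm.eq).symm

/-- With `X = u⁻¹`, the series `X · geo y` is `(u - y)⁻¹`; the last factor is thus `1 - (u - y)⁻²`.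
-/
theorem u_sub_C_sq_sub_one (y : S) : (u - HahnSeries.C y) ^ 2 - 1 =
    (u - HahnSeries.C y) ^ 2 * HahnSeries.ofPowerSeries ℤ S (1 - X ^ 2 * geo y ^ 2) := by
  have h1 : (1 - X * C y) ^ 2 * (1 - X ^ 2 * geo y ^ 2) = (1 - X * C y) ^ 2 - X ^ 2 :=
    sq_mul_one_sub_sq (mul_geo y) (geo_mul y) (commute_X _)
  have h3 : (u : LaurentSeries S) ^ 2 * HahnSeries.ofPowerSeries ℤ S (X ^ 2) = 1 := by
    rw [map_pow, ← (commute_u _).mul_pow, u_mul_ofPowerSeries_X, one_pow]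
  rw [u_sub_C_sq, mul_assoc, ← map_mul, h1, map_sub, mul_sub, h3]

theorem isUnit_u_sub_C_sq (y : S) : IsUnit ((u - HahnSeries.C y) ^ 2) := by
  rw [u_sub_C]
  exact (isUnit_u.mul (IsUnit.map (HahnSeries.ofPowerSeries ℤ S)
    (isUnit_of_constantCoeff_eq_one (by simp)))).pow 2

theorem commute_u_sub_C_sq {q : PowerSeries S} {y : S} (h : Commute q (C y)) :
    Commute (HahnSeries.ofPowerSeries ℤ S q) ((u - HahnSeries.C y) ^ 2) := by
  rw [u_sub_C]
  exact ((commute_u _).symm.mul_right ((commute_X_mul_C h).map _)).pow_right 2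

theorem commute_one_sub_X_sq_mul {q f : PowerSeries S} (h : Commute f q) :
    Commute (1 - X ^ 2 * f) q :=
  (Commute.one_left _).sub_left (((commute_X q).symm.pow_left 2).mul_left h)

/-- Translates a power series recursion into the stated fractions. The central unit `t` absorbs the
normalization: `-u` for the first recursion and `1` for the second. -/
theorem laurent_fractions {F G : PowerSeries S} {x y : S} {t : LaurentSeries S}
    (hFG : Commute F G) (hG : constantCoeff G = 1) (hxy : Commute x y) (ht : IsUnit t)
    (htc : ∀ f, Commute t f)
    (h : F * (1 - X ^ 2 * geo y ^ 2) = G * (1 - X ^ 2 * geo (-x) ^ 2)) :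
    IsFraction (t * HahnSeries.ofPowerSeries ℤ S F) (t * HahnSeries.ofPowerSeries ℤ S G) ∧
      IsFraction ((u + HahnSeries.C x) ^ 2 - 1) ((u - HahnSeries.C y) ^ 2 - 1) ∧
      IsFraction ((u - HahnSeries.C y) ^ 2) ((u + HahnSeries.C x) ^ 2) ∧
      frac (t * HahnSeries.ofPowerSeries ℤ S F) (t * HahnSeries.ofPowerSeries ℤ S G) =
        frac ((u + HahnSeries.C x) ^ 2 - 1) ((u - HahnSeries.C y) ^ 2 - 1) *
          frac ((u - HahnSeries.C y) ^ 2) ((u + HahnSeries.C x) ^ 2) := by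
  have hx : u + HahnSeries.C x = u - HahnSeries.C (-x) := by rw [map_neg, sub_neg_eq_add]
  rw [hx]
  have hxy' : Commute (-x) y := hxy.neg_left
  refine frac_eq_of_mul_eq (Ox := HahnSeries.ofPowerSeries ℤ S (1 - X ^ 2 * geo (-x) ^ 2))
    (Oy := HahnSeries.ofPowerSeries ℤ S (1 - X ^ 2 * geo y ^ 2))
    (ht.mul (IsUnit.map _ (isUnit_of_constantCoeff_eq_one hG))) (isUnit_u_sub_C_sq y)
    (isUnit_u_sub_C_sq (-x)) (IsUnit.map _ (isUnit_of_constantCoeff_eq_one (by simp)))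
    (u_sub_C_sq_sub_one (-x)) (u_sub_C_sq_sub_one y) ?_ ?_ ?_ ?_ ?_ ?_ ?_ ?_
  · exact ((Commute.refl t).mul_right (htc _)).mul_left ((htc _).symm.mul_right (hFG.map _))
  · exact (commute_one_sub_X_sq_mul (commute_one_sub_X_sq_mul
      ((commute_geo hxy').pow_pow 2 2).symm).symm).map _
  · exact commute_u_sub_C_sq (commute_one_sub_X_sq_mul ((commute_geo_C hxy').pow_left 2))
  · exact commute_u_sub_C_sq (commute_one_sub_X_sq_mul ((commute_geo_C (Commute.refl _)).pow_left 2))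
  · exact commute_u_sub_C_sq (commute_one_sub_X_sq_mul ((commute_geo_C (Commute.refl _)).pow_left 2))
  · exact commute_u_sub_C_sq (commute_one_sub_X_sq_mul ((commute_geo_C hxy'.symm).pow_left 2))
  · rw [u_sub_C_sq y]
    refine ((commute_u _).pow_left 2).mul_left (commute_u_sub_C_sq ?_)
    exact (commute_X_mul_C ((hxy'.map C))).symm.pow_left 2
  · rw [mul_assoc, mul_assoc, ← map_mul, ← map_mul, h]

/-- The series `1 - (c - 1) X - X ^ 2 ∑_j w_j X ^ j`. -/
def shiftedSeries (c : S) (w : ℕ → S) : PowerSeries S := 1 - X * C (c - 1) - X ^ 2 * mk w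

theorem map_mk {S' : Type*} [Ring S'] (f : S →+* S') (w : ℕ → S) :
    PowerSeries.map f (mk w) = mk fun j => f (w j) := by
  ext
  simp

theorem map_shiftedSeries {S' : Type*} [Ring S'] (f : S →+* S') (c : S) (w : ℕ → S) :
    PowerSeries.map f (shiftedSeries c w) = shiftedSeries (f c) fun j => f (w j) := by
  simp only [shiftedSeries, map_sub, map_mul, map_pow, map_one, map_X, map_C, map_mk]

theorem map_geo {S' : Type*} [Ring S'] (f : S →+* S') (y : S) :
    PowerSeries.map f (geo y) = geo (f y) := by
  ext
  simp [geo]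

theorem commute_mk {v w : ℕ → S} (h : ∀ i j, Commute (v i) (w j)) : Commute (mk v) (mk w) := by
  ext n
  rw [coeff_mul, coeff_mul, ← Finset.Nat.sum_antidiagonal_swap]
  refine Finset.sum_congr rfl fun p _ => ?_
  simpa using (h p.2 p.1).eq

theorem commute_shiftedSeries {c : S} (hc : ∀ a, Commute c a) {v w : ℕ → S}
    (h : ∀ i j, Commute (v i) (w j)) : Commute (shiftedSeries c v) (shiftedSeries c w) := by
  have hC : ∀ f : PowerSeries S, Commute (C (c - 1)) f := by
    intro f
    ext n
    rw [coeff_C_mul, coeff_mul_C]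
    exact ((hc _).sub_left (Commute.one_left _)).eq
  have hX : ∀ f : PowerSeries S, Commute (1 - X * C (c - 1)) f := fun f =>
    (Commute.one_left _).sub_left ((commute_X f).symm.mul_left (hC f))
  refine (hX _).sub_left (Commute.sub_right (hX _).symm ?_)
  exact ((commute_X _).symm.pow_left 2).mul_left
    (((commute_X _).pow_right 2).mul_right (commute_mk h))

/-- Factoring out `-u` exhibits the shifted `W_{i+1/2}` as a unit times a power series with constant
term `1`; this makes it invertible and matches it with `hat` on tensor space. -/
theorem neg_u_mul_shiftedSeries (c : S) (w : ℕ → S) :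
    -u * HahnSeries.ofPowerSeries ℤ S (shiftedSeries c w) =
      WHalf w + (HahnSeries.C c - u - 1) := by
  have h : (u : LaurentSeries S) * HahnSeries.ofPowerSeries ℤ S (X ^ 2) =
      HahnSeries.single (1 : ℤ) 1 := by
    rw [pow_two, map_mul, ← mul_assoc, u_mul_ofPowerSeries_X, one_mul, HahnSeries.ofPowerSeries_X]
  rw [shiftedSeries, map_sub, map_sub, map_one, map_mul _ X, map_mul _ (X ^ 2), neg_mul, mul_sub,
    mul_sub, ← mul_assoc, ← mul_assoc, u_mul_ofPowerSeries_X, h, HahnSeries.ofPowerSeries_C,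
    map_sub, map_one, WHalf, genSeries]
  noncomm_ring

end Fractions

end PartAlg

end

-- The recursions in the generic algebra.

noncomputable section

namespace PartAlg

section Contraction

variable {R : Type*} [CommRing R] {z : R} {k : ℕ}

/-- `w` is a sequence of elements of `M` such that `w_j q = q y ^ j q`. -/
def IsContraction (M : Submodule R (PAlg R z k)) (q y : PAlg R z k) (w : ℕ → PAlg R z k) : Prop :=
  ∀ j, w j ∈ M ∧ w j * q = q * y ^ j * q

theorem IsContraction.eq {M : Submodule R (PAlg R z k)} {q y : PAlg R z k}
    {v w : ℕ → PAlg R z k} (hM : Set.InjOn (fun a => a * q) M) (hv : IsContraction M q y v)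
    (hw : IsContraction M q y w) : v = w :=
  funext fun j => hM (hv j).1 (hw j).1 ((hv j).2.trans (hw j).2.symm)

theorem pHalf_mul_pHalf {m : ℕ} (hm : m + 1 < k) :
    pHalf z k (m + 1) * pHalf z k (m + 1) = pHalf z k (m + 1) := by
  refine of_mul_of_eq (fun x y h => ?_) (fun x b y h h' => ?_)
  · rw [sat_pHalfDiagram hm] at h
    obtain ⟨rfl, h⟩ := h
    refine ⟨y, ?_, fun b hb => ((sat_pHalfDiagram hm _ _).1 hb.1).1⟩
    simp only [sat_pHalfDiagram hm, h, and_self]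
  · rw [sat_pHalfDiagram hm] at h h' ⊢
    exact ⟨h'.1.trans h.1, h.2⟩

/-- Because `p_{m+3/2}` is idempotent. This makes `W_{m+1}` a power series with constant term `1`,
hence invertible. -/
theorem IsContraction.apply_zero {m : ℕ} (hm : m + 1 < k) {y : PAlg R z k} {w : ℕ → PAlg R z k}
    (hw : IsContraction (AHalf z k m) (pHalf z k (m + 1)) y w) : w 0 = 1 := by
  refine mul_pHalf_injOn hm (hw 0).1 (A_le_AHalf one_mem_A) ?_
  change w 0 * _ = 1 * _
  rw [(hw 0).2, pow_zero, mul_one, one_mul, pHalf_mul_pHalf hm]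

end Contraction

section Generic

variable {k : ℕ}

theorem commute_genericRep_of_mem_span {n : ℕ} {D : Set (Diagram k)}
    {T : TensorEnd ℤ k (Fin (2 * n))} (hT : ∀ d ∈ D, Commute T (diagramOp ℤ d)) {a : GenericAlg k}
    (ha : a ∈ Submodule.span (Polynomial ℤ) (PAlg.of _ '' D)) : Commute T (genericRep k n a) :=
  commute_rep_of_mem_span (z := (2 * n : ℤ)) (by simp) hT (baseChange_mem_span _ _ ha)

theorem genericRep_contractionHalf {m : ℕ} (hm : m < k) {w : ℕ → GenericAlg k}
    (hw : IsContraction (A _ k m) (p _ k (m + 1)) (genericXHalf k m) w) (n j : ℕ) :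
    genericRep k n (w j) =
      ∑ b, signedShift (1 : ℤ) (n : ℤ) (jucys (permOp ℤ k m) (b : Fin (2 * n))) ^ j := by
  have h := congrArg (genericRep k n) (hw j).2
  rw [map_mul, map_mul, map_mul, map_pow, genericRep_genericXHalf n hm] at h
  refine rep_contractionHalf (by simp) hm _ _ _ (baseChange_mem_span _ _ (hw j).1) ?_
  have hp : genericRep k n (p _ k (m + 1)) = rep (z := (2 * n : ℤ)) (by simp) (p _ k (m + 1)) := by
    rw [genericRep, RingHom.comp_apply, baseChange_p]
  rw [hp] at h
  exact h

theorem genericRep_contractionSucc {m : ℕ} (hm : m + 1 < k) {w : ℕ → GenericAlg k}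
    (hw : IsContraction (AHalf _ k m) (pHalf _ k (m + 1)) (genericX k (m + 1)) w) (n j : ℕ) :
    genericRep k n (w j) =
      diagPow ℤ (Fin (2 * n)) (by lia : m < k) (-1 : ℤ) (n : ℤ) j := by
  have h := congrArg (genericRep k n) (hw j).2
  rw [map_mul, map_mul, map_mul, map_pow, genericRep_genericX n (by lia)] at h
  refine rep_contractionSucc (by simp) hm _ _ _ (baseChange_mem_span _ _ (hw j).1) ?_
  have hp : genericRep k n (pHalf _ k (m + 1)) =
      rep (z := (2 * n : ℤ)) (by simp) (pHalf _ k (m + 1)) := by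
    rw [genericRep, RingHom.comp_apply, baseChange_pHalf]
  rw [hp] at h
  exact h

theorem generic_commute_contractionHalf {m : ℕ} (hm : m < k) {w : ℕ → GenericAlg k}
    (hw : IsContraction (A _ k m) (p _ k (m + 1)) (genericXHalf k m) w) (j : ℕ)
    {d : Diagram k} (hd : d ∈ diagrams k m) : Commute (w j) (.of _ d) := by
  refine genericRep_ext fun n _ => ?_
  rw [map_mul, map_mul, genericRep_of, genericRep_contractionHalf hm hw]
  exact (commute_permOp_sum_pow_jucys _ _ j fun g =>
    (commute_permOp_diagramOp hd le_rfl g).symm).symm.eq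

theorem generic_commute_contractionSucc {m : ℕ} (hm : m + 1 < k) {w : ℕ → GenericAlg k}
    (hw : IsContraction (AHalf _ k m) (pHalf _ k (m + 1)) (genericX k (m + 1)) w) (j : ℕ)
    {d : Diagram k} (hd : d ∈ diagramsHalf k m) : Commute (w j) (.of _ d) := by
  refine genericRep_ext fun n _ => ?_
  rw [map_mul, map_mul, genericRep_of, genericRep_contractionSucc hm hw]
  exact (commute_diagPow _ _ _ j (fun a => (commute_proj_diagramOp_half _ hd a).symm)
    (commute_opL_diagramOp_half _ hd).symm).symm.eq

theorem generic_commute_x_xHalf {m : ℕ} (hm : m < k) :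
    Commute (genericX k (m + 1)) (genericXHalf k m) := by
  refine genericRep_ext fun n _ => ?_
  rw [map_mul, map_mul, genericRep_genericX n hm, genericRep_genericXHalf n hm]
  exact (commute_signedShift (commute_signedShift (commute_opL_opLHalf hm).symm).symm).eq

theorem commute_opL_opLHalf_succ {S : Type*} [CommRing S] {α : Type*} [Fintype α] [DecidableEq α]
    {m : ℕ} (hm : m + 1 < k) : Commute (opL S α (by lia : m < k)) (opLHalf S α hm) :=
  Commute.sum_right _ _ _ fun _ _ => (commute_opL_proj _ _ (by simp) _).mul_right
    (Commute.sum_right _ _ _ fun _ _ => commute_opL_permOp _ _)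

theorem generic_commute_x_xHalf_succ {m : ℕ} (hm : m + 1 < k) :
    Commute (genericX k (m + 1)) (genericXHalf k (m + 1)) := by
  refine genericRep_ext fun n _ => ?_
  rw [map_mul, map_mul, genericRep_genericX n (by lia), genericRep_genericXHalf n hm]
  exact (commute_signedShift (commute_signedShift (commute_opL_opLHalf_succ hm).symm).symm).eq

open PowerSeries

theorem map_one_sub_X_sq_mul_geo {S S' : Type*} [Ring S] [Ring S'] (f : S →+* S') (y : S) :
    PowerSeries.map f (1 - X ^ 2 * geo y ^ 2) = 1 - X ^ 2 * geo (f y) ^ 2 := by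
  rw [map_sub, map_one, map_mul, map_pow, map_pow, map_X, map_geo]

theorem map_genericRep_ext {F G : PowerSeries (GenericAlg k)}
    (h : ∀ n, PowerSeries.map (genericRep k n) F = PowerSeries.map (genericRep k n) G) :
    F = G := by
  ext j
  refine genericRep_ext fun n _ => ?_
  rw [← coeff_map, h, coeff_map]

theorem map_shiftedSeries_contractionHalf {m : ℕ} (hm : m < k) {w : ℕ → GenericAlg k}
    (hw : IsContraction (A _ k m) (p _ k (m + 1)) (genericXHalf k m) w) (n : ℕ) :
    PowerSeries.map (genericRep k n)
        (shiftedSeries (algebraMap (Polynomial ℤ) _ Polynomial.X) w) =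
      hat (permOp ℤ k m : Equiv.Perm (Fin (2 * n)) →* _) (1 : ℤ) (n : ℤ) := by
  have h : mk (fun j => genericRep k n (w j)) =
      ∑ b, geo (signedShift (1 : ℤ) (n : ℤ) (jucys (permOp ℤ k m) (b : Fin (2 * n)))) := by
    ext j : 1
    rw [coeff_mk, genericRep_contractionHalf hm hw, map_sum]
    simp only [geo, coeff_mk]
  rw [map_shiftedSeries, shiftedSeries, hat, leadPoly, genericRep_algebraMap, Polynomial.eval_X,
    one_mul, map_sub (algebraMap ℤ _), map_one (algebraMap ℤ _), h]

theorem map_mk_contractionSucc {m : ℕ} (hm : m + 1 < k) {w : ℕ → GenericAlg k}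
    (hw : IsContraction (AHalf _ k m) (pHalf _ k (m + 1)) (genericX k (m + 1)) w) (n : ℕ) :
    PowerSeries.map (genericRep k n) (mk w) =
      diagSeries ℤ (Fin (2 * n)) (by lia : m < k) (-1 : ℤ) (n : ℤ) := by
  ext j : 1
  rw [coeff_map, coeff_mk, genericRep_contractionSucc hm hw, coeff_diagSeries, diagPow]

/-- On tensor space this is `hat_recursion` with `ε = 1`. -/
theorem generic_recursion_half {m : ℕ} (hm : m + 1 < k) {v w : ℕ → GenericAlg k}
    (hv : IsContraction (A _ k m) (p _ k (m + 1)) (genericXHalf k m) v)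
    (hw : IsContraction (A _ k (m + 1)) (p _ k (m + 2)) (genericXHalf k (m + 1)) w) :
    shiftedSeries (algebraMap (Polynomial ℤ) _ Polynomial.X) w *
        (1 - X ^ 2 * geo (genericXHalf k m) ^ 2) =
      shiftedSeries (algebraMap (Polynomial ℤ) _ Polynomial.X) v *
        (1 - X ^ 2 * geo (-genericX k (m + 1)) ^ 2) := by
  refine map_genericRep_ext fun n => ?_
  rw [map_mul, map_mul, map_one_sub_X_sq_mul_geo, map_one_sub_X_sq_mul_geo, map_shiftedSeries_contractionHalf (by lia) hv,
    map_shiftedSeries_contractionHalf hm hw, genericRep_genericXHalf n (by lia),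
    genericRep_neg_genericX n (by lia)]
  exact hat_recursion _ _ (by norm_num)

/-- With `ε = -1`, the two right factors are the products of `mk v` and of `mk w` with the same
`hat` at level `m + 1`; the identity then only says that `mk v` and `mk w` commute. -/
theorem generic_recursion_succ {m : ℕ} (hm : m + 2 < k) {v w : ℕ → GenericAlg k}
    (hv : IsContraction (AHalf _ k m) (pHalf _ k (m + 1)) (genericX k (m + 1)) v)
    (hw : IsContraction (AHalf _ k (m + 1)) (pHalf _ k (m + 2)) (genericX k (m + 2)) w) :
    mk w * (1 - X ^ 2 * geo (genericX k (m + 1)) ^ 2) =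
      mk v * (1 - X ^ 2 * geo (-genericXHalf k (m + 1)) ^ 2) := by
  have hvw : ∀ i j, Commute (w i) (v j) := by
    intro i j
    refine genericRep_ext fun n _ => ?_
    rw [map_mul, map_mul, genericRep_contractionSucc hm hw]
    refine (commute_genericRep_of_mem_span (fun d hd => ?_) (A_le_AHalf (AHalf_le_A (hv j).1))).eq
    exact (commute_diagPow _ _ _ i (fun a => (commute_proj_diagramOp_half _ hd a).symm)
      (commute_opL_diagramOp_half _ hd).symm).symm
  refine map_genericRep_ext fun n => ?_
  have hc : Commute (PowerSeries.map (genericRep k n) (mk w))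
      (PowerSeries.map (genericRep k n) (mk v)) := (commute_mk hvw).map _
  rw [map_mul, map_mul, map_one_sub_X_sq_mul_geo, map_one_sub_X_sq_mul_geo, genericRep_genericX n (by lia),
    genericRep_neg_genericXHalf n (by lia),
    ← diagSeries_mul_hat_succ (by lia : m < k) (n : ℤ) (by norm_num),
    ← diagSeries_mul_hat (by lia : m + 1 < k) (n : ℤ) (by norm_num),
    ← map_mk_contractionSucc (by lia) hv, ← map_mk_contractionSucc hm hw, ← mul_assoc,
    ← mul_assoc, hc.eq]

end Generic

-- Specialization to an arbitrary base ring.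

section Specialize

variable {R : Type*} [CommRing R] [Invertible (2 : R)] (z : R) {k : ℕ}

/-- Specialization of the generic partition algebra. -/
def specialize (k : ℕ) : GenericAlg k →+* PAlg R z k :=
  baseChange (Polynomial.eval₂RingHom (Int.castRingHom R) (⅟2 * z)) (by simp)

theorem specialize_algebraMap_X :
    specialize z k (algebraMap (Polynomial ℤ) _ Polynomial.X) = halfZ z k := by
  rw [specialize, baseChange_algebraMap, halfZ]
  simp

theorem specialize_genericX (m : ℕ) : specialize z k (genericX k m) = x z k m := by
  rw [genericX, map_sub, specialize_algebraMap_X, specialize, baseChange_L, x]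

theorem specialize_genericXHalf (m : ℕ) : specialize z k (genericXHalf k m) = xHalf z k m := by
  rw [genericXHalf, map_sub, specialize_algebraMap_X, specialize, baseChange_LHalf, xHalf]

/-- `R` need not be a quotient of `ℤ[h]`, so an element over `R` may not lift. Diagrams do lift, and
commuting with them suffices. -/
theorem commute_specialize_of_mem_span {D : Set (Diagram k)} {w : GenericAlg k}
    (hw : ∀ d ∈ D, Commute w (.of _ d)) {a : PAlg R z k}
    (ha : a ∈ Submodule.span R (PAlg.of z '' D)) : Commute (specialize z k w) a := by
  induction ha using Submodule.span_induction with
  | mem x hx =>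
    obtain ⟨d, hd, rfl⟩ := hx
    have := (hw d hd).map (specialize z k)
    rwa [specialize, baseChange_of] at this
  | zero => exact Commute.zero_right _
  | add x y _ _ hx hy => exact hx.add_right hy
  | smul c x _ hx => exact hx.smul_right c

theorem exists_generic_contractionHalf {m : ℕ} (hm : m < k) :
    ∃ w : ℕ → GenericAlg k, IsContraction (A _ k m) (p _ k (m + 1)) (genericXHalf k m) w ∧
      IsContractionHalf z k m fun j => specialize z k (w j) := by
  have h (j : ℕ) := exists_contraction (z := (2 * Polynomial.X : Polynomial ℤ)) hm
    (a := genericXHalf k m ^ j) (pow_mem_A (sub_mem (LHalf_mem_A hm) (algebraMap_mem_A _)) j)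
  choose w hw hw' using h
  refine ⟨w, fun j => ⟨hw j, hw' j⟩, fun j => ⟨baseChange_mem_span _ _ (hw j), ?_⟩⟩
  have := congrArg (specialize z k) (hw' j)
  simp only [map_mul, map_pow, specialize_genericXHalf] at this
  rwa [specialize, baseChange_p] at this

theorem exists_generic_contractionSucc {m : ℕ} (hm : m + 1 < k) :
    ∃ w : ℕ → GenericAlg k,
      IsContraction (AHalf _ k m) (pHalf _ k (m + 1)) (genericX k (m + 1)) w ∧
        IsContractionSucc z k m fun j => specialize z k (w j) := by
  have h (j : ℕ) := exists_contractionHalf (z := (2 * Polynomial.X : Polynomial ℤ)) hm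
    (a := genericX k (m + 1) ^ j)
    (pow_mem_A (sub_mem (L_mem_A (by lia)) (algebraMap_mem_A _)) j)
  choose w hw hw' using h
  refine ⟨w, fun j => ⟨hw j, hw' j⟩, fun j => ⟨baseChange_mem_span _ _ (hw j), ?_⟩⟩
  have := congrArg (specialize z k) (hw' j)
  simp only [map_mul, map_pow, specialize_genericX] at this
  rwa [specialize, baseChange_pHalf] at this

variable {z}

/-- The generic contraction exists and specializes to a contraction over `R`; uniqueness over `R`
identifies it with `w`. -/
theorem IsContractionHalf.exists_generic {m : ℕ} (hm : m < k) {w : ℕ → PAlg R z k}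
    (hw : IsContractionHalf z k m w) : ∃ w' : ℕ → GenericAlg k,
      IsContraction (A _ k m) (p _ k (m + 1)) (genericXHalf k m) w' ∧
        w = fun j => specialize z k (w' j) := by
  obtain ⟨w', h1, h2⟩ := exists_generic_contractionHalf z hm
  exact ⟨w', h1, IsContraction.eq (mul_p_injOn hm) hw h2⟩

theorem IsContractionSucc.exists_generic {m : ℕ} (hm : m + 1 < k) {w : ℕ → PAlg R z k}
    (hw : IsContractionSucc z k m w) : ∃ w' : ℕ → GenericAlg k,
      IsContraction (AHalf _ k m) (pHalf _ k (m + 1)) (genericX k (m + 1)) w' ∧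
        w = fun j => specialize z k (w' j) := by
  obtain ⟨w', h1, h2⟩ := exists_generic_contractionSucc z hm
  exact ⟨w', h1, IsContraction.eq (mul_pHalf_injOn hm) hw h2⟩

theorem IsContractionHalf.commute {m : ℕ} (hm : m < k) {w : ℕ → PAlg R z k}
    (hw : IsContractionHalf z k m w) (j : ℕ) {a : PAlg R z k} (ha : a ∈ A z k m) :
    Commute (w j) a := by
  obtain ⟨w', h, rfl⟩ := hw.exists_generic hm
  exact commute_specialize_of_mem_span z
    (fun _ hd => generic_commute_contractionHalf hm h j hd) ha

theorem IsContractionSucc.commute {m : ℕ} (hm : m + 1 < k) {w : ℕ → PAlg R z k}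
    (hw : IsContractionSucc z k m w) (j : ℕ) {a : PAlg R z k} (ha : a ∈ AHalf z k m) :
    Commute (w j) a := by
  obtain ⟨w', h, rfl⟩ := hw.exists_generic hm
  exact commute_specialize_of_mem_span z
    (fun _ hd => generic_commute_contractionSucc hm h j hd) ha

theorem commute_x_xHalf {m : ℕ} (hm : m < k) : Commute (x z k (m + 1)) (xHalf z k m) := by
  have := (generic_commute_x_xHalf hm).map (specialize z k)
  rwa [specialize_genericX, specialize_genericXHalf] at this

theorem commute_x_xHalf_succ {m : ℕ} (hm : m + 1 < k) :
    Commute (x z k (m + 1)) (xHalf z k (m + 1)) := by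
  have := (generic_commute_x_xHalf_succ hm).map (specialize z k)
  rwa [specialize_genericX, specialize_genericXHalf] at this

open PowerSeries

theorem recursion_half {m : ℕ} (hm : m + 1 < k) {v w : ℕ → PAlg R z k}
    (hv : IsContractionHalf z k m v) (hw : IsContractionHalf z k (m + 1) w) :
    shiftedSeries (halfZ z k) w * (1 - X ^ 2 * geo (xHalf z k m) ^ 2) =
      shiftedSeries (halfZ z k) v * (1 - X ^ 2 * geo (-x z k (m + 1)) ^ 2) := by
  obtain ⟨v', hv', rfl⟩ := hv.exists_generic (by lia)
  obtain ⟨w', hw', rfl⟩ := hw.exists_generic hm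
  have := congrArg (PowerSeries.map (specialize z k)) (generic_recursion_half hm hv' hw')
  simpa only [map_mul, map_one_sub_X_sq_mul_geo, map_shiftedSeries, specialize_algebraMap_X,
    specialize_genericXHalf, specialize_genericX, map_neg] using this

theorem recursion_succ {m : ℕ} (hm : m + 2 < k) {v w : ℕ → PAlg R z k}
    (hv : IsContractionSucc z k m v) (hw : IsContractionSucc z k (m + 1) w) :
    mk w * (1 - X ^ 2 * geo (x z k (m + 1)) ^ 2) =
      mk v * (1 - X ^ 2 * geo (-xHalf z k (m + 1)) ^ 2) := by
  obtain ⟨v', hv', rfl⟩ := hv.exists_generic (by lia)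
  obtain ⟨w', hw', rfl⟩ := hw.exists_generic hm
  have := congrArg (PowerSeries.map (specialize z k)) (generic_recursion_succ hm hv' hw')
  simpa only [map_mul, map_one_sub_X_sq_mul_geo, map_mk, specialize_genericXHalf,
    specialize_genericX, map_neg] using this

end Specialize

end PartAlg

end

theorem proposition6p1 {R : Type*} [CommRing R] [Invertible (2 : R)] (z : R) (k : ℕ) :
    -- the central elements `x_{i+1/2}^{(j)}` of `A_i(z)` and `x_{i+1}^{(j)}` of `A_{i+1/2}(z)`
    (∀ i, i + 1 ≤ k →
      (∃! w, PartAlg.IsContractionHalf z k i w) ∧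
      ∀ w, PartAlg.IsContractionHalf z k i w →
        ∀ j, ∀ a ∈ PartAlg.A z k i, Commute (w j) a) ∧
    (∀ i, i + 2 ≤ k →
      (∃! w, PartAlg.IsContractionSucc z k i w) ∧
      ∀ w, PartAlg.IsContractionSucc z k i w →
        ∀ j, ∀ a ∈ PartAlg.AHalf z k i, Commute (w j) a) ∧
    -- the recursion for `W_{i+1/2}(u)` (here `v` and `w` are the coefficients of `W_{i-1/2}(u)` and
    -- `W_{i+1/2}(u)`, and `y = x_{i-1/2}`, `x = x_i`)
    (∀ i, 1 ≤ i → i + 1 ≤ k → ∀ v w,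
      PartAlg.IsContractionHalf z k (i - 1) v → PartAlg.IsContractionHalf z k i w →
      ∀ y x : LaurentSeries (PartAlg.PAlg R z k),
      y = HahnSeries.C (PartAlg.xHalf z k (i - 1)) → x = HahnSeries.C (PartAlg.x z k i) →
      PartAlg.IsFraction (PartAlg.shiftedWHalf z k w) (PartAlg.shiftedWHalf z k v) ∧
      PartAlg.IsFraction ((PartAlg.u + x) ^ 2 - 1) ((PartAlg.u - y) ^ 2 - 1) ∧
      PartAlg.IsFraction ((PartAlg.u - y) ^ 2) ((PartAlg.u + x) ^ 2) ∧
      PartAlg.frac (PartAlg.shiftedWHalf z k w) (PartAlg.shiftedWHalf z k v) =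
        PartAlg.frac ((PartAlg.u + x) ^ 2 - 1) ((PartAlg.u - y) ^ 2 - 1) *
          PartAlg.frac ((PartAlg.u - y) ^ 2) ((PartAlg.u + x) ^ 2)) ∧
    -- the recursion for `W_{i+1}(u)` (here `v` and `w` are the coefficients of `W_i(u)` and
    -- `W_{i+1}(u)`, and `y = x_i`, `x = x_{i+1/2}`)
    (∀ i, 1 ≤ i → i + 2 ≤ k → ∀ v w,
      PartAlg.IsContractionSucc z k (i - 1) v → PartAlg.IsContractionSucc z k i w →
      ∀ y x : LaurentSeries (PartAlg.PAlg R z k),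
      y = HahnSeries.C (PartAlg.x z k i) → x = HahnSeries.C (PartAlg.xHalf z k i) →
      PartAlg.IsFraction (PartAlg.WSucc w) (PartAlg.WSucc v) ∧
      PartAlg.IsFraction ((PartAlg.u + x) ^ 2 - 1) ((PartAlg.u - y) ^ 2 - 1) ∧
      PartAlg.IsFraction ((PartAlg.u - y) ^ 2) ((PartAlg.u + x) ^ 2) ∧
      PartAlg.frac (PartAlg.WSucc w) (PartAlg.WSucc v) =
        PartAlg.frac ((PartAlg.u + x) ^ 2 - 1) ((PartAlg.u - y) ^ 2 - 1) *
          PartAlg.frac ((PartAlg.u - y) ^ 2) ((PartAlg.u + x) ^ 2)) := by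
  refine ⟨fun i hi => ⟨?_, fun w hw j a ha => hw.commute hi j ha⟩,
    fun i hi => ⟨?_, fun w hw j a ha => hw.commute hi j ha⟩, ?_, ?_⟩
  · obtain ⟨w, -, hw⟩ := PartAlg.exists_generic_contractionHalf z hi
    exact ⟨_, hw, fun v hv => PartAlg.IsContraction.eq (PartAlg.mul_p_injOn hi) hv hw⟩
  · obtain ⟨w, -, hw⟩ := PartAlg.exists_generic_contractionSucc z hi
    exact ⟨_, hw, fun v hv => PartAlg.IsContraction.eq (PartAlg.mul_pHalf_injOn hi) hv hw⟩
  · rintro i hi hik v w hv hw y x rfl rfl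
    obtain ⟨m, rfl⟩ : ∃ m, i = m + 1 := ⟨i - 1, by lia⟩
    rw [Nat.add_sub_cancel] at hv ⊢
    have hc : ∀ a, Commute (PartAlg.halfZ z k) a := fun a => Algebra.commutes _ a
    have h := PartAlg.laurent_fractions (t := -PartAlg.u)
      -- The coefficients of the numerator are central in `A_{m+1}`, which contains those of the
      -- denominator.
      (PartAlg.commute_shiftedSeries hc fun i j => hw.commute hik i (PartAlg.A_mono (by lia) (hv j).1))
      (by simp [PartAlg.shiftedSeries]) (PartAlg.commute_x_xHalf (by lia : m < k))
      PartAlg.isUnit_u.neg (fun f => (PartAlg.commute_u f).neg_left)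
      (PartAlg.recursion_half (by lia) hv hw)
    simpa only [PartAlg.shiftedWHalf, PartAlg.neg_u_mul_shiftedSeries] using h
  · rintro i hi hik v w hv hw y x rfl rfl
    obtain ⟨m, rfl⟩ : ∃ m, i = m + 1 := ⟨i - 1, by lia⟩
    rw [Nat.add_sub_cancel] at hv
    have h := PartAlg.laurent_fractions (t := 1)
      (PartAlg.commute_mk fun i j => hw.commute hik i
        (PartAlg.A_le_AHalf (PartAlg.AHalf_le_A (hv j).1)))
      (by simpa using PartAlg.IsContraction.apply_zero (by lia : m + 1 < k) hv)
      (PartAlg.commute_x_xHalf_succ (by lia : m + 1 < k)).symm isUnit_one Commute.one_left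
      (PartAlg.recursion_succ (by lia) hv hw)
    simpa only [PartAlg.WSucc, PartAlg.genSeries, one_mul] using h
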